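/- Let $\mathbb F$ be a field. Let $\mathrm{Com}$ be the category with objects the natural numbers $m\ge 0$ and morphism spaces $\mathrm{Com}(m,n)=\mathbb F[\mathrm{FinSet}(m,n)]$, the free vector space on the maps $\{1,\dots,m\}\to\{1,\dots,n\}$, and let $\mathrm{Ch}$ be the category of (unbounded) chain complexes over $\mathbb F$. A dg-functor $\Phi:\mathrm{Com}\to\mathrm{Ch}$ is an $\mathbb F$-linear functor. Its Hochschild complex is $C(\Phi)=\bigoplus_{n\ge 0}\Phi(n+1)[n]$ (so $C(\Phi)_p=\bigoplus_{n}\Phi(n+1)_{p-n}$) with differential, for $x\in\Phi(k)$ of degree $|x|$, $$d(x)=d_\Phi(x)+(-1)^{|x|}\sum_{i=1}^{k}(-1)^i\,\Phi(m^k_{i,i+1})(x)\qquad(k\ge 2),$$ and $d=d_\Phi$ on $\Phi(1)$, where $m^k_{i,i+1}\in\mathrm{Com}(k,k-1)$ multiplies the $i$-th and the $(i+1)$-st input and $m^k_{k,k+1}:=m^k_{k,1}$ multiplies the last input into the first. Let $\mathrm{Nat}$ be the complex of formal operations on the Hochschild complex: an element of $\mathrm{Nat}_l$ is a family of linear maps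 $\varphi_\Phi:C(\Phi)_p\to C(\Phi)_{p+l}$ ($p\in\mathbb Z$), one for every dg-functor $\Phi$, which is natural in the dg-enriched sense, i.e. $\varphi_\Psi\circ C(\theta)=(-1)^{lr}C(\theta)\circ\varphi_\Phi$ for every natural family $\theta$ of graded linear maps $\Phi(m)\to\Psi(m)$ of any degree $r$ (not necessarily commuting with the differentials), and the differential is $\varphi\mapsto d\varphi-(-1)^l\varphi d$. For $l\ge0$, a sequence $f=(f_n)_{n\ge 0}$ with $f_n\in\mathrm{Com}(n+1,n+l+1)$ defines an element of $\mathrm{Nat}_l$ by $x\mapsto(-1)^{l|x|}\Phi(f_n)(x)$ for $x\in\Phi(n+1)$. For $n\ge 1$ let $l_n^i\in\mathrm{Com}(n+1,n+1)$ be the sum $\sum_\sigma\mathrm{sgn}(\sigma)\,\sigma$ over all permutations $\sigma\in\Sigma_n$ with exactly $i-1$ descents, where $\sigma$ acts on $\{2,\dots,n+1\}$ and $1$ is fixed. Put $$(sh^k)_n=\sum_{i=1}^k\binom{n-i}{k-i}\,l_n^i\quad(1\le k\le n),\qquad (sh^0)_0=\mathrm{id},\qquad (sh^k)_n=0\text{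 otherwise}.$$ Let $B\in\mathrm{Nat}_1$ be the operation whose component in $\mathrm{Com}(l,l+1)$, $l\ge1$, is $B_l=\sum_{i=1}^{l}(-1)^{i(l+1)}g_i$, where $g_i(t)=t+i+1$ if $t+i+1\le l+1$ and $g_i(t)=t+i+1-l$ otherwise, and let $B^k=B\circ sh^k$. **Theorem.** The homology $H_*(\mathrm{Nat})$ is concentrated in degrees $0$ and $1$. Moreover: 1. The operations $sh^k$, $k\ge0$, are cycles of degree $0$. For every sequence $(c_k)_{k\ge0}$ in $\mathbb F$ the infinite sum $\sum_{k=0}^\infty c_k\,sh^k$, whose component on $\Phi(n+1)$ is the finite sum $\sum_{k=0}^n c_k (sh^k)_n$, is a cycle, and every element of $H_0(\mathrm{Nat})$ can be written as its class $\sum_{k=0}^\infty c_k[sh^k]$ for exactly one sequence $(c_k)$. 2. The operations $B^k$, $k\ge0$, are cycles of degree $1$. For every sequence $(c_k)_{k\ge0}$ in $\mathbb F$ the infinite sum $\sum_{k=0}^\infty c_k\,B^k$, whose component on $\Phi(n+1)$ is the finite sum $\sum_{k=0}^n c_k (B^k)_n$, is a cycle, and every element of $H_1(\mathrm{Nat})$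 can be written as its class $\sum_{k=0}^\infty c_k[B^k]$ for exactly one sequence $(c_k)$. -/

import Mathlib

open CategoryTheory
open scoped DirectSum

universe u

/-- The standard finite sets `{0, …, n - 1}`, one for each natural number `n`. -/
structure FinSetN where
  /-- the number of elements -/
  card : ℕ

/-- Morphisms of standard finite sets are all maps. -/
instance FinSetN.category : Category.{0} FinSetN where
  Hom m n := Fin m.card → Fin n.card
  id _ := fun i => i
  comp f g := fun i => g (f i)

/-- The PROP `Com` of unital commutative algebras: objects are the natural numbers, and the
morphism spaces are the free vector spaces `F[FinSet(m, n)]`. -/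
abbrev ComPROP (F : Type u) [Field F] : Type := Free F FinSetN

namespace ComPROP

variable (F : Type u) [Field F]

/-- The object `n` of `Com`. -/
def obj (n : ℕ) : ComPROP F := Free.of F (FinSetN.mk n)

/-- The basis element of `Com(m, n)` given by a map of finite sets. -/
noncomputable def ofFun {m n : ℕ} (f : Fin m → Fin n) : obj F m ⟶ obj F n :=
  (Free.embedding F FinSetN).map (X := FinSetN.mk m) (Y := FinSetN.mk n) f

theorem ofFun_comp {l m n : ℕ} (f : Fin l → Fin m) (g : Fin m → Fin n) :
    ofFun F f ≫ ofFun F g = ofFun F (fun i => g (f i)) :=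
  ((Free.embedding F FinSetN).map_comp (X := FinSetN.mk l) (Y := FinSetN.mk m)
    (Z := FinSetN.mk n) f g).symm

end ComPROP

/-- A dg-functor `Com ⥤ Ch`. Since `Com` is concentrated in degree zero, it is an `F`-linear
functor from `Com` to the category of (unbounded) chain complexes of `F`-vector spaces. -/
structure DGFunctor (F : Type u) [Field F] where
  /-- the underlying functor -/
  toFunctor : ComPROP F ⥤ ChainComplex (ModuleCat.{u} F) ℤ
  /-- it is additive on morphism spaces -/
  additive : toFunctor.Additive
  /-- it is linear on morphism spaces -/
  linear : toFunctor.Linear F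

namespace DGFunctor

variable {F : Type u} [Field F]

instance (Φ : DGFunctor F) : Φ.toFunctor.Additive := Φ.additive
instance (Φ : DGFunctor F) : Φ.toFunctor.Linear F := Φ.linear

/-- The degree `q` part of the chain complex `Φ(m)`. -/
abbrev X (Φ : DGFunctor F) (m : ℕ) (q : ℤ) : ModuleCat.{u} F :=
  (Φ.toFunctor.obj (ComPROP.obj F m)).X q

/-- The differential `d_Φ` of the chain complex `Φ(m)`. -/
def d (Φ : DGFunctor F) (m : ℕ) (q q' : ℤ) : Φ.X m q →ₗ[F] Φ.X m q' :=
  ((Φ.toFunctor.obj (ComPROP.obj F m)).d q q').hom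

/-- The map `Φ(f) : Φ(m)_q → Φ(n)_q` for `f ∈ Com(m, n)`; the degree of the target is only
required to be propositionally equal to `q`. -/
def act (Φ : DGFunctor F) {m n : ℕ} (f : ComPROP.obj F m ⟶ ComPROP.obj F n) (q q' : ℤ)
    (h : q = q') : Φ.X m q →ₗ[F] Φ.X n q' :=
  ((Φ.toFunctor.map f).f q ≫ ((Φ.toFunctor.obj (ComPROP.obj F n)).XIsoOfEq h).hom).hom

theorem d_d (Φ : DGFunctor F) (m : ℕ) (q q' q'' : ℤ) (x : Φ.X m q) :
    Φ.d m q' q'' (Φ.d m q q' x) = 0 := by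
  have := (Φ.toFunctor.obj (ComPROP.obj F m)).d_comp_d q q' q''
  exact congrArg (fun f => f.hom x) this

theorem d_act (Φ : DGFunctor F) {m n : ℕ} (f : ComPROP.obj F m ⟶ ComPROP.obj F n)
    (q q' r r' : ℤ) (h : q = q') (h' : r = r') (x : Φ.X m q) :
    Φ.d n q' r' (Φ.act f q q' h x) = Φ.act f r r' h' (Φ.d m q r x) := by
  subst h h'
  have := (Φ.toFunctor.map f).comm q r
  have h2 := congrArg (fun f => f.hom x) this
  simp only [ModuleCat.hom_comp, LinearMap.comp_apply] at h2
  simpa [act, d] using h2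

theorem act_act (Φ : DGFunctor F) {l m n : ℕ} (f : ComPROP.obj F l ⟶ ComPROP.obj F m)
    (g : ComPROP.obj F m ⟶ ComPROP.obj F n) (q q' q'' : ℤ) (h : q = q') (h' : q' = q'')
    (x : Φ.X l q) :
    Φ.act g q' q'' h' (Φ.act f q q' h x) = Φ.act (f ≫ g) q q'' (h.trans h') x := by
  subst h h'
  simp [act]

theorem act_zero (Φ : DGFunctor F) {m n : ℕ} (q q' : ℤ) (h : q = q') (x : Φ.X m q) :
    Φ.act (0 : ComPROP.obj F m ⟶ ComPROP.obj F n) q q' h x = 0 := by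
  subst h
  simp [act]

end DGFunctor

/-! ### The Hochschild complex of a dg-functor -/

namespace Hochschild

variable {F : Type u} [Field F]

/-- The map of finite sets `n + 2 → n + 1` (with elements numbered from `0`) which identifies
`i` with its cyclic successor `i + 1` (for the last element: with `0`), and is otherwise
injective and monotone. -/
def face (n : ℕ) (i : Fin (n + 2)) (j : Fin (n + 2)) : Fin (n + 1) :=
  ⟨(if (j : ℕ) ≤ i then (j : ℕ) else j - 1) % (n + 1), Nat.mod_lt _ n.succ_pos⟩

variable (F) in
/-- The Hochschild boundary `∑_{i = 1}^{k} (-1)^i m_{i, i+1} ∈ Com(k, k - 1)` for `k = n + 2`. -/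
noncomputable def bdry (n : ℕ) : ComPROP.obj F (n + 2) ⟶ ComPROP.obj F (n + 1) :=
  ∑ i : Fin (n + 2), (-1 : ℤ) ^ ((i : ℕ) + 1) • ComPROP.ofFun F (face n i)

theorem face_face (n : ℕ) (i : Fin (n + 2)) (j : Fin (n + 3)) (h : (j : ℕ) ≤ i)
    (t : Fin (n + 3)) :
    face n i (face (n + 1) j t) =
      face n ⟨j, lt_of_le_of_lt h i.isLt⟩ (face (n + 1) i.succ t) := by
  obtain ⟨i, hi⟩ := i
  obtain ⟨j, hj⟩ := j
  obtain ⟨t, ht⟩ := t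
  have key : ∀ a i n : ℕ, a < n + 2 → i < n + 2 → (if a ≤ i then a else a - 1) % (n + 1) =
      if a ≤ i then (if a = n + 1 then 0 else a) else a - 1 := by
    intro a i n ha hi
    split_ifs with h1 h2
    · simp [h2]
    · exact Nat.mod_eq_of_lt (by omega)
    · exact Nat.mod_eq_of_lt (by omega)
  simp only at h
  have e1 := key t j (n + 1) (by omega) (by omega)
  have e2 := key t (i + 1) (n + 1) (by omega) (by omega)
  simp only [face, Fin.mk.injEq, Fin.val_succ]
  rw [e1, e2, key _ i n (by split_ifs <;> omega) hi, key _ j n (by split_ifs <;> omega) (by omega)]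
  split_ifs <;> omega

theorem bdry_bdry (n : ℕ) : bdry F (n + 1) ≫ bdry F n = 0 := by
  simp only [bdry, Preadditive.comp_sum, Preadditive.sum_comp, ← Finset.sum_product']
  let P := Fin (n + 2) × Fin (n + 3)
  let S : Finset P := {ij : P | (ij.2 : ℕ) ≤ (ij.1 : ℕ)}
  rw [Finset.univ_product_univ, ← Finset.sum_add_sum_compl S, ← eq_neg_iff_add_eq_zero,
    ← Finset.sum_neg_distrib]
  let φ : ∀ ij : P, ij ∈ S → P := fun ij hij =>
    (Fin.castLT ij.2 (lt_of_le_of_lt (Finset.mem_filter.mp hij).right (Fin.is_lt ij.1)),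
      ij.1.succ)
  apply Finset.sum_bij φ
  · intro ij hij
    simp_rw [S, φ, Finset.compl_filter, Finset.mem_filter_univ, Fin.val_succ,
      Fin.val_castLT] at hij ⊢
    omega
  · rintro ⟨i, j⟩ hij ⟨i', j'⟩ hij' h
    rw [Prod.mk_inj]
    exact ⟨by simpa [φ] using! congr_arg Prod.snd h,
      by simpa [φ, Fin.castSucc_castLT] using! congr_arg Fin.castSucc (congr_arg Prod.fst h)⟩
  · rintro ⟨i', j'⟩ hij'
    simp_rw [S, Finset.compl_filter, Finset.mem_filter_univ, not_le] at hij'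
    refine ⟨(j'.pred <| ?_, Fin.castSucc i'), ?_, ?_⟩
    · rintro rfl
      simp only [Fin.val_zero, not_lt_zero] at hij'
    · simpa [S] using! Nat.le_sub_one_of_lt hij'
    · simp only [φ, Fin.castLT_castSucc, Fin.succ_pred]
  · rintro ⟨i, j⟩ hij
    have hij' : (j : ℕ) ≤ i := (Finset.mem_filter.mp hij).right
    simp only [Preadditive.zsmul_comp, Preadditive.comp_zsmul, smul_smul, ← neg_smul, φ,
      ComPROP.ofFun_comp]
    congr 1
    · simp only [Fin.val_succ, Fin.val_castLT, pow_add, pow_one]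
      ring
    · congr 1
      funext t
      exact face_face n i j hij' t

/-- The degree `p` part `⨁_{n ≥ 0} Φ(n + 1)_{p - n}` of the Hochschild complex
`C(Φ) = ⨁_{k ≥ 1} Φ(k)[k - 1]`. -/
abbrev X (Φ : DGFunctor F) (p : ℤ) : Type u := ⨁ n : ℕ, Φ.X (n + 1) (p - n)

/-- The Hochschild part of the differential, on the summand `Φ(n + 1)`: it sends `x` to
`(-1)^{|x|} ∑_i (-1)^i Φ(m_{i, i+1})(x)`, where `|x|` is the degree of `x` in `Φ(n + 1)`,
and it vanishes on the summand `Φ(1)`. -/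
noncomputable def dHoch (Φ : DGFunctor F) (p p' : ℤ) (h : p' + 1 = p) :
    ∀ n : ℕ, Φ.X (n + 1) (p - n) →ₗ[F] X Φ p'
  | 0 => 0
  | n + 1 => (p - (n + 1 : ℕ)).negOnePow •
      (DirectSum.lof F ℕ (fun n : ℕ => Φ.X (n + 1) (p' - n)) n ∘ₗ
        Φ.act (bdry F n) (p - (n + 1 : ℕ)) (p' - n) (by push_cast; omega))

/-- The differential of the Hochschild complex, the sum of `d_Φ` and of the Hochschild part. -/
noncomputable def dX (Φ : DGFunctor F) (p p' : ℤ) (h : p' + 1 = p) : X Φ p →ₗ[F] X Φ p' :=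
  DirectSum.toModule F ℕ (X Φ p') fun n =>
    DirectSum.lof F ℕ (fun n : ℕ => Φ.X (n + 1) (p' - n)) n ∘ₗ Φ.d (n + 1) (p - n) (p' - n) +
      dHoch Φ p p' h n

/-- Restriction of the differential to a summand. -/
theorem dX_lof (Φ : DGFunctor F) (p p' : ℤ) (h : p' + 1 = p) (n : ℕ) (x : Φ.X (n + 1) (p - n)) :
    dX Φ p p' h (DirectSum.lof F ℕ (fun n : ℕ => Φ.X (n + 1) (p - n)) n x) =
      DirectSum.lof F ℕ (fun n : ℕ => Φ.X (n + 1) (p' - n)) n (Φ.d (n + 1) (p - n) (p' - n) x) +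
        dHoch Φ p p' h n x := by
  simp [dX, DirectSum.toModule_lof]

theorem dX_dHoch (Φ : DGFunctor F) (p p' p'' : ℤ) (h : p' + 1 = p) (h' : p'' + 1 = p') (n : ℕ)
    (x : Φ.X (n + 1) (p - n)) :
    dX Φ p' p'' h' (dHoch Φ p p' h n x) =
      - dHoch Φ p' p'' h' n (Φ.d (n + 1) (p - n) (p' - n) x) := by
  obtain _ | n := n
  · simp [dHoch]
  subst h h'
  have e : (p'' + 1 - ((n + 1 : ℕ) : ℤ)).negOnePow =
      - (p'' + 1 + 1 - ((n + 1 : ℕ) : ℤ)).negOnePow := by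
    rw [show p'' + 1 + 1 - ((n + 1 : ℕ) : ℤ) = (p'' + 1 - ((n + 1 : ℕ) : ℤ)) + 1 by ring,
      Int.negOnePow_succ, neg_neg]
  have e2 : dHoch Φ (p'' + 1) p'' rfl n
      (Φ.act (bdry F n) (p'' + 1 + 1 - (n + 1 : ℕ)) (p'' + 1 - n) (by push_cast; omega) x) = 0 := by
    obtain _ | n := n
    · simp [dHoch]
    · simp only [dHoch, LinearMap.smul_apply, LinearMap.comp_apply, DGFunctor.act_act, bdry_bdry,
        DGFunctor.act_zero, map_zero, smul_zero]
  rw [dHoch]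
  simp only [LinearMap.smul_apply, LinearMap.comp_apply, map_zsmul_unit, dX_lof, e2, add_zero]
  rw [dHoch]
  simp only [LinearMap.smul_apply, LinearMap.comp_apply, e]
  rw [DGFunctor.d_act _ _ _ _ _ _ _ (show p'' + 1 - ((n + 1 : ℕ) : ℤ) = p'' - n by
    push_cast; omega)]
  simp

theorem dX_dX (Φ : DGFunctor F) (p p' p'' : ℤ) (h : p' + 1 = p) (h' : p'' + 1 = p') :
    dX Φ p' p'' h' ∘ₗ dX Φ p p' h = 0 := by
  refine DirectSum.linearMap_ext F fun n => LinearMap.ext fun x => ?_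
  simp only [LinearMap.comp_apply, dX_lof, map_add, dX_dHoch, DGFunctor.d_d, map_zero, zero_add,
    LinearMap.zero_apply]
  abel

end Hochschild

/-! ### Graded natural transformations -/

/-- An element of degree `r` of the morphism complex from `Φ` to `Ψ` in the dg-category of
dg-functors: a family of linear maps `Φ(m)_p → Ψ(m)_{p + r}`, natural with respect to all
morphisms of `Com`, but not required to commute with the differentials. -/
structure GradedTrans {F : Type u} [Field F] (Φ Ψ : DGFunctor F) (r : ℤ) where
  /-- the components -/
  app : ∀ (m : ℕ) (p p' : ℤ), p + r = p' → (Φ.X m p →ₗ[F] Ψ.X m p')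
  /-- naturality -/
  naturality : ∀ (m n : ℕ) (f : ComPROP.obj F m ⟶ ComPROP.obj F n) (p p' : ℤ) (h : p + r = p')
    (x : Φ.X m p), app n p p' h (Φ.act f p p rfl x) = Ψ.act f p' p' rfl (app m p p' h x)

namespace GradedTrans

variable {F : Type u} [Field F] {Φ Ψ : DGFunctor F} {r : ℤ}

theorem naturality' (θ : GradedTrans Φ Ψ r) {m n : ℕ} (f : ComPROP.obj F m ⟶ ComPROP.obj F n)
    (p p' q q' : ℤ) (h : p + r = p') (hq : p = q) (hq' : p' = q') (x : Φ.X m p) :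
    θ.app n q q' (by omega) (Φ.act f p q hq x) = Ψ.act f p' q' hq' (θ.app m p p' h x) := by
  subst hq hq'
  exact θ.naturality m n f p p' h x

/-- The differential `d_Ψ ∘ θ - (-1)^r θ ∘ d_Φ` of a graded natural transformation. -/
noncomputable def d (θ : GradedTrans Φ Ψ r) (r' : ℤ) (hr : r' + 1 = r) :
    GradedTrans Φ Ψ r' where
  app m p p' h := Ψ.d m (p' + 1) p' ∘ₗ θ.app m p (p' + 1) (by omega) -
    r.negOnePow • (θ.app m (p - 1) p' (by omega) ∘ₗ Φ.d m p (p - 1))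
  naturality m n f p p' h x := by
    simp only [LinearMap.sub_apply, LinearMap.smul_apply, LinearMap.comp_apply, map_sub,
      map_zsmul_unit]
    rw [Φ.d_act f p p (p - 1) (p - 1) rfl rfl, θ.naturality, θ.naturality,
      Ψ.d_act f _ _ p' p' rfl rfl]

/-- The map `C(θ) : C(Φ)_p → C(Ψ)_{p + r}` induced by a graded natural transformation. -/
noncomputable def hoch (θ : GradedTrans Φ Ψ r) (p p' : ℤ) (h : p + r = p') :
    Hochschild.X Φ p →ₗ[F] Hochschild.X Ψ p' :=
  DirectSum.toModule F ℕ (Hochschild.X Ψ p') fun n =>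
    DirectSum.lof F ℕ (fun n : ℕ => Ψ.X (n + 1) (p' - n)) n ∘ₗ
      θ.app (n + 1) (p - n) (p' - n) (by omega)

theorem hoch_lof (θ : GradedTrans Φ Ψ r) (p p' : ℤ) (h : p + r = p') (n : ℕ)
    (x : Φ.X (n + 1) (p - n)) :
    θ.hoch p p' h (DirectSum.lof F ℕ (fun n : ℕ => Φ.X (n + 1) (p - n)) n x) =
      DirectSum.lof F ℕ (fun n : ℕ => Ψ.X (n + 1) (p' - n)) n
        (θ.app (n + 1) (p - n) (p' - n) (by omega) x) := by
  simp [hoch, DirectSum.toModule_lof]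

theorem app_d_congr (θ : GradedTrans Φ Ψ r) (m : ℕ) (p a b p' : ℤ) (hab : a = b)
    (ha : a + r = p') (x : Φ.X m p) :
    θ.app m a p' ha (Φ.d m p a x) = θ.app m b p' (hab ▸ ha) (Φ.d m p b x) := by
  subst hab
  rfl

theorem d_app_congr (θ : GradedTrans Φ Ψ r) (m : ℕ) (p a b p' : ℤ) (hab : a = b)
    (ha : p + r = a) (x : Φ.X m p) :
    Ψ.d m a p' (θ.app m p a ha x) = Ψ.d m b p' (θ.app m p b (hab ▸ ha) x) := by
  subst hab
  rfl

/-- `C` is compatible with the differentials on morphisms. -/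
theorem dX_hoch (θ : GradedTrans Φ Ψ r) (r' : ℤ) (hr : r' + 1 = r) (p p' : ℤ)
    (h : p + r' = p') :
    Hochschild.dX Ψ (p' + 1) p' rfl ∘ₗ θ.hoch p (p' + 1) (by omega) =
      (θ.d r' hr).hoch p p' h +
        r.negOnePow • (θ.hoch (p - 1) p' (by omega) ∘ₗ
          Hochschild.dX Φ p (p - 1) (by omega)) := by
  refine DirectSum.linearMap_ext F fun n => LinearMap.ext fun x => ?_
  simp only [LinearMap.comp_apply, LinearMap.add_apply, LinearMap.smul_apply, hoch_lof,
    Hochschild.dX_lof, map_add, d, LinearMap.sub_apply, map_sub, map_zsmul_unit, smul_add]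
  rw [θ.app_d_congr (n + 1) (p - n) (p - 1 - n) (p - n - 1) (p' - n) (by omega),
    θ.d_app_congr (n + 1) (p - n) (p' + 1 - n) (p' - n + 1) (p' - n) (by omega)]
  have key : Hochschild.dHoch Ψ (p' + 1) p' rfl n
      (θ.app (n + 1) (p - n) (p' + 1 - n) (by omega) x) =
      r.negOnePow • θ.hoch (p - 1) p' (by omega)
        (Hochschild.dHoch Φ p (p - 1) (by omega) n x) := by
    obtain _ | n := n
    · simp [Hochschild.dHoch]
    · simp only [Hochschild.dHoch, LinearMap.smul_apply, LinearMap.comp_apply, map_zsmul_unit,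
        hoch_lof, smul_smul, ← Int.negOnePow_add]
      rw [θ.naturality' _ _ (p' + 1 - (n + 1 : ℕ)) _ _ (by omega) _ (by push_cast; omega)]
      congr 2
      omega
  rw [key]
  abel

theorem dX_hoch_apply (θ : GradedTrans Φ Ψ r) (r' : ℤ) (hr : r' + 1 = r) (p p₀ p' p₁ : ℤ)
    (h : p + r' = p') (h₀ : p₀ + 1 = p) (h₁ : p' + 1 = p₁) (x : Hochschild.X Φ p) :
    Hochschild.dX Ψ p₁ p' h₁ (θ.hoch p p₁ (by omega) x) =
      (θ.d r' hr).hoch p p' h x +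
        r.negOnePow • θ.hoch p₀ p' (by omega) (Hochschild.dX Φ p p₀ h₀ x) := by
  obtain rfl : p₀ = p - 1 := by omega
  subst h₁
  exact LinearMap.congr_fun (θ.dX_hoch r' hr p p' h) x

end GradedTrans

/-! ### The complex of formal operations -/

namespace FormalOp

open Hochschild

/-- Pairs of degrees with difference `l`. -/
structure DegPair (l : ℤ) where
  /-- the degree of the source -/
  src : ℤ
  /-- the degree of the target -/
  tgt : ℤ
  /-- the target is `l` above the source -/
  eq : src + l = tgt

/-- Families of linear maps `C(Φ)_p → C(Φ)_{p + l}`, one for each dg-functor `Φ` and each `p`. -/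
abbrev Family (F : Type u) [Field F] (l : ℤ) : Type (u + 1) :=
  ∀ (Φ : DGFunctor F) (t : DegPair l), X Φ t.src →ₗ[F] X Φ t.tgt

/-- Naturality of a family of degree `l` in all dg-functors `Φ`, in the enriched sense: it
commutes, up to the Koszul sign, with the maps `C(θ)` for all graded natural transformations. -/
def IsNatural {F : Type u} [Field F] {l : ℤ} (φ : Family F l) : Prop :=
  ∀ (Φ Ψ : DGFunctor F) (r : ℤ) (θ : GradedTrans Φ Ψ r) (p p' q q' : ℤ)
    (hp : p + r = p') (hq : q + r = q') (h : p + l = q) (h' : p' + l = q') (x : X Φ p),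
    φ Ψ ⟨p', q', h'⟩ (θ.hoch p p' hp x) =
      (l * r).negOnePow • θ.hoch q q' hq (φ Φ ⟨p, q, h⟩ x)

/-- The space of formal operations `C(Φ) → C(Φ)` of degree `l`: the families of linear maps of
degree `l` which are natural in all dg-functors `Φ`. -/
def op (F : Type u) [Field F] (l : ℤ) : Submodule F (Family F l) where
  carrier := {φ | IsNatural φ}
  zero_mem' := by
    intro Φ Ψ r θ p p' q q' hp hq h h' x
    simp
  add_mem' := by
    intro φ ψ hφ hψ Φ Ψ r θ p p' q q' hp hq h h' x
    simp only [Pi.add_apply, LinearMap.add_apply, map_add, smul_add,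
      hφ Φ Ψ r θ p p' q q' hp hq h h', hψ Φ Ψ r θ p p' q q' hp hq h h']
  smul_mem' := by
    intro c φ hφ Φ Ψ r θ p p' q q' hp hq h h' x
    simp only [Pi.smul_apply, LinearMap.smul_apply, map_smul,
      hφ Φ Ψ r θ p p' q q' hp hq h h']
    rw [smul_comm]

variable {F : Type u} [Field F]

/-- The differential `d ∘ φ - (-1)^l φ ∘ d` on families of degree `l`. -/
noncomputable def dFamily (l l' : ℤ) (hl : l' + 1 = l) : Family F l →ₗ[F] Family F l' where
  toFun φ := fun Φ t =>
    dX Φ (t.tgt + 1) t.tgt rfl ∘ₗ φ Φ ⟨t.src, t.tgt + 1, by have := t.eq; omega⟩ -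
    l.negOnePow • (φ Φ ⟨t.src - 1, t.tgt, by have := t.eq; omega⟩ ∘ₗ
      dX Φ t.src (t.src - 1) (by omega))
  map_add' φ ψ := by
    funext Φ t
    simp only [Pi.add_apply, LinearMap.add_comp, LinearMap.comp_add, smul_add]
    abel
  map_smul' c φ := by
    funext Φ t
    simp only [Pi.smul_apply, LinearMap.smul_comp, LinearMap.comp_smul, RingHom.id_apply,
      smul_sub]
    rw [smul_comm c]

theorem dFamily_apply (l l' : ℤ) (hl : l' + 1 = l) (φ : Family F l) (Φ : DGFunctor F)
    (p q : ℤ) (h : p + l' = q) (x : X Φ p) :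
    dFamily l l' hl φ Φ ⟨p, q, h⟩ x =
      dX Φ (q + 1) q rfl (φ Φ ⟨p, q + 1, by omega⟩ x) -
        l.negOnePow • φ Φ ⟨p - 1, q, by omega⟩ (dX Φ p (p - 1) (by omega) x) := rfl

theorem dFamily_mem (l l' : ℤ) (hl : l' + 1 = l) (φ : Family F l) (hφ : φ ∈ op F l) :
    dFamily l l' hl φ ∈ op F l' := by
  intro Φ Ψ r θ p p' q q' hp hq h h' x
  rw [dFamily_apply, dFamily_apply,
    hφ Φ Ψ r θ p p' (q + 1) (q' + 1) hp (by omega) (by omega) (by omega), map_zsmul_unit,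
    θ.dX_hoch_apply (r - 1) (by omega) (q + 1) q q' (q' + 1) (by omega) rfl rfl,
    θ.dX_hoch_apply (r - 1) (by omega) p (p - 1) (p' - 1) p' (by omega) (by omega) (by omega),
    map_add, map_zsmul_unit,
    hφ Φ Ψ r θ (p - 1) (p' - 1) q q' (by omega) hq (by omega) (by omega),
    hφ Φ Ψ (r - 1) (θ.d (r - 1) (by omega)) p (p' - 1) (q + 1) q' (by omega) (by omega)
      (by omega) (by omega), map_sub, map_zsmul_unit]
  simp only [smul_add, smul_sub, smul_smul, ← Int.negOnePow_add]
  have s1 : (l + l * (r - 1)).negOnePow = (l * r).negOnePow := by congr 1; ring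
  have s2 : (l' * r).negOnePow = (l * r + r).negOnePow := by
    rw [Int.negOnePow_eq_iff]
    exact ⟨-r, by subst hl; ring⟩
  have s3 : (l' * r + l).negOnePow = (l + (r + l * r)).negOnePow := by
    rw [Int.negOnePow_eq_iff]
    exact ⟨-r, by subst hl; ring⟩
  rw [s1, s2, s3]
  abel

theorem dFamily_dFamily (l l' l'' : ℤ) (hl : l' + 1 = l) (hl' : l'' + 1 = l') (φ : Family F l) :
    dFamily l' l'' hl' (dFamily l l' hl φ) = 0 := by
  funext Φ t
  obtain ⟨p, q, h⟩ := t
  refine LinearMap.ext fun x => ?_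
  have hd : ∀ (p p' p'' : ℤ) (h : p' + 1 = p) (h' : p'' + 1 = p') (x : X Φ p),
      dX Φ p' p'' h' (dX Φ p p' h x) = 0 := fun p p' p'' h h' x =>
    LinearMap.congr_fun (dX_dX Φ p p' p'' h h') x
  have e : l.negOnePow = - l'.negOnePow := by rw [← hl, Int.negOnePow_succ]
  simp only [dFamily_apply, map_sub, hd, map_zero, smul_zero, e, zero_sub, sub_zero,
    Units.neg_smul]
  simp

/-- The differential on formal operations. -/
noncomputable def dOp (l l' : ℤ) (hl : l' + 1 = l) : op F l →ₗ[F] op F l' :=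
  (dFamily l l' hl).restrict (dFamily_mem l l' hl)

variable (F) in
/-- The chain complex of formal operations on the Hochschild complex. -/
noncomputable def complex : ChainComplex (ModuleCat.{u + 1} F) ℤ where
  X l := ModuleCat.of F (op F l)
  d l l' := if hl : l' + 1 = l then ModuleCat.ofHom (dOp l l' hl) else 0
  shape l l' h := dif_neg h
  d_comp_d' l l' l'' h h' := by
    have h1 : l' + 1 = l := h
    have h2 : l'' + 1 = l' := h'
    rw [dif_pos h1, dif_pos h2, ← ModuleCat.ofHom_comp]
    ext φ : 2
    exact Subtype.ext (dFamily_dFamily l l' l'' h1 h2 φ.1)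

/-- The family of maps given by elements `f_n ∈ Com(n + 1, n + l + 1)`: on `Φ(n + 1)` it applies
`Φ(f_n)`, with the Koszul sign `(-1)^{l |x|}` for moving the degree `l` operation past
`x ∈ Φ(n + 1)` of degree `|x|`. -/
noncomputable def familyOf (l : ℕ)
    (f : ∀ n : ℕ, ComPROP.obj F (n + 1) ⟶ ComPROP.obj F (n + l + 1)) : Family F l :=
  fun Φ t => DirectSum.toModule F ℕ (X Φ t.tgt) fun n =>
    ((l : ℤ) * (t.src - n)).negOnePow •
      (DirectSum.lof F ℕ (fun n : ℕ => Φ.X (n + 1) (t.tgt - n)) (n + l) ∘ₗ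
        Φ.act (f n) (t.src - n) (t.tgt - (n + l : ℕ)) (by have := t.eq; push_cast; omega))

theorem familyOf_lof (l : ℕ)
    (f : ∀ n : ℕ, ComPROP.obj F (n + 1) ⟶ ComPROP.obj F (n + l + 1)) (Φ : DGFunctor F)
    (p q : ℤ) (h : p + l = q) (n : ℕ) (x : Φ.X (n + 1) (p - n)) :
    familyOf l f Φ ⟨p, q, h⟩ (DirectSum.lof F ℕ (fun n : ℕ => Φ.X (n + 1) (p - n)) n x) =
      ((l : ℤ) * (p - n)).negOnePow •
        DirectSum.lof F ℕ (fun n : ℕ => Φ.X (n + 1) (q - n)) (n + l)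
          (Φ.act (f n) (p - n) (q - (n + l : ℕ)) (by push_cast; omega) x) := by
  simp [familyOf, DirectSum.toModule_lof]

theorem familyOf_mem (l : ℕ)
    (f : ∀ n : ℕ, ComPROP.obj F (n + 1) ⟶ ComPROP.obj F (n + l + 1)) :
    familyOf l f ∈ op F l := by
  intro Φ Ψ r θ p p' q q' hp hq h h' x
  induction x using DirectSum.induction_on with
  | zero => simp
  | add x y hx hy => simp only [map_add, hx, hy, smul_add]
  | of n x =>
    change familyOf l f Ψ ⟨p', q', h'⟩ (θ.hoch p p' hp
      (DirectSum.lof F ℕ (fun n : ℕ => Φ.X (n + 1) (p - n)) n x)) =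
      _ • θ.hoch q q' hq (familyOf l f Φ ⟨p, q, h⟩
        (DirectSum.lof F ℕ (fun n : ℕ => Φ.X (n + 1) (p - n)) n x))
    rw [θ.hoch_lof, familyOf_lof, familyOf_lof, map_zsmul_unit, θ.hoch_lof,
      θ.naturality' (f n) (p - n) (p' - n) _ (q' - (n + l : ℕ)) (by omega) _
        (by push_cast; omega), smul_smul, ← Int.negOnePow_add]
    congr 2
    subst hp
    ring

/-- The formal operation of degree `l` given by elements `f_n ∈ Com(n + 1, n + l + 1)`. -/
noncomputable def ofComponents (l : ℕ)
    (f : ∀ n : ℕ, ComPROP.obj F (n + 1) ⟶ ComPROP.obj F (n + l + 1)) : op F l :=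
  ⟨familyOf l f, familyOf_mem l f⟩

/-! ### Shuffle operations and Connes' operator -/

/-- The number of descents of a permutation, i.e. of `i` with `σ(i) > σ(i + 1)`. -/
def descents {n : ℕ} (σ : Equiv.Perm (Fin n)) : ℕ :=
  Finset.card {i : Fin n | ∃ h : (i : ℕ) + 1 < n, σ ⟨i + 1, h⟩ < σ i}

variable (F) in
/-- A permutation of `n` elements as an element of `Com(n + 1, n + 1)`, fixing the first element
and permuting the others. -/
noncomputable def ofPerm {n : ℕ} (σ : Equiv.Perm (Fin n)) :
    ComPROP.obj F (n + 1) ⟶ ComPROP.obj F (n + 1) :=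
  ComPROP.ofFun F (Fin.cons 0 fun i => (σ i).succ)

variable (F) in
/-- Loday's elements `l_n^k`: for `n ≥ 1` the signed sum over the permutations of `n` elements
with `k - 1` descents; `l_0^0 = 1` and `l_0^k = 0` for `k > 0`. -/
noncomputable def loday (k n : ℕ) : ComPROP.obj F (n + 1) ⟶ ComPROP.obj F (n + 1) :=
  if n = 0 then (if k = 0 then 𝟙 _ else 0)
  else ∑ σ : Equiv.Perm (Fin n) with descents σ + 1 = k,
    (Equiv.Perm.sign σ : ℤ) • ofPerm F σ

variable (F) in
/-- The component `sh_n^k ∈ Com(n + 1, n + 1)` of the shuffle operation: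
`∑_{i = 1}^k binom(n - i, k - i) l_n^i` for `1 ≤ k ≤ n`, the identity for `k = n = 0`, and
zero otherwise. -/
noncomputable def sh (k n : ℕ) : ComPROP.obj F (n + 1) ⟶ ComPROP.obj F (n + 1) :=
  if n = 0 ∧ k = 0 then 𝟙 _
  else if 1 ≤ k ∧ k ≤ n then ∑ i ∈ Finset.Icc 1 k, ((n - i).choose (k - i) : ℤ) • loday F i n
  else 0

/-- The map `g_i` from `{0, …, n}` to `{0, …, n + 1}`, a cyclic permutation (`t ↦ t + i` modulo
`n + 1`) followed by the monotone injection which misses `0`. -/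
def rot (n i : ℕ) (t : Fin (n + 1)) : Fin (n + 2) :=
  Fin.succ ⟨((t : ℕ) + i) % (n + 1), Nat.mod_lt _ n.succ_pos⟩

variable (F) in
/-- The component `B_{n + 1} = ∑_{i = 1}^{n + 1} (-1)^{i (n + 2)} g_i ∈ Com(n + 1, n + 2)` of
Connes' operator. -/
noncomputable def connes (n : ℕ) : ComPROP.obj F (n + 1) ⟶ ComPROP.obj F (n + 1 + 1) :=
  ∑ i ∈ Finset.Icc 1 (n + 1), (-1 : ℤ) ^ (i * (n + 2)) • ComPROP.ofFun F (rot n i)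

variable (F) in
/-- The component in `Com(n + 1, n + 2)` of `B^k = B ∘ sh^k` (first `sh^k`, then `B`). -/
noncomputable def bsh (k n : ℕ) : ComPROP.obj F (n + 1) ⟶ ComPROP.obj F (n + 1 + 1) :=
  sh F k n ≫ connes F n

variable (F) in
/-- The formal operation `sh^k`, of degree `0`. -/
noncomputable def shOp (k : ℕ) : op F 0 := ofComponents 0 fun n => sh F k n

variable (F) in
/-- The formal operation `B^k`, of degree `1`. -/
noncomputable def bOp (k : ℕ) : op F 1 := ofComponents 1 fun n => bsh F k n

/-- The infinite sum `∑_k c_k sh^k`; its component on `Φ(n + 1)` is the finite sum over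
`k ≤ n`, since `sh_n^k = 0` for `k > n`. -/
noncomputable def shSum (c : ℕ → F) : op F 0 :=
  ofComponents 0 fun n => ∑ k ∈ Finset.range (n + 1), c k • sh F k n

/-- The infinite sum `∑_k c_k B^k`; its component on `Φ(n + 1)` is the finite sum over `k ≤ n`. -/
noncomputable def bSum (c : ℕ → F) : op F 1 :=
  ofComponents 1 fun n => ∑ k ∈ Finset.range (n + 1), c k • bsh F k n

/-- The formal operation `φ` is a cycle, and `x` is its homology class. -/
def HasClass {l : ℤ} (φ : op F l) (x : (complex F).homology l) : Prop :=
  ∃ z : (complex F).cycles l,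
    (complex F).iCycles l z = φ ∧ (complex F).homologyπ l z = x

end FormalOp

/-! By the Yoneda lemma a formal operation of degree `l` is a family of elements of `Com(n + 1, n +
l + 1)`, one for each `n` with `n + l ≥ 0`. Naturality holds for all graded transformations, so the
value on the identity in `Com(n + 1, -)` determines the operation and may be prescribed freely
(`apply_component`, `family`). The differential becomes postcomposition with the Hochschild boundary
minus `(-1)^l` times precomposition with it (`comp_dFamily`). Thus `Nat` is the product total
complex of a double complex with columns indexed by `n`.

Up to sign, column `n` is the complex of unnormalized chains on the power `(S^1)^{n + 1}` of the
simplicial circle. The horizontal direction is simplicial too, so the Dold-Kan projection `nproj`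
replaces the column by elements that are killed by deleting any coordinate but the first
(`IsCyc.sub_normalize`). Their homology is `H(S^1)` tensored with `n` copies of the reduced homology
of `S^1`: one-dimensional in dimensions `n` and `n + 1`, which are the total degrees `0` and `1`. It
is detected by the functionals `lamZero` and `lamOne` (`exists_comp_bdry_eq`).

The operations `sh^n` and `B^n` vanish in the columns before `n`, and in column `n` the
corresponding functional takes the value `1` on them. They are cycles. For `sh^k` this follows from
the Adams operations, signed sums over colourings of the permutations that sort them. These commute
with the boundary by cancellation of terms (`adams_comp_bdry`) and are the sums of the `binom(k, j)
sh^j`. That relation is triangular with ones on the diagonal, so the `sh^k` commute with the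
boundary over every field. For `B^k` one adds that Connes' operator anticommutes with the boundary
(`connes_comp_bdry`).

A cycle is then compared with the generators column by column. The horizontal differential raises
`n`, so after the earlier columns are settled the error in column `n` is a normalized vertical
cycle, hence a multiple of the generator plus a vertical boundary. The product allows infinitely
many such corrections (`exists_dHom_eq`). For uniqueness, the functional of the first nonzero
coefficient vanishes on vertical boundaries. It also vanishes on the horizontal contribution,
because the classes of one degree higher in the preceding column extend to cycles
(`eq_zero_of_isBdry`). -/

/-! ### Representable functors and the components of a formal operation -/

namespace FormalOp

open Hochschild

variable {F : Type u} [Field F]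

variable (F) in
/-- The space `Com(n + 1, m + 1)`. -/
abbrev Com (n m : ℕ) : Type u := ComPROP.obj F (n + 1) ⟶ ComPROP.obj F (m + 1)

variable (F) in
/-- The functor `Com(n + 1, -)`, repeated in every degree, with zero differentials. -/
noncomputable def rep (n : ℕ) : DGFunctor F where
  toFunctor :=
    { obj := fun k =>
        { X := fun _ => ModuleCat.of F (ComPROP.obj F (n + 1) ⟶ k)
          d := fun _ _ => 0 }
      map := fun g => { f := fun _ => ModuleCat.ofHom (Linear.rightComp F _ g) }
      map_id := fun k => by ext i x; exact Category.comp_id (obj := ComPROP F) x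
      map_comp := fun f g => by
        ext i x; exact (Category.assoc (obj := ComPROP F) x f g).symm }
  additive := ⟨fun {_ _ f g} => by
    ext i x; exact Preadditive.comp_add (C := ComPROP F) _ _ _ x f g⟩
  linear := ⟨fun f r => by
    ext i x; exact Linear.comp_smul (C := ComPROP F) _ _ _ x r f⟩

/-- Elements of `Com(n + 1, m)` as elements of the representable functor. -/
noncomputable def toRep (n m : ℕ) (q : ℤ) :
    (ComPROP.obj F (n + 1) ⟶ ComPROP.obj F m) ≃ₗ[F] (rep F n).X m q :=
  LinearEquiv.refl F (ComPROP.obj F (n + 1) ⟶ ComPROP.obj F m)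

theorem rep_d (n m : ℕ) (q q' : ℤ) : (rep F n).d m q q' = 0 := rfl

theorem rep_act (n : ℕ) {m k : ℕ} (f : ComPROP.obj F m ⟶ ComPROP.obj F k) (q q' : ℤ)
    (h : q = q') (x : ComPROP.obj F (n + 1) ⟶ ComPROP.obj F m) :
    (rep F n).act f q q' h (toRep n m q x) = toRep n k q' (x ≫ f) := by
  subst h
  rfl

end FormalOp

namespace DGFunctor

variable {F : Type u} [Field F] (Φ : DGFunctor F)

theorem act_add {m n : ℕ} (f g : ComPROP.obj F m ⟶ ComPROP.obj F n) (q q' : ℤ)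
    (h : q = q') (x : Φ.X m q) :
    Φ.act (f + g) q q' h x = Φ.act f q q' h x + Φ.act g q q' h x := by
  subst h
  simp [act, Functor.map_add]

theorem act_smul (c : F) {m n : ℕ} (f : ComPROP.obj F m ⟶ ComPROP.obj F n) (q q' : ℤ)
    (h : q = q') (x : Φ.X m q) :
    Φ.act (c • f) q q' h x = c • Φ.act f q q' h x := by
  subst h
  simp [act, Functor.map_smul]

theorem act_id {m : ℕ} (q : ℤ) (x : Φ.X m q) :
    Φ.act (𝟙 (ComPROP.obj F m)) q q rfl x = x := by
  simp [act]

end DGFunctor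

namespace FormalOp

open Hochschild

variable {F : Type u} [Field F]

/-- The graded transformation from `Com(n + 1, -)` given by an element `x ∈ Φ(n + 1)_r`; it
vanishes outside degree `0`. -/
noncomputable def yoneda (Φ : DGFunctor F) (n : ℕ) (r : ℤ) (x : Φ.X (n + 1) r) :
    GradedTrans (rep F n) Φ r where
  app m p p' h :=
    if hp : p = 0 then
      { toFun := fun g => Φ.act ((toRep n m p).symm g) r p' (by omega) x
        map_add' := fun f g => by rw [map_add, Φ.act_add]
        map_smul' := fun c f => by rw [map_smul, Φ.act_smul]; rfl }
    else 0
  naturality m k f p p' h g := by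
    by_cases hp : p = 0
    · obtain ⟨g, rfl⟩ := (toRep n m p).surjective g
      simp only [hp, dif_pos, LinearMap.coe_mk, AddHom.coe_mk]
      rw [rep_act]
      simp only [LinearEquiv.symm_apply_apply, Φ.act_act]
    · simp [hp]

theorem yoneda_app (Φ : DGFunctor F) (n : ℕ) (r : ℤ) (x : Φ.X (n + 1) r) (m : ℕ) (p p' : ℤ)
    (h : p + r = p') (hp : p = 0) (g : (rep F n).X m p) :
    (yoneda Φ n r x).app m p p' h g = Φ.act ((toRep n m p).symm g) r p' (by omega) x := by
  simp only [yoneda, hp, dif_pos]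
  rfl

theorem yoneda_app_ne (Φ : DGFunctor F) (n : ℕ) (r : ℤ) (x : Φ.X (n + 1) r) (m : ℕ) (p p' : ℤ)
    (h : p + r = p') (hp : p ≠ 0) (g : (rep F n).X m p) :
    (yoneda Φ n r x).app m p p' h g = 0 := by
  simp [yoneda, hp]

variable (F) in
/-- The universal element of `C(Com(n + 1, -))` in degree `p`. -/
noncomputable def univ (n : ℕ) (p : ℤ) : X (rep F n) p :=
  DirectSum.lof F ℕ (fun k : ℕ => (rep F n).X (k + 1) (p - k)) n
    (toRep n (n + 1) (p - n) (𝟙 (ComPROP.obj F (n + 1))))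

/-- Every element of a summand of `C(Φ)` is an image of the universal one, whether or not it is a
cycle and whatever its degree. This is where naturality for graded transformations that ignore the
differentials is needed. -/
theorem yoneda_hoch_univ (Φ : DGFunctor F) (n : ℕ) (p : ℤ) (x : Φ.X (n + 1) (p - n)) :
    (yoneda Φ n (p - n) x).hoch n p (by omega) (univ F n n) =
      DirectSum.lof F ℕ (fun n : ℕ => Φ.X (n + 1) (p - n)) n x := by
  rw [univ, GradedTrans.hoch_lof, yoneda_app _ _ _ _ _ _ _ _ (by omega),
    LinearEquiv.symm_apply_apply, Φ.act_id]

/-- The component of a formal operation in `Com(n + 1, m + 1)`. -/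
noncomputable def comp {l : ℤ} (φ : Family F l) (n m : ℕ) : Com F n m :=
  (toRep n (m + 1) (n + l - m)).symm
    (DirectSum.component F ℕ (fun k : ℕ => (rep F n).X (k + 1) (n + l - k)) m
      (φ (rep F n) ⟨n, n + l, rfl⟩ (univ F n n)))

theorem hoch_component {Φ Ψ : DGFunctor F} {r : ℤ} (θ : GradedTrans Φ Ψ r) (p p' : ℤ)
    (h : p + r = p') (m : ℕ) (x : X Φ p) :
    DirectSum.component F ℕ (fun n : ℕ => Ψ.X (n + 1) (p' - n)) m (θ.hoch p p' h x) =
      θ.app (m + 1) (p - m) (p' - m) (by omega)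
        (DirectSum.component F ℕ (fun n : ℕ => Φ.X (n + 1) (p - n)) m x) := by
  induction x using DirectSum.induction_on with
  | zero => simp
  | add x y hx hy => simp only [map_add, hx, hy]
  | of n x =>
    change DirectSum.component F ℕ _ m (θ.hoch p p' h (DirectSum.lof F ℕ _ n x)) =
      θ.app _ _ _ _ (DirectSum.component F ℕ (fun n : ℕ => Φ.X (n + 1) (p - n)) m
        (DirectSum.lof F ℕ (fun n : ℕ => Φ.X (n + 1) (p - n)) n x))
    rw [θ.hoch_lof]
    by_cases hnm : n = m
    · subst hnm
      rw [DirectSum.component.lof_self, DirectSum.component.lof_self]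
    · rw [DirectSum.component.of, DirectSum.component.of, dif_neg hnm, dif_neg hnm, map_zero]

/-- A formal operation is determined by its components. -/
theorem apply_component {l : ℤ} {φ : Family F l} (hφ : φ ∈ op F l) (Φ : DGFunctor F) (p q : ℤ)
    (h : p + l = q) (n m : ℕ) (hm : (n : ℤ) + l = m) (x : Φ.X (n + 1) (p - n)) :
    DirectSum.component F ℕ (fun n : ℕ => Φ.X (n + 1) (q - n)) m
      (φ Φ ⟨p, q, h⟩ (DirectSum.lof F ℕ (fun n : ℕ => Φ.X (n + 1) (p - n)) n x)) =
      (l * (p - n)).negOnePow • Φ.act (comp φ n m) (p - n) (q - m) (by omega) x := by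
  have h1 := hφ (rep F n) Φ (p - n) (yoneda Φ n (p - n) x) n p (n + l) q
    (by omega) (by omega) rfl h (univ F n n)
  rw [yoneda_hoch_univ] at h1
  rw [h1, map_zsmul_unit, hoch_component, yoneda_app _ _ _ _ _ _ _ _ (by omega)]
  rfl

/-- The component in summand `m` of the value on the universal element has internal degree `n + l -
m`, and the Yoneda transformation vanishes outside internal degree `0`. -/
theorem apply_component_ne {l : ℤ} {φ : Family F l} (hφ : φ ∈ op F l) (Φ : DGFunctor F)
    (p q : ℤ) (h : p + l = q) (n m : ℕ) (hm : (n : ℤ) + l ≠ m) (x : Φ.X (n + 1) (p - n)) :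
    DirectSum.component F ℕ (fun n : ℕ => Φ.X (n + 1) (q - n)) m
      (φ Φ ⟨p, q, h⟩ (DirectSum.lof F ℕ (fun n : ℕ => Φ.X (n + 1) (p - n)) n x)) = 0 := by
  have h1 := hφ (rep F n) Φ (p - n) (yoneda Φ n (p - n) x) n p (n + l) q
    (by omega) (by omega) rfl h (univ F n n)
  rw [yoneda_hoch_univ] at h1
  rw [h1, map_zsmul_unit, hoch_component, yoneda_app_ne _ _ _ _ _ _ _ _ (by omega), smul_zero]

theorem ext_comp {l : ℤ} {φ ψ : Family F l} (hφ : φ ∈ op F l) (hψ : ψ ∈ op F l)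
    (h : ∀ n m : ℕ, (n : ℤ) + l = m → comp φ n m = comp ψ n m) : φ = ψ := by
  funext Φ ⟨p, q, hpq⟩
  refine DirectSum.linearMap_ext F fun n => LinearMap.ext fun x => ?_
  refine DirectSum.ext_component F fun m => ?_
  simp only [LinearMap.comp_apply]
  by_cases hm : (n : ℤ) + l = m
  · rw [apply_component hφ Φ p q hpq n m hm, apply_component hψ Φ p q hpq n m hm, h n m hm]
  · rw [apply_component_ne hφ Φ p q hpq n m hm, apply_component_ne hψ Φ p q hpq n m hm]

theorem comp_sub {l : ℤ} (φ ψ : Family F l) (n m : ℕ) :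
    comp (φ - ψ) n m = comp φ n m - comp ψ n m := by
  simp [comp]

theorem comp_zero {l : ℤ} (n m : ℕ) : comp (0 : Family F l) n m = 0 := by
  simp [comp]

/-- The family of maps given by elements of `Com(n + 1, m + 1)` for `n + l = m`. -/
noncomputable def family (l : ℤ) (f : ∀ n m : ℕ, Com F n m) : Family F l :=
  fun Φ t => DirectSum.toModule F ℕ (X Φ t.tgt) fun n =>
    if hl : 0 ≤ n + l then
      (l * (t.src - n)).negOnePow •
        (DirectSum.lof F ℕ (fun n : ℕ => Φ.X (n + 1) (t.tgt - n)) (n + l).toNat ∘ₗ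
          Φ.act (f n (n + l).toNat) (t.src - n) (t.tgt - ((n + l).toNat : ℕ))
            (by have := t.eq; rw [Int.toNat_of_nonneg hl]; omega))
    else 0

theorem family_lof (l : ℤ) (f : ∀ n m : ℕ, Com F n m) (Φ : DGFunctor F)
    (p q : ℤ) (h : p + l = q) (n m : ℕ) (hm : (n : ℤ) + l = m) (x : Φ.X (n + 1) (p - n)) :
    family l f Φ ⟨p, q, h⟩ (DirectSum.lof F ℕ (fun n : ℕ => Φ.X (n + 1) (p - n)) n x) =
      (l * (p - n)).negOnePow •
        DirectSum.lof F ℕ (fun n : ℕ => Φ.X (n + 1) (q - n)) m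
          (Φ.act (f n m) (p - n) (q - m) (by omega) x) := by
  obtain rfl : m = (n + l).toNat := by omega
  simp [family, DirectSum.toModule_lof, show 0 ≤ (n : ℤ) + l by omega]

theorem family_lof_neg (l : ℤ) (f : ∀ n m : ℕ, Com F n m) (Φ : DGFunctor F)
    (p q : ℤ) (h : p + l = q) (n : ℕ) (hm : (n : ℤ) + l < 0) (x : Φ.X (n + 1) (p - n)) :
    family l f Φ ⟨p, q, h⟩ (DirectSum.lof F ℕ (fun n : ℕ => Φ.X (n + 1) (p - n)) n x) = 0 := by
  simp [family, DirectSum.toModule_lof, show ¬ 0 ≤ (n : ℤ) + l by omega]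

theorem family_mem (l : ℤ) (f : ∀ n m : ℕ, Com F n m) : family l f ∈ op F l := by
  intro Φ Ψ r θ p p' q q' hp hq h h' x
  induction x using DirectSum.induction_on with
  | zero => simp
  | add x y hx hy => simp only [map_add, hx, hy, smul_add]
  | of n x =>
    change family l f Ψ ⟨p', q', h'⟩ (θ.hoch p p' hp
      (DirectSum.lof F ℕ (fun n : ℕ => Φ.X (n + 1) (p - n)) n x)) =
      _ • θ.hoch q q' hq (family l f Φ ⟨p, q, h⟩
        (DirectSum.lof F ℕ (fun n : ℕ => Φ.X (n + 1) (p - n)) n x))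
    by_cases hm : (n : ℤ) + l < 0
    · rw [θ.hoch_lof, family_lof_neg _ _ _ _ _ _ _ hm, family_lof_neg _ _ _ _ _ _ _ hm,
        map_zero, smul_zero]
    · obtain ⟨m, hm⟩ : ∃ m : ℕ, (n : ℤ) + l = m := ⟨(n + l).toNat, by omega⟩
      rw [θ.hoch_lof, family_lof _ _ _ _ _ _ _ m hm, family_lof _ _ _ _ _ _ _ m hm,
        map_zsmul_unit, θ.hoch_lof,
        θ.naturality' (f n m) (p - n) (p' - n) _ (q' - m) (by omega) _ (by omega), smul_smul,
        ← Int.negOnePow_add]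
      congr 2
      subst hp
      ring

theorem comp_family (l : ℤ) (f : ∀ n m : ℕ, Com F n m) (n m : ℕ) (hm : (n : ℤ) + l = m) :
    comp (family l f) n m = f n m := by
  rw [comp, univ, family_lof _ _ _ _ _ _ _ m hm, map_zsmul_unit, DirectSum.component.lof_self,
    rep_act, Category.id_comp, map_zsmul_unit, LinearEquiv.symm_apply_apply]
  simp

theorem comp_familyOf (l : ℕ)
    (f : ∀ n : ℕ, ComPROP.obj F (n + 1) ⟶ ComPROP.obj F (n + l + 1)) (n : ℕ) :
    comp (familyOf l f) n (n + l) = f n := by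
  rw [comp, univ, familyOf_lof, map_zsmul_unit, DirectSum.component.lof_self,
    rep_act, Category.id_comp, map_zsmul_unit, LinearEquiv.symm_apply_apply]
  simp

variable (F) in
/-- The differential of the Hochschild complex as an element of `Com(n + 1, m + 1)`. -/
noncomputable def dCom (n m : ℕ) : Com F n m :=
  if h : n = m + 1 then eqToHom (by rw [h]) ≫ bdry F m else 0

theorem dCom_succ (n : ℕ) : dCom F (n + 1) n = bdry F n := by
  simp [dCom]

theorem dCom_of_ne {n m : ℕ} (h : n ≠ m + 1) : dCom F n m = 0 := by
  simp [dCom, h]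

/-- The differential of formal operations in terms of components. -/
noncomputable def dHom (l : ℤ) (f : ∀ n m : ℕ, Com F n m) (n m : ℕ) : Com F n m :=
  f n (m + 1) ≫ dCom F (m + 1) m - (l.negOnePow : ℤ) • (dCom F n (n - 1) ≫ f (n - 1) m)

/-- The internal differential of a representable is zero, so only the Hochschild part is left, with
its sign `(-1)^{|x|}`. -/
theorem rep_dX_component (n : ℕ) (p p' : ℤ) (h : p' + 1 = p) (m : ℕ) (x : X (rep F n) p) :
    (toRep n (m + 1) _).symm
      (DirectSum.component F ℕ (fun k : ℕ => (rep F n).X (k + 1) (p' - k)) m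
        (dX (rep F n) p p' h x)) =
    (p - (m + 1 : ℕ)).negOnePow •
      ((toRep n (m + 1 + 1) _).symm
        (DirectSum.component F ℕ (fun k : ℕ => (rep F n).X (k + 1) (p - k)) (m + 1) x) ≫
          bdry F m) := by
  induction x using DirectSum.induction_on with
  | zero => simp only [map_zero, Limits.zero_comp, smul_zero]
  | add x y hx hy => simp only [map_add, hx, hy, Preadditive.add_comp, smul_add]
  | of k x =>
    change (toRep n (m + 1) _).symm (DirectSum.component F ℕ _ m
        (dX _ p p' h (DirectSum.lof F ℕ (fun k : ℕ => (rep F n).X (k + 1) (p - k)) k x))) =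
      _ • ((toRep n (m + 1 + 1) _).symm (DirectSum.component F ℕ
        (fun k : ℕ => (rep F n).X (k + 1) (p - k)) (m + 1)
          (DirectSum.lof F ℕ (fun k : ℕ => (rep F n).X (k + 1) (p - k)) k x)) ≫ bdry F m)
    rw [dX_lof, rep_d, LinearMap.zero_apply, map_zero, zero_add]
    obtain _ | k := k
    · rw [DirectSum.component.of, dif_neg (by omega)]
      simp only [dHoch, LinearMap.zero_apply, map_zero, Limits.zero_comp, smul_zero]
    · simp only [dHoch, LinearMap.smul_apply, LinearMap.comp_apply, map_zsmul_unit]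
      by_cases hk : k = m
      · subst hk
        obtain ⟨x, rfl⟩ := (toRep n (k + 1 + 1) _).surjective x
        rw [DirectSum.component.lof_self, DirectSum.component.lof_self, rep_act]
        simp only [LinearEquiv.symm_apply_apply]
      · rw [DirectSum.component.of, DirectSum.component.of, dif_neg hk,
          dif_neg (by omega)]
        simp only [map_zero, Limits.zero_comp, smul_zero]

theorem comp_congr {l : ℤ} (φ : Family F l) (n m : ℕ) (p q : ℤ) (h : p + l = q) (hp : p = n) :
    (toRep n (m + 1) _).symm
      (DirectSum.component F ℕ (fun k : ℕ => (rep F n).X (k + 1) (q - k)) m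
        (φ (rep F n) ⟨p, q, h⟩ (univ F n p))) = comp φ n m := by
  subst hp h
  rfl

/-- Both sides are evaluated on the universal element. Everything relevant sits in internal degree
`0`, where the signs `(-1)^{|x|}` and the Koszul signs are trivial. -/
theorem comp_dFamily (l l' : ℤ) (hl : l' + 1 = l) {φ : Family F l} (hφ : φ ∈ op F l) (n m : ℕ)
    (hm : (n : ℤ) + l' = m) : comp (dFamily l l' hl φ) n m = dHom l (comp φ) n m := by
  have hd : (dX (rep F n) n (n - 1) (by omega)) (univ F n n) =
      dHoch (rep F n) n (n - 1) (by omega) n (toRep n (n + 1) _ (𝟙 (ComPROP.obj F (n + 1)))) := by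
    rw [univ, dX_lof, rep_d, LinearMap.zero_apply, map_zero, zero_add]
  rw [comp, dFamily_apply, map_sub, map_sub, map_zsmul_unit, map_zsmul_unit, hd,
    rep_dX_component, dHom, dCom_succ]
  congr 1
  · have e : ((n : ℤ) + l' + 1 - (m + 1 : ℕ)) = 0 := by push_cast; omega
    rw [comp_congr φ n (m + 1) n _ (by omega) rfl, e, Int.negOnePow_zero, one_smul]
  · congr 1
    -- For `n = 0` the truncated index `n - 1` is again `0`; this is harmless because `dCom F 0 0 =
    -- 0`.
    obtain _ | n := n
    · simp only [dHoch, LinearMap.zero_apply, map_zero]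
      rw [dCom_of_ne (by omega), Limits.zero_comp]
    · simp only [dHoch, LinearMap.smul_apply, LinearMap.comp_apply, map_zsmul_unit]
      rw [rep_act, Category.id_comp, apply_component hφ _ _ _ _ _ _ (by push_cast at hm; omega), rep_act,
        Nat.add_sub_cancel, dCom_succ]
      simp

end FormalOp

/-! ### Homology classes of formal operations -/

namespace FormalOp

variable {F : Type u} [Field F]

theorem complex_d (l l' : ℤ) (hl : l' + 1 = l) :
    (complex F).d l l' = ModuleCat.ofHom (dOp (F := F) l l' hl) := dif_pos hl

theorem dOp_sub (l l' : ℤ) (hl : l' + 1 = l) (φ ψ : op F l) :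
    dOp l l' hl (φ - ψ) = dOp l l' hl φ - dOp l l' hl ψ :=
  Subtype.ext ((dFamily l l' hl).map_sub φ.1 ψ.1)

theorem exists_cycle {l l' : ℤ} (hl : l' + 1 = l) (φ : op F l) (h : dOp l l' hl φ = 0) :
    ∃ z : (complex F).cycles l, (complex F).iCycles l z = φ := by
  have hk := (complex F).cyclesIsKernel l l' (by simp [← hl])
  have h1 : (ShortComplex.mk ((complex F).iCycles l) ((complex F).d l l') (by simp)).Exact :=
    ShortComplex.exact_of_f_is_kernel _ hk
  rw [ShortComplex.moduleCat_exact_iff] at h1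
  refine h1 φ ?_
  change (complex F).d l l' φ = 0
  rw [complex_d l l' hl]
  exact h

theorem d_iCycles {l l' : ℤ} (hl : l' + 1 = l) (z : (complex F).cycles l) :
    dOp l l' hl ((complex F).iCycles l z : op F l) = 0 := by
  have h1 := (complex F).iCycles_d l l'
  rw [complex_d l l' hl] at h1
  exact congrArg (fun f => f.hom z) h1

theorem homologyπ_eq_zero_iff {l l' : ℤ} (hl : l + 1 = l') (z : (complex F).cycles l) :
    (complex F).homologyπ l z = 0 ↔ ∃ w : op F l', dOp l' l hl w = (complex F).iCycles l z := by
  have hk := (complex F).homologyIsCokernel l' l (by simp [← hl])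
  have h1 : (ShortComplex.mk ((complex F).toCycles l' l) ((complex F).homologyπ l)
    (by simp)).Exact := ShortComplex.exact_of_g_is_cokernel _ hk
  rw [ShortComplex.moduleCat_exact_iff] at h1
  have h2 := (complex F).toCycles_i l' l
  rw [complex_d l' l hl] at h2
  constructor
  · intro h
    obtain ⟨w, hw⟩ := h1 z h
    refine ⟨w, ?_⟩
    rw [← hw]
    exact (congrArg (fun f => f.hom w) h2).symm
  · rintro ⟨w, hw⟩
    have h3 : (complex F).toCycles l' l w = z := by
      apply (ModuleCat.mono_iff_injective ((complex F).iCycles l)).1 inferInstance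
      rw [← hw]
      exact congrArg (fun f => f.hom w) h2
    rw [← h3]
    exact congrArg (fun f => f.hom w) ((complex F).toCycles_comp_homologyπ l' l)

theorem exists_hasClass {l l' : ℤ} (hl : l' + 1 = l) {φ : op F l} (h : dOp l l' hl φ = 0) :
    ∃ x, HasClass φ x := by
  obtain ⟨z, hz⟩ := exists_cycle hl φ h
  exact ⟨_, z, hz, rfl⟩

theorem exists_representative {l l' : ℤ} (hl : l' + 1 = l) (x : (complex F).homology l) :
    ∃ φ : op F l, dOp l l' hl φ = 0 ∧ HasClass φ x := by
  obtain ⟨z, rfl⟩ := (ModuleCat.epi_iff_surjective ((complex F).homologyπ l)).1 inferInstance x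
  exact ⟨_, d_iCycles hl z, z, rfl, rfl⟩

theorem HasClass.iff_boundary {l l' : ℤ} (hl : l + 1 = l') {φ ψ : op F l}
    {x y : (complex F).homology l} (h : HasClass φ x) (h' : HasClass ψ y) :
    x = y ↔ ∃ w : op F l', dOp l' l hl w = φ - ψ := by
  obtain ⟨z, rfl, rfl⟩ := h
  obtain ⟨z', rfl, rfl⟩ := h'
  rw [← sub_eq_zero, ← map_sub, homologyπ_eq_zero_iff hl, map_sub]
  rfl

theorem isZero_homology {l l' l'' : ℤ} (hl : l + 1 = l') (hl' : l'' + 1 = l)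
    (h : ∀ φ : op F l, dOp l l'' hl' φ = 0 → ∃ w : op F l', dOp l' l hl w = φ) :
    Limits.IsZero ((complex F).homology l) := by
  rw [ModuleCat.isZero_iff_subsingleton]
  refine ⟨fun x y => ?_⟩
  obtain ⟨φ, hφ, hx⟩ := exists_representative hl' x
  obtain ⟨ψ, hψ, hy⟩ := exists_representative hl' y
  rw [HasClass.iff_boundary hl hx hy]
  exact h _ (by rw [dOp_sub, hφ, hψ]; exact Subtype.ext (sub_zero _))

theorem dOp_eq_zero_iff {l l' : ℤ} (hl : l' + 1 = l) (φ : op F l) :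
    dOp l l' hl φ = 0 ↔ ∀ n m : ℕ, (n : ℤ) + l' = m → dHom l (comp φ.1) n m = 0 := by
  constructor
  · intro h n m hm
    rw [← comp_dFamily l l' hl φ.2 n m hm, ← comp_zero (l := l') n m]
    exact congrArg (fun ψ : op F l' => comp ψ.1 n m) h
  · intro h
    refine Subtype.ext (ext_comp (dOp l l' hl φ).2 (op F l').zero_mem fun n m hm => ?_)
    exact (comp_dFamily l l' hl φ.2 n m hm).trans ((h n m hm).trans (comp_zero n m).symm)

/-- The components of the required degree can be prescribed arbitrarily by `family`, and `dHom` in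
the relevant positions reads only those. -/
theorem exists_dOp_eq_iff {l l' : ℤ} (hl : l' + 1 = l) (φ : op F l') :
    (∃ w, dOp l l' hl w = φ) ↔
      ∃ h : ∀ n m : ℕ, Com F n m, ∀ n m : ℕ, (n : ℤ) + l' = m →
        dHom l h n m = comp φ.1 n m := by
  constructor
  · rintro ⟨w, rfl⟩
    exact ⟨comp w.1, fun n m hm => (comp_dFamily l l' hl w.2 n m hm).symm⟩
  · rintro ⟨h, hh⟩
    refine ⟨⟨family l h, family_mem l h⟩, Subtype.ext (ext_comp
      (dFamily_mem l l' hl _ (family_mem l h)) φ.2 fun n m hm => ?_)⟩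
    rw [← hh n m hm]
    refine (comp_dFamily l l' hl (family_mem l h) n m hm).trans ?_
    rw [dHom, dHom, comp_family _ _ _ _ (by push_cast; omega)]
    congr 2
    obtain _ | n := n
    · rw [dCom_of_ne (by omega), Limits.zero_comp, Limits.zero_comp]
    · rw [Nat.add_sub_cancel, comp_family _ _ _ _ (by push_cast at hm; omega)]

end FormalOp

/-! ### Chains on powers of the simplicial circle -/

namespace CircleChains

open Hochschild

variable {F : Type u} [Field F]

variable (F) in
/-- The chains of dimension `m` on the `r`-th power of the simplicial circle. -/
abbrev Chain (r m : ℕ) : Type u := (Fin r → Fin (m + 1)) →₀ F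

/-- The map `Fin (m + 1) → Fin (m + 2)` which misses `i + 1`. -/
def dgn (m : ℕ) (i : Fin (m + 1)) (t : Fin (m + 1)) : Fin (m + 2) :=
  if t ≤ i then t.castSucc else t.succ

/-- The boundary of the unnormalized chains. -/
noncomputable def bd (r m : ℕ) : Chain F r (m + 1) →ₗ[F] Chain F r m :=
  ∑ k : Fin (m + 2), (-1 : F) ^ (k : ℕ) • Finsupp.lmapDomain F F (fun f t => face m k (f t))

theorem bd_single (r m : ℕ) (f : Fin r → Fin (m + 2)) (c : F) :
    bd r m (Finsupp.single f c) =
      ∑ k : Fin (m + 2), (-1 : F) ^ (k : ℕ) • Finsupp.single (fun t => face m k (f t)) c := by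
  simp only [bd, LinearMap.sum_apply, LinearMap.smul_apply, Finsupp.lmapDomain_apply,
    Finsupp.mapDomain_single]

theorem face_val (m : ℕ) (k t : Fin (m + 2)) :
    (face m k t : ℕ) = if (t : ℕ) ≤ k then (if (t : ℕ) = m + 1 then 0 else (t : ℕ))
      else (t : ℕ) - 1 := by
  have h1 := t.isLt
  have h2 := k.isLt
  simp only [face]
  split_ifs with h h'
  · simp [h']
  · exact Nat.mod_eq_of_lt (by omega)
  · exact Nat.mod_eq_of_lt (by omega)

theorem dgn_val (m : ℕ) (i t : Fin (m + 1)) :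
    (dgn m i t : ℕ) = if (t : ℕ) ≤ i then (t : ℕ) else (t : ℕ) + 1 := by
  simp only [dgn, Fin.le_def]
  split_ifs <;> simp

theorem face_zero_right (m : ℕ) (k : Fin (m + 2)) : face m k 0 = 0 := by
  ext; simp [face_val]

theorem dgn_zero_right (m : ℕ) (i : Fin (m + 1)) : dgn m i 0 = 0 := by
  ext; simp [dgn_val]

theorem face_dgn_self (m : ℕ) (i : Fin (m + 1)) (t : Fin (m + 1)) :
    face m i.castSucc (dgn m i t) = t := by
  ext; simp only [face_val, dgn_val, Fin.val_castSucc]; split_ifs <;> omega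

theorem face_dgn_succ (m : ℕ) (i : Fin (m + 1)) (t : Fin (m + 1)) :
    face m i.succ (dgn m i t) = t := by
  ext; simp only [face_val, dgn_val, Fin.val_succ]; split_ifs <;> omega

theorem face_dgn_lt (m : ℕ) (i : Fin (m + 1)) (k : Fin (m + 2)) (h : (k : ℕ) ≤ i)
    (t : Fin (m + 2)) :
    face (m + 1) k.castSucc (dgn (m + 1) i.succ t) = dgn m i (face m k t) := by
  ext; simp only [face_val, dgn_val, Fin.val_succ, Fin.val_castSucc]; split_ifs <;> omega

theorem face_dgn_gt (m : ℕ) (i : Fin (m + 1)) (k : Fin (m + 2)) (h : (i : ℕ) < k)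
    (t : Fin (m + 2)) :
    face (m + 1) k.succ (dgn (m + 1) i.castSucc t) = dgn m i (face m k t) := by
  ext; simp only [face_val, dgn_val, Fin.val_succ, Fin.val_castSucc]; split_ifs <;> omega

/-- The tuple with first entry `j` and the other entries given by `f`. -/
def consFun {r n : ℕ} (j : Fin n) (f : Fin r → Fin n) : Fin (r + 1) → Fin n := Fin.cons j f

@[simp] theorem consFun_zero {r n : ℕ} (j : Fin n) (f : Fin r → Fin n) : consFun j f 0 = j := rfl

@[simp] theorem consFun_succ {r n : ℕ} (j : Fin n) (f : Fin r → Fin n) (t : Fin r) :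
    consFun j f t.succ = f t := rfl

/-- The prism on a simplex `f` from the vertex `j` of the simplicial interval. -/
noncomputable def prism {r : ℕ} (m : ℕ) (f : Fin r → Fin (m + 1)) (j : ℕ) :
    Chain F (r + 1) (m + 1) :=
  ∑ i : Fin (m + 1), if j ≤ i then
    (-1 : F) ^ (i : ℕ) • Finsupp.single (consFun i.succ fun t => dgn m i (f t)) 1 else 0

theorem face_cons {r : ℕ} (m : ℕ) (k j : Fin (m + 2)) (f : Fin r → Fin (m + 2)) :
    (fun t => face m k (consFun j f t)) =
      (consFun (face m k j) fun t => face m k (f t)) := by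
  funext t
  refine Fin.cases ?_ (fun t => ?_) t <;> simp

/-- Separates the two faces that undo the `i`-th degeneracy from the others, which are reindexed so
that they become faces of the simplex under the prism. -/
theorem sum_prism_faces {M : Type*} [AddCommGroup M] (m : ℕ) (i : Fin (m + 2))
    (a : Fin (m + 3) → M) :
    ∑ k, a k = a i.castSucc + a i.succ +
      ((∑ k : Fin (m + 2), if (k : ℕ) < i then a k.castSucc else 0) +
        ∑ k : Fin (m + 2), if (i : ℕ) < k then a k.succ else 0) := by
  have h1 : (∑ k : Fin (m + 2), if (k : ℕ) < i then a k.castSucc else 0) =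
      ∑ k : Fin (m + 3), if (k : ℕ) < i then a k else 0 := by
    rw [Fin.sum_univ_castSucc (n := m + 2), Fin.val_last, if_neg (by omega), add_zero]
    rfl
  have h2 : (∑ k : Fin (m + 2), if (i : ℕ) < k then a k.succ else 0) =
      ∑ k : Fin (m + 3), if (i : ℕ) + 1 < k then a k else 0 := by
    rw [Fin.sum_univ_succ (n := m + 2), Fin.val_zero, if_neg (by omega), zero_add]
    simp
  have h3 : a i.castSucc = ∑ k : Fin (m + 3), if k = i.castSucc then a k else 0 := by simp
  have h4 : a i.succ = ∑ k : Fin (m + 3), if k = i.succ then a k else 0 := by simp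
  rw [h1, h2, h3, h4, ← Finset.sum_add_distrib, ← Finset.sum_add_distrib,
    ← Finset.sum_add_distrib]
  refine Finset.sum_congr rfl fun k _ => ?_
  simp only [Fin.ext_iff, Fin.val_castSucc, Fin.val_succ]
  rcases lt_trichotomy (k : ℕ) i with h | h | h
  · simp [h, h.ne, show ¬ (i : ℕ) + 1 < k by omega, show ¬ (k : ℕ) = i + 1 by omega]
  · simp [h]
  · by_cases h' : (k : ℕ) = i + 1
    · simp [h', show ¬ (i : ℕ) + 1 < i by omega]
    · simp [h', h.ne', show ¬ (k : ℕ) < i by omega, show (i : ℕ) + 1 < k by omega]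

/-- The two faces that undo the `i`-th degeneracy give first entries `i` and `i + 1`. These
telescope from `j` to the end of the simplex, which is the base point again. All other faces cancel
against the prisms on the faces of `f`; the starting vertex `j` drops by one when a face below it is
taken. -/
theorem bd_prism {r : ℕ} (m : ℕ) (f : Fin r → Fin (m + 2)) (j : Fin (m + 2)) :
    bd (r + 1) (m + 1) (prism (F := F) (m + 1) f j) +
      ∑ k : Fin (m + 2), (-1 : F) ^ (k : ℕ) •
        prism m (fun t => face m k (f t)) (if (j : ℕ) ≤ k then j else j - 1) =
    Finsupp.single (consFun j f) 1 - Finsupp.single (consFun 0 f) 1 := by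
  have tele : ∀ g : ℕ → Chain F (r + 1) (m + 1), ∀ N : ℕ, (j : ℕ) ≤ N →
      (∑ i ∈ Finset.range N, if (j : ℕ) ≤ i then g i - g (i + 1) else 0) = g j - g N := by
    intro g N hN
    induction N, hN using Nat.le_induction with
    | base => 
      rw [sub_self]
      exact Finset.sum_eq_zero fun i hi => if_neg (by simpa using hi)
    | succ N hN ih => rw [Finset.sum_range_succ, ih, if_pos hN]; abel
  let X : Fin (m + 1) → Fin (m + 2) → Chain F (r + 1) (m + 1) := fun i k =>
    (-1 : F) ^ ((i : ℕ) + k) • Finsupp.single (consFun i.succ fun t => dgn m i (face m k (f t))) 1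
  have h1 : bd (r + 1) (m + 1) (prism (F := F) (m + 1) f j) =
      (∑ i : Fin (m + 2), if (j : ℕ) ≤ i then
        (Finsupp.single (consFun i f) 1 - Finsupp.single (consFun (face (m + 1) i.succ i.succ) f) 1)
        else 0) +
      ((∑ i : Fin (m + 1), ∑ k : Fin (m + 2),
        if (j : ℕ) ≤ i + 1 ∧ (k : ℕ) ≤ i then - X i k else 0) +
       ∑ i : Fin (m + 1), ∑ k : Fin (m + 2),
        if (j : ℕ) ≤ i ∧ (i : ℕ) < k then - X i k else 0) := by
    have hi : ∀ i : Fin (m + 2), (-1 : F) ^ (i : ℕ) • bd (r + 1) (m + 1)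
        (Finsupp.single (consFun i.succ fun t => dgn (m + 1) i (f t)) (1 : F)) =
        (Finsupp.single (consFun i f) 1 -
          Finsupp.single (consFun (face (m + 1) i.succ i.succ) f) 1) +
        ((∑ k : Fin (m + 2), if (k : ℕ) < i then (-1 : F) ^ ((i : ℕ) + k) •
          Finsupp.single (consFun (face (m + 1) k.castSucc i.succ)
            fun t => face (m + 1) k.castSucc (dgn (m + 1) i (f t))) 1 else 0) +
        ∑ k : Fin (m + 2), if (i : ℕ) < k then (-1 : F) ^ ((i : ℕ) + k + 1) •
          Finsupp.single (consFun (face (m + 1) k.succ i.succ)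
            fun t => face (m + 1) k.succ (dgn (m + 1) i (f t))) 1 else 0) := by
      intro i
      rw [bd_single, sum_prism_faces m i]
      have e : face (m + 1) i.castSucc i.succ = i := by
        ext; simp [face_val]
      simp only [face_cons, face_dgn_self, face_dgn_succ, e, Fin.val_castSucc, Fin.val_succ,
        smul_add, Finset.smul_sum, smul_ite, smul_zero, smul_smul, ← pow_add]
      congr 1
      have e1 : (-1 : F) ^ ((i : ℕ) + i) = 1 := Even.neg_one_pow ⟨i, rfl⟩
      rw [← add_assoc (i : ℕ), pow_succ, e1, one_smul, one_mul, neg_one_smul, sub_eq_add_neg]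
    rw [prism, map_sum]
    have hj : ∀ i : Fin (m + 2), bd (r + 1) (m + 1) (if (j : ℕ) ≤ i then (-1 : F) ^ (i : ℕ) •
        Finsupp.single (consFun i.succ fun t => dgn (m + 1) i (f t)) (1 : F) else 0) =
        (if (j : ℕ) ≤ i then (Finsupp.single (consFun i f) (1 : F) -
          Finsupp.single (consFun (face (m + 1) i.succ i.succ) f) (1 : F)) else 0) +
        ((∑ k : Fin (m + 2), if (j : ℕ) ≤ i ∧ (k : ℕ) < i then (-1 : F) ^ ((i : ℕ) + k) •
          Finsupp.single (consFun (face (m + 1) k.castSucc i.succ)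
            fun t => face (m + 1) k.castSucc (dgn (m + 1) i (f t))) 1 else 0) +
        ∑ k : Fin (m + 2), if (j : ℕ) ≤ i ∧ (i : ℕ) < k then (-1 : F) ^ ((i : ℕ) + k + 1) •
          Finsupp.single (consFun (face (m + 1) k.succ i.succ)
            fun t => face (m + 1) k.succ (dgn (m + 1) i (f t))) 1 else 0) := by
      intro i
      split_ifs with h
      · rw [map_smul, hi]; simp only [h, true_and]
      · simp [h]
    rw [Finset.sum_congr rfl fun i _ => hj i, Finset.sum_add_distrib, Finset.sum_add_distrib]
    congr 2
    -- No face lies below `i = 0`; after shifting `i` by one, the simplicial identity moves the face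
    -- inside the degeneracy.
    · rw [Fin.sum_univ_succ]
      simp only [Fin.val_zero, not_lt_zero, and_false, if_false, Finset.sum_const_zero, zero_add]
      refine Finset.sum_congr rfl fun i _ => Finset.sum_congr rfl fun k _ => ?_
      simp only [Fin.val_succ, Nat.lt_succ_iff]
      refine if_ctx_congr Iff.rfl (fun h => ?_) fun _ => rfl
      have e : face (m + 1) k.castSucc i.succ.succ = i.succ := by
        ext; simp only [face_val, Fin.val_succ, Fin.val_castSucc]; split_ifs <;> omega
      simp only [e, face_dgn_lt m i k h.2, X, ← neg_smul]
      congr 1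
      ring
    -- Dually, no face lies above the last `i`.
    · rw [Fin.sum_univ_castSucc]
      simp only [Fin.val_last, Fin.val_castSucc]
      have hz : ∀ k : Fin (m + 2), ¬ (m + 1 < (k : ℕ)) := fun k => by omega
      simp only [hz, and_false, if_false, Finset.sum_const_zero, add_zero]
      refine Finset.sum_congr rfl fun i _ => Finset.sum_congr rfl fun k _ => ?_
      refine if_ctx_congr Iff.rfl (fun h => ?_) fun _ => rfl
      have e : face (m + 1) k.succ i.castSucc.succ = i.succ := by
        ext; simp only [face_val, Fin.val_succ, Fin.val_castSucc]; split_ifs <;> omega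
      simp only [e, face_dgn_gt m i k h.2, X, ← neg_smul]
      congr 1
      ring
  have h2 : ∑ k : Fin (m + 2), (-1 : F) ^ (k : ℕ) •
        prism m (fun t => face m k (f t)) (if (j : ℕ) ≤ k then j else j - 1) =
      ∑ i : Fin (m + 1), ∑ k : Fin (m + 2),
        if (if (j : ℕ) ≤ k then (j : ℕ) else j - 1) ≤ i then X i k else 0 := by
    rw [Finset.sum_comm]
    refine Finset.sum_congr rfl fun k _ => ?_
    rw [prism, Finset.smul_sum]
    refine Finset.sum_congr rfl fun i _ => ?_
    rw [smul_ite, smul_zero, smul_smul, ← pow_add, add_comm (k : ℕ)]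
  have h3 : (∑ i : Fin (m + 2), if (j : ℕ) ≤ i then
        (Finsupp.single (consFun i f) (1 : F) -
          Finsupp.single (consFun (face (m + 1) i.succ i.succ) f) 1)
        else 0) =
      Finsupp.single (consFun j f) 1 - Finsupp.single (consFun 0 f) 1 := by
    -- Reading the first entry modulo `m + 2` encodes that the last telescoping term is at the base
    -- point.
    let g : ℕ → Chain F (r + 1) (m + 1) := fun i =>
      Finsupp.single (consFun ⟨i % (m + 2), Nat.mod_lt _ (by omega)⟩ f) 1
    have := tele g (m + 2) (by omega)
    rw [Finset.sum_range] at this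
    convert this using 1
    · refine Finset.sum_congr rfl fun i _ => ?_
      refine if_ctx_congr Iff.rfl (fun h => ?_) fun _ => rfl
      simp only [g]
      have e1 : (⟨(i : ℕ) % (m + 2), Nat.mod_lt _ (by omega)⟩ : Fin (m + 2)) = i := by
        ext; simp [Nat.mod_eq_of_lt]
      have e2 : (⟨((i : ℕ) + 1) % (m + 2), Nat.mod_lt _ (by omega)⟩ : Fin (m + 2)) =
          face (m + 1) i.succ i.succ := by
        ext; simp [face]
      rw [e1, e2]
    · simp only [g]
      have e1 : (⟨(j : ℕ) % (m + 2), Nat.mod_lt _ (by omega)⟩ : Fin (m + 2)) = j := by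
        ext; simp [Nat.mod_eq_of_lt]
      have e2 : (⟨(m + 2) % (m + 2), Nat.mod_lt _ (by omega)⟩ : Fin (m + 2)) = 0 := by
        ext; simp
      rw [e1, e2]
  rw [h1, h2, h3, add_assoc, ← Finset.sum_add_distrib, ← Finset.sum_add_distrib, add_eq_left]
  -- For fixed `i` and `k` the condition on `j` in the third sum agrees with that of the first sum
  -- if `k ≤ i` and with that of the second if `i < k`, so `X i k` cancels.
  refine Finset.sum_eq_zero fun i _ => ?_
  rw [← Finset.sum_add_distrib, ← Finset.sum_add_distrib]
  refine Finset.sum_eq_zero fun k _ => ?_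
  have := j.isLt
  by_cases h1 : (k : ℕ) ≤ i <;> by_cases h2 : (j : ℕ) ≤ k <;> by_cases h3 : (j : ℕ) ≤ i + 1 <;>
    by_cases h4 : (j : ℕ) ≤ i <;>
    simp [h1, h2, h3, h4, show (i : ℕ) < k ↔ ¬ (k : ℕ) ≤ i by omega] <;> omega

end CircleChains

/-! ### Powers of the circle relative to the fat wedge -/

namespace CircleChains

open Hochschild

variable {F : Type u} [Field F]

variable (F) in
/-- The subspace spanned by the tuples with an entry at the base point. -/
noncomputable def fat (r m : ℕ) : Submodule F (Chain F r m) :=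
  Finsupp.supported F F {f | ∃ t, f t = 0}

theorem single_mem_fat {r m : ℕ} {f : Fin r → Fin (m + 1)} (h : ∃ t, f t = 0) (c : F) :
    Finsupp.single f c ∈ fat F r m :=
  Finsupp.single_mem_supported F c h

theorem map_mem_fat {r m : ℕ} {M : Type*} [AddCommGroup M] [Module F M]
    (φ : Chain F r m →ₗ[F] M) (N : Submodule F M)
    (h : ∀ f : Fin r → Fin (m + 1), (∃ t, f t = 0) → φ (Finsupp.single f 1) ∈ N)
    {x : Chain F r m} (hx : x ∈ fat F r m) : φ x ∈ N := by
  have : fat F r m ≤ N.comap φ := by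
    rw [fat, Finsupp.supported_eq_span_single, Submodule.span_le]
    rintro _ ⟨f, hf, rfl⟩
    exact h f hf
  exact this hx

theorem mem_of_single {r m : ℕ} {M : Type*} [AddCommGroup M] [Module F M]
    (φ : Chain F r m →ₗ[F] M) (N : Submodule F M)
    (h : ∀ f : Fin r → Fin (m + 1), φ (Finsupp.single f 1) ∈ N) (x : Chain F r m) : φ x ∈ N := by
  induction x using Finsupp.induction_linear with
  | zero => simp
  | add x y hx hy => rw [map_add]; exact N.add_mem hx hy
  | single f c =>
    rw [← mul_one c, ← smul_eq_mul, ← Finsupp.smul_single, map_smul]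
    exact N.smul_mem c (h f)

/-- The contracting homotopy. -/
noncomputable def htpy (r m : ℕ) : Chain F (r + 1) m →ₗ[F] Chain F (r + 1) (m + 1) :=
  Finsupp.linearCombination F fun f =>
    if f 0 = 0 then 0 else prism m (fun t => f t.succ) (f 0)

/-- The cross product with the fundamental class of the circle. -/
noncomputable def cross (r m : ℕ) : Chain F r m →ₗ[F] Chain F (r + 1) (m + 1) :=
  Finsupp.linearCombination F fun f => prism m f 0

/-- The slant product with the fundamental class of the circle. -/
noncomputable def slant (r m : ℕ) : Chain F (r + 1) (m + 1) →ₗ[F] Chain F r m :=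
  Finsupp.linearCombination F fun f =>
    if f 0 = 1 then Finsupp.single (fun t => face m 0 (f t.succ)) 1 else 0

theorem htpy_single {r m : ℕ} (f : Fin (r + 1) → Fin (m + 1)) :
    htpy r m (Finsupp.single f (1 : F)) =
      if f 0 = 0 then 0 else prism m (fun t => f t.succ) (f 0) := by
  simp [htpy]

theorem cross_single {r m : ℕ} (f : Fin r → Fin (m + 1)) :
    cross r m (Finsupp.single f (1 : F)) = prism m f 0 := by
  simp [cross]

theorem slant_single {r m : ℕ} (f : Fin (r + 1) → Fin (m + 2)) :
    slant r m (Finsupp.single f (1 : F)) =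
      if f 0 = 1 then Finsupp.single (fun t => face m 0 (f t.succ)) 1 else 0 := by
  simp [slant]

theorem prism_mem_fat {r m : ℕ} (f : Fin r → Fin (m + 1)) (j : ℕ) (h : ∃ t, f t = 0) :
    prism m f j ∈ fat F (r + 1) (m + 1) := by
  obtain ⟨t, ht⟩ := h
  refine Submodule.sum_mem _ fun i _ => ?_
  split_ifs
  · refine Submodule.smul_mem _ _ (single_mem_fat ⟨t.succ, ?_⟩ _)
    simp [ht, dgn_zero_right]
  · exact Submodule.zero_mem _

theorem htpy_mem_fat {r m : ℕ} {x : Chain F (r + 1) m} (hx : x ∈ fat F (r + 1) m) :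
    htpy r m x ∈ fat F (r + 1) (m + 1) := by
  refine map_mem_fat _ _ (fun f ⟨t, ht⟩ => ?_) hx
  rw [htpy_single]
  split_ifs with h0
  · exact Submodule.zero_mem _
  · refine prism_mem_fat _ _ ?_
    refine Fin.cases (fun ht => (h0 ht).elim) (fun t ht => ⟨t, ht⟩) t ht

theorem cross_mem_fat {r m : ℕ} {x : Chain F r m} (hx : x ∈ fat F r m) :
    cross r m x ∈ fat F (r + 1) (m + 1) := by
  refine map_mem_fat _ _ (fun f h => ?_) hx
  rw [cross_single]
  exact prism_mem_fat _ _ h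

theorem slant_mem_fat {r m : ℕ} {x : Chain F (r + 1) (m + 1)} (hx : x ∈ fat F (r + 1) (m + 1)) :
    slant r m x ∈ fat F r m := by
  refine map_mem_fat _ _ (fun f ⟨t, ht⟩ => ?_) hx
  rw [slant_single]
  split_ifs with h0
  · refine single_mem_fat ?_ _
    refine Fin.cases (fun ht => ?_) (fun t ht => ⟨t, ?_⟩) t ht
    · simp [ht] at h0
    · rw [ht, face_zero_right]
  · exact Submodule.zero_mem _

/-- The prism from vertex `0` runs once around the circle, so its two ends coincide and cancel. -/
theorem bd_cross {r m : ℕ} (x : Chain F r (m + 1)) :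
    bd (r + 1) (m + 1) (cross r (m + 1) x) = - cross r m (bd r m x) := by
  have := mem_of_single (bd (r + 1) (m + 1) ∘ₗ cross r (m + 1) + cross r m ∘ₗ bd r m) ⊥
    (fun f => by
      have := bd_prism (F := F) m f 0
      simp only [Fin.val_zero, zero_le, if_true, sub_self] at this
      simp only [LinearMap.add_apply, LinearMap.comp_apply, bd_single, map_sum, map_smul,
        cross_single, Submodule.mem_bot]
      exact this) x
  rw [Submodule.mem_bot] at this
  exact eq_neg_of_add_eq_zero_left this

theorem face_eq_one_iff {m : ℕ} (k t : Fin (m + 3)) :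
    face (m + 1) k t = 1 ↔ (t : ℕ) = 1 ∧ 0 < (k : ℕ) ∨ (t : ℕ) = 2 ∧ (k : ℕ) ≤ 1 := by
  have h1 := t.isLt
  have h2 := k.isLt
  rw [Fin.ext_iff, face_val, Fin.val_one]
  grind

/-- `slant` is a cap product with the fundamental cocycle of the first coordinate: the entry `1`
says that the front edge is the nondegenerate edge of the circle, and `face m 0` takes the back face
of the rest. The formula is the Leibniz rule for a cocycle of degree one. -/
theorem slant_bd {r m : ℕ} (x : Chain F (r + 1) (m + 2)) :
    slant r m (bd (r + 1) (m + 1) x) = - bd r m (slant r (m + 1) x) := by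
  have := mem_of_single (slant r m ∘ₗ bd (r + 1) (m + 1) + bd r m ∘ₗ slant r (m + 1)) ⊥
    (fun f => by
      simp only [LinearMap.add_apply, LinearMap.comp_apply, bd_single, map_sum, map_smul,
        slant_single, Submodule.mem_bot, face_eq_one_iff]
      by_cases h1 : f 0 = 1
      · rw [Fin.sum_univ_succ]
        simp only [h1, Fin.val_one, Fin.val_zero, lt_self_iff_false, and_false, false_or,
          Fin.val_succ, Nat.succ_pos, if_true, bd_single, true_and, true_or]
        simp only [OfNat.one_ne_ofNat, false_and, if_false, smul_zero, zero_add]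
        rw [← Finset.sum_add_distrib]
        refine Finset.sum_eq_zero fun k _ => ?_
        rw [pow_succ, mul_neg_one, neg_smul, neg_add_eq_zero]
        congr 2
        funext t
        ext
        have := (f t.succ).isLt
        have := k.isLt
        simp only [face_val, Fin.val_zero, Fin.val_succ]
        grind
      · have h1' : (f 0 : ℕ) ≠ 1 := fun h => h1 (Fin.ext h)
        rw [Fin.sum_univ_succ, Fin.sum_univ_succ]
        simp only [h1, h1', false_and, false_or, if_false, map_zero, add_zero]
        have : ∀ k : Fin (m + 1), ¬ ((k.succ.succ : Fin (m + 3)) : ℕ) ≤ 1 := fun k => by simp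
        simp only [this, and_false, if_false, smul_zero, Finset.sum_const_zero, add_zero]
        simp only [Fin.val_zero, Fin.val_succ, pow_zero, one_smul, zero_add, pow_one, zero_le,
          le_refl, and_true, neg_one_smul]
        split_ifs with h2
        · rw [add_neg_eq_zero]
          congr 1
          funext t
          ext
          have := (f t.succ).isLt
          simp only [face_val, Fin.val_zero, Fin.val_succ]
          grind
        · simp) x
  rw [Submodule.mem_bot] at this
  exact eq_neg_of_add_eq_zero_left this

/-- The homotopy pushes the first coordinate to the base point along the rest of the circle. It is
discontinuous at the base point itself, where it is zero instead of a full turn. This defect shows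
up for the entry `1` under face `0` and equals `cross` after `slant`. -/
theorem htpy_identity {r m : ℕ} (x : Chain F (r + 1) (m + 1)) :
    bd (r + 1) (m + 1) (htpy r (m + 1) x) + htpy r m (bd (r + 1) m x) - x +
      cross r m (slant r m x) ∈ fat F (r + 1) (m + 1) := by
  refine mem_of_single (bd (r + 1) (m + 1) ∘ₗ htpy r (m + 1) + htpy r m ∘ₗ bd (r + 1) m -
    LinearMap.id + cross r m ∘ₗ slant r m) _ (fun f => ?_) x
  simp only [LinearMap.add_apply, LinearMap.sub_apply, LinearMap.comp_apply, LinearMap.id_apply,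
    bd_single, map_sum, map_smul, htpy_single, slant_single]
  have hf : consFun (f 0) (fun t => f t.succ) = f := by
    funext t
    exact Fin.cases rfl (fun t => rfl) t
  by_cases h0 : f 0 = 0
  · simp only [h0, if_true, map_zero, face_zero_right, smul_zero, Finset.sum_const_zero,
      zero_sub, add_zero, zero_ne_one, if_false]
    simpa using single_mem_fat ⟨0, h0⟩ 1
  have key := bd_prism (F := F) m (fun t => f t.succ) (f 0)
  have h0' : 0 < (f 0 : ℕ) := Nat.pos_of_ne_zero fun h => h0 (Fin.ext h)
  rw [hf] at key
  -- A face moves a nonzero first entry to the base point in two cases: the entry `1` under face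
  -- `0`, where the missing full prism is supplied by the slant term, and the last entry under the
  -- last face, where the prism is an empty sum.
  have e : ∀ k : Fin (m + 2), (if face m k (f 0) = 0 then 0 else
      prism m (fun t => face m k (f t.succ)) (face m k (f 0))) +
      (if f 0 = 1 ∧ k = 0 then prism m (fun t => face m 0 (f t.succ)) 0 else 0) =
      prism (F := F) m (fun t => face m k (f t.succ))
        (if (f 0 : ℕ) ≤ k then (f 0 : ℕ) else f 0 - 1) := by
    intro k
    have hlt := (f 0).isLt
    have hk := k.isLt
    by_cases hc : f 0 = 1 ∧ k = 0
    · have : face m k (f 0) = 0 := by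
        ext; simp [face_val, hc]
      rw [if_pos this, if_pos hc, zero_add, hc.2]
      simp [hc.1]
    · rw [if_neg hc, add_zero]
      have hc' : ¬ ((f 0 : ℕ) = 1 ∧ (k : ℕ) = 0) := fun h => hc ⟨Fin.ext h.1, Fin.ext h.2⟩
      split_ifs with h1 h2 h2
      · have : (f 0 : ℕ) = m + 1 := by
          have := congrArg Fin.val h1
          rw [face_val, Fin.val_zero] at this
          split_ifs at this <;> omega
        symm
        refine Finset.sum_eq_zero fun i _ => if_neg ?_
        omega
      · exfalso
        have := congrArg Fin.val h1
        rw [face_val, Fin.val_zero] at this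
        split_ifs at this <;> omega
      · congr 1
        rw [face_val, if_pos h2, if_neg]
        intro h3
        exact h1 (Fin.ext (by rw [face_val, if_pos h2, if_pos h3]; rfl))
      · congr 1
        rw [face_val, if_neg h2]
  have e2 : cross r m (if f 0 = 1 then Finsupp.single (fun t => face m 0 (f t.succ)) (1 : F)
      else 0) = ∑ k : Fin (m + 2), (-1 : F) ^ (k : ℕ) •
        (if f 0 = 1 ∧ k = 0 then prism m (fun t => face m 0 (f t.succ)) 0 else 0) := by
    rw [Fin.sum_univ_succ]
    simp only [Fin.succ_ne_zero, and_false, if_false, smul_zero, Finset.sum_const_zero, add_zero,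
      and_true, Fin.val_zero, pow_zero, one_smul]
    split_ifs
    · rw [cross_single]
    · simp
  rw [e2, if_neg h0]
  have e3 : ∀ a b c d : Chain F (r + 1) (m + 1), a + b - c + d = a + (b + d) - c :=
    fun a b c d => by abel
  rw [e3, ← Finset.sum_add_distrib]
  simp only [← smul_add, e]
  rw [key]
  have := single_mem_fat (F := F) (f := consFun 0 (fun t => f t.succ)) ⟨0, rfl⟩ 1
  have h4 := Submodule.neg_mem _ this
  convert h4 using 1
  abel

/-- The pairing of a chain of dimension `m` with the `r`-fold exterior product of the
fundamental cohomology class. -/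
noncomputable def pairing (r m : ℕ) : Chain F r m →ₗ[F] F :=
  Finsupp.linearCombination F fun f => if m = r ∧ ∀ t, (f t : ℕ) = t + 1 then 1 else 0

theorem pairing_single {r m : ℕ} (f : Fin r → Fin (m + 1)) (c : F) :
    pairing r m (Finsupp.single f c) = if m = r ∧ ∀ t, (f t : ℕ) = t + 1 then c else 0 := by
  simp [pairing]

theorem pairing_of_ne {r m : ℕ} (h : m ≠ r) (x : Chain F r m) : pairing r m x = 0 := by
  have : (fun f : Fin r → Fin (m + 1) => if m = r ∧ ∀ t, (f t : ℕ) = t + 1 then (1 : F) else 0) =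
      fun _ => 0 := funext fun f => if_neg fun h' => h h'.1
  rw [pairing, this, Finsupp.linearCombination_apply]
  simp

/-- The tuple `(1, …, r + 1)` has first entry `1`, and face `0` turns its tail into `(1, …, r)`; no
other tuple with first entry `1` has such a tail. -/
theorem pairing_slant {r m : ℕ} (x : Chain F (r + 1) (m + 1)) :
    pairing r m (slant r m x) = pairing (r + 1) (m + 1) x := by
  have := mem_of_single (pairing r m ∘ₗ slant r m - pairing (r + 1) (m + 1)) ⊥ (fun f => by
    simp only [LinearMap.sub_apply, LinearMap.comp_apply, slant_single, Submodule.mem_bot,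
      pairing_single, sub_eq_zero]
    by_cases h0 : f 0 = 1
    · rw [if_pos h0, pairing_single]
      refine if_congr ?_ rfl rfl
      simp only [Nat.add_right_cancel_iff, Fin.forall_fin_succ, h0, Fin.val_one, Fin.val_zero,
        zero_add, true_and, Fin.val_succ]
      refine and_congr_right fun hm => forall_congr' fun t => ?_
      have := (f t.succ).isLt
      rw [face_val, Fin.val_zero]
      split_ifs <;> omega
    · rw [if_neg h0, map_zero, if_neg]
      rintro ⟨h1, h2⟩
      exact h0 (Fin.ext (by simpa using h2 0))) x
  rw [Submodule.mem_bot] at this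
  exact sub_eq_zero.1 this

/-- The zeroth power is a point, so all `m + 2` faces agree and only their alternating sum of signs
matters. -/
theorem bd_single_zero {m : ℕ} (f : Fin 0 → Fin (m + 2)) (c : F) (g : Fin 0 → Fin (m + 1)) :
    bd 0 m (Finsupp.single f c) = if Even m then 0 else Finsupp.single g c := by
  rw [bd_single]
  have : ∀ k : Fin (m + 2), (fun t => face m k (f t)) = g := fun k => Subsingleton.elim _ _
  simp only [this, ← Finset.sum_smul]
  rw [Fin.sum_univ_eq_sum_range (fun i => (-1 : F) ^ i), neg_one_geom_sum]
  simp only [Nat.even_add_one, not_not]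
  split_ifs <;> simp

/-- Slanting with every coordinate reduces to the point, where the boundary from dimension `1` to
dimension `0` vanishes. -/
theorem pairing_bd (r m : ℕ) (x : Chain F r (m + 1)) : pairing r m (bd r m x) = 0 := by
  induction r generalizing m with
  | zero =>
    by_cases hm : m = 0
    · subst hm
      have : bd 0 0 x = 0 := by
        have := mem_of_single (bd (F := F) 0 0) ⊥ (fun f => by
          rw [bd_single_zero f 1 (fun _ => 0)]; simp) x
        simpa using this
      rw [this, map_zero]
    · exact pairing_of_ne hm _
  | succ r ih =>
    by_cases hm : m = r + 1
    · subst hm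
      rw [← pairing_slant, slant_bd, map_neg, ih, neg_zero]
    · exact pairing_of_ne hm _

/-- A cycle relative to the fat subspace is a relative boundary if it pairs to zero with the
fundamental cohomology class. -/
theorem exists_bd_sub_mem_fat (r m : ℕ) (z : Chain F r m)
    (hz : ∀ m' (h : m = m' + 1), bd r m' (h ▸ z) ∈ fat F r m') (hp : pairing r m z = 0) :
    ∃ w, bd r m w - z ∈ fat F r m := by
  induction r generalizing m with
  | zero =>
    have hfat : ∀ k, fat F 0 k = ⊥ := fun k => by
      rw [fat]
      have : {f : Fin 0 → Fin (k + 1) | ∃ t, f t = 0} = ∅ := by ext f; simp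
      rw [this, Finsupp.supported_empty]
    let g : ∀ k, Fin 0 → Fin (k + 1) := fun k _ => 0
    obtain ⟨c, rfl⟩ : ∃ c, z = Finsupp.single (g m) c :=
      ⟨z (g m), Finsupp.ext fun f => by rw [Subsingleton.elim f (g m)]; simp⟩
    -- The boundary from dimension `m + 1` to `m` of a point is the identity for odd `m`. Hence
    -- everything in odd dimension bounds, a cycle in positive even dimension is zero, and dimension
    -- `0` is settled by the pairing.
    by_cases he : Even m
    · refine ⟨0, ?_⟩
      suffices c = 0 by simp [this]
      obtain _ | m := m
      · rw [pairing_single, if_pos ⟨rfl, fun t => t.elim0⟩] at hp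
        exact hp
      · have := hz m rfl
        rw [hfat, Submodule.mem_bot, bd_single_zero _ _ (g m), if_neg (by
          rwa [Nat.even_add_one] at he)] at this
        simpa using this
    · refine ⟨Finsupp.single (g _) c, ?_⟩
      rw [bd_single_zero _ _ (g m), if_neg he, sub_self]
      exact Submodule.zero_mem _
  | succ r ih =>
    -- In dimension `0` the base point is the only value, so every chain is in `fat`.
    obtain _ | m := m
    · refine ⟨0, ?_⟩
      rw [map_zero]
      refine mem_of_single (0 - LinearMap.id) _ (fun f => ?_) z
      rw [LinearMap.sub_apply, LinearMap.zero_apply, zero_sub, LinearMap.id_apply]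
      exact Submodule.neg_mem _ (single_mem_fat ⟨0, Fin.ext (by omega)⟩ _)
    have hz' := hz m rfl
    obtain ⟨w, hw⟩ := ih m (slant r m z) (by
      rintro m' rfl
      have := slant_mem_fat hz'
      rw [slant_bd] at this
      simpa using this) (by rw [pairing_slant, hp])
    -- Modulo `fat` and boundaries, `z` is `cross` of its slant product; the slant product bounds by
    -- induction, and `cross` anticommutes with the boundary.
    refine ⟨htpy r (m + 1) z - cross r (m + 1) w, ?_⟩
    have h1 := htpy_identity z
    have h2 := htpy_mem_fat hz'
    have h3 := cross_mem_fat hw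
    have h4 := Submodule.add_mem _ (Submodule.sub_mem _ h1 h2) h3
    convert h4 using 1
    rw [map_sub, bd_cross, map_sub]
    abel

end CircleChains

/-! ### Splitting off the first coordinate and cutting out the reduced part -/

namespace CircleChains

open Hochschild

variable {F : Type u} [Field F]

theorem bd_mapDomain {r r' m : ℕ} (a : ∀ m, (Fin r → Fin (m + 1)) → (Fin r' → Fin (m + 1)))
    (ha : ∀ (k : Fin (m + 2)) f, (fun t => face m k (a (m + 1) f t)) = a m fun t => face m k (f t))
    (x : Chain F r (m + 1)) :
    bd r' m (Finsupp.lmapDomain F F (a (m + 1)) x) = Finsupp.lmapDomain F F (a m) (bd r m x) := by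
  have := mem_of_single (bd r' m ∘ₗ Finsupp.lmapDomain F F (a (m + 1)) -
    Finsupp.lmapDomain F F (a m) ∘ₗ bd r m) ⊥ (fun f => by
      simp only [LinearMap.sub_apply, LinearMap.comp_apply, Finsupp.lmapDomain_apply,
        Finsupp.mapDomain_single, bd_single, Submodule.mem_bot]
      rw [sub_eq_zero, ← Finsupp.lmapDomain_apply F F, map_sum]
      refine Finset.sum_congr rfl fun k _ => ?_
      rw [map_smul, Finsupp.lmapDomain_apply, Finsupp.mapDomain_single, ha]) x
  rw [Submodule.mem_bot] at this
  exact sub_eq_zero.1 this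

variable (F) in
/-- The subspace spanned by the tuples with an entry, other than the first, at the base point. -/
noncomputable def fatTail (n m : ℕ) : Submodule F (Chain F (n + 1) m) :=
  Finsupp.supported F F {f | ∃ t : Fin n, f t.succ = 0}

theorem single_mem_fatTail {n m : ℕ} {f : Fin (n + 1) → Fin (m + 1)}
    (h : ∃ t : Fin n, f t.succ = 0) (c : F) : Finsupp.single f c ∈ fatTail F n m :=
  Finsupp.single_mem_supported F c h

theorem map_mem_of_fatTail {n m : ℕ} {M : Type*} [AddCommGroup M] [Module F M]
    (φ : Chain F (n + 1) m →ₗ[F] M) (N : Submodule F M)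
    (h : ∀ f : Fin (n + 1) → Fin (m + 1), (∃ t : Fin n, f t.succ = 0) →
      φ (Finsupp.single f 1) ∈ N) {x : Chain F (n + 1) m} (hx : x ∈ fatTail F n m) : φ x ∈ N := by
  have : fatTail F n m ≤ N.comap φ := by
    rw [fatTail, Finsupp.supported_eq_span_single, Submodule.span_le]
    rintro _ ⟨f, hf, rfl⟩
    exact h f hf
  exact this hx

variable (F) in
/-- Restriction of a tuple to all entries but the first. -/
noncomputable def tailMap (n m : ℕ) : Chain F (n + 1) m →ₗ[F] Chain F n m :=
  Finsupp.lmapDomain F F fun f t => f t.succ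

variable (F) in
/-- Extension of a tuple by a first entry at the base point. -/
noncomputable def consZero (n m : ℕ) : Chain F n m →ₗ[F] Chain F (n + 1) m :=
  Finsupp.lmapDomain F F fun f => consFun 0 f

theorem tailMap_single {n m : ℕ} (f : Fin (n + 1) → Fin (m + 1)) (c : F) :
    tailMap F n m (Finsupp.single f c) = Finsupp.single (fun t => f t.succ) c := by
  simp [tailMap]

theorem consZero_single {n m : ℕ} (f : Fin n → Fin (m + 1)) (c : F) :
    consZero F n m (Finsupp.single f c) = Finsupp.single (consFun 0 f) c := by
  simp [consZero]

theorem bd_tailMap {n m : ℕ} (x : Chain F (n + 1) (m + 1)) :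
    bd n m (tailMap F n (m + 1) x) = tailMap F n m (bd (n + 1) m x) :=
  bd_mapDomain (fun _ f t => f t.succ) (fun _ _ => rfl) x

theorem bd_consZero {n m : ℕ} (x : Chain F n (m + 1)) :
    bd (n + 1) m (consZero F n (m + 1) x) = consZero F n m (bd n m x) :=
  bd_mapDomain (fun _ f => consFun 0 f) (fun k f => by rw [face_cons, face_zero_right]) x

/-- Modulo `fatTail` the chains split into those with first entry at the base point, which are the
chains on `n` coordinates modulo `fat`, and a complement isomorphic to the chains on `n + 1`
coordinates modulo `fat`. The two pairings are the obstructions in the two pieces. -/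
theorem exists_bd_sub_mem_fatTail (n m : ℕ) (z : Chain F (n + 1) m)
    (hz : ∀ m' (h : m = m' + 1), bd (n + 1) m' (h ▸ z) = 0)
    (h0 : pairing n m (tailMap F n m z) = 0) (h1 : pairing (n + 1) m z = 0) :
    ∃ w, bd (n + 1) m w - z ∈ fatTail F n m := by
  obtain ⟨w₁, hw₁⟩ := exists_bd_sub_mem_fat (n + 1) m z
    (fun m' h => by rw [hz]; exact Submodule.zero_mem _) h1
  obtain ⟨w₀, hw₀⟩ := exists_bd_sub_mem_fat n m (tailMap F n m z)
    (by
      rintro m' rfl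
      have := hz m' rfl
      simp only at this
      rw [bd_tailMap, this, map_zero]
      exact Submodule.zero_mem _) h0
  -- Subtracting the retraction from `w₁` removes its contribution to the first piece, which `w₀`
  -- fills.
  refine ⟨consZero F n _ w₀ + (w₁ - consZero F n _ (tailMap F n _ w₁)), ?_⟩
  have e0 : consZero F n m (bd n m w₀ - tailMap F n m z) ∈ fatTail F n m := by
    refine map_mem_fat _ _ (fun f ⟨t, ht⟩ => ?_) hw₀
    rw [consZero_single]
    exact single_mem_fatTail ⟨t, ht⟩ _
  have e1 : ((LinearMap.id : Chain F (n + 1) m →ₗ[F] _) - consZero F n m ∘ₗ tailMap F n m) (bd (n + 1) m w₁ - z) ∈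
      fatTail F n m := by
    refine map_mem_fat _ _ (fun f ⟨t, ht⟩ => ?_) hw₁
    rw [LinearMap.sub_apply, LinearMap.comp_apply, tailMap_single, consZero_single,
      LinearMap.id_apply]
    refine Fin.cases (fun ht => ?_) (fun t ht => ?_) t ht
    · have : consFun 0 (fun t => f t.succ) = f := by
        funext s
        exact Fin.cases ht.symm (fun s => rfl) s
      rw [this, sub_self]
      exact Submodule.zero_mem _
    · exact Submodule.sub_mem _ (single_mem_fatTail ⟨t, ht⟩ _)
        (single_mem_fatTail (f := consFun 0 fun t => f t.succ) ⟨t, ht⟩ _)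
  convert Submodule.add_mem _ e0 e1 using 1
  simp only [map_add, map_sub, bd_consZero, bd_tailMap, LinearMap.sub_apply,
    LinearMap.comp_apply, LinearMap.id_apply]
  abel

/-- The tuple with the entries indexed by `T`, shifted by one, moved to the base point. -/
def zeroOut {n : ℕ} (T : Finset (Fin n)) (m : ℕ) (f : Fin (n + 1) → Fin (m + 1)) :
    Fin (n + 1) → Fin (m + 1) :=
  consFun (f 0) fun i => if i ∈ T then 0 else f i.succ

/-- The projection along `fatTail` onto the tensors which are augmented in all factors but the
first. -/
noncomputable def cut (n m : ℕ) : Chain F (n + 1) m →ₗ[F] Chain F (n + 1) m :=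
  ∑ T : Finset (Fin n), (-1 : F) ^ T.card • Finsupp.lmapDomain F F (zeroOut T m)

theorem bd_cut (n m : ℕ) (x : Chain F (n + 1) (m + 1)) :
    bd (n + 1) m (cut n (m + 1) x) = cut n m (bd (n + 1) m x) := by
  simp only [cut, LinearMap.sum_apply, map_sum, LinearMap.smul_apply, map_smul]
  refine Finset.sum_congr rfl fun T _ => ?_
  rw [bd_mapDomain (zeroOut T)]
  intro k f
  rw [zeroOut, face_cons, zeroOut]
  congr 1
  funext t
  split_ifs
  · rw [face_zero_right]
  · rfl

/-- If entry `i` is already at the base point, then `T` and `T ∪ {i}` give the same tuple with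
opposite signs. -/
theorem cut_eq_zero {n m : ℕ} {x : Chain F (n + 1) m} (hx : x ∈ fatTail F n m) :
    cut n m x = 0 := by
  rw [← Submodule.mem_bot F]
  refine map_mem_of_fatTail _ _ (fun f ⟨i, hi⟩ => ?_) hx
  rw [Submodule.mem_bot]
  have hu : (Finset.univ : Finset (Finset (Fin n))) =
      (insert i (Finset.univ.erase i)).powerset := by
    rw [Finset.insert_erase (Finset.mem_univ i), Finset.powerset_univ]
  simp only [cut, LinearMap.sum_apply, LinearMap.smul_apply, Finsupp.lmapDomain_apply,
    Finsupp.mapDomain_single]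
  rw [hu, Finset.sum_powerset_insert (Finset.notMem_erase i _), ← Finset.sum_add_distrib]
  refine Finset.sum_eq_zero fun T hT => ?_
  have hiT : i ∉ T := fun h => Finset.notMem_erase i _ (Finset.mem_powerset.1 hT h)
  have : zeroOut (insert i T) m f = zeroOut T m f := by
    unfold zeroOut
    congr 1
    funext t
    by_cases ht : t = i
    · subst ht; simp [hi]
    · simp [ht]
  rw [this, Finset.card_insert_of_notMem hiT, pow_succ, mul_neg_one, neg_smul, add_neg_cancel]

/-- For nonempty `T` the map `zeroOut T` factors through the deletion of a coordinate in `T`, which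
kills `x`. Only the empty set contributes. -/
theorem cut_eq_self {n m : ℕ} (x : Chain F (n + 1) m)
    (hx : ∀ i : Fin n, Finsupp.lmapDomain F F
      (fun (f : Fin (n + 1) → Fin (m + 1)) (t : Fin n) => f (i.succ.succAbove t)) x = 0) :
    cut n m x = x := by
  rw [cut, LinearMap.sum_apply, Finset.sum_eq_single ∅]
  · have : zeroOut (n := n) ∅ m = id := by
      funext f t
      exact Fin.cases rfl (fun t => by simp [zeroOut]) t
    rw [this]
    simp
  · intro T _ hT
    obtain ⟨i, hi⟩ := Finset.nonempty_iff_ne_empty.2 hT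
    have : zeroOut T m = (fun f => zeroOut T m (i.succ.insertNth 0 f)) ∘
        fun (f : Fin (n + 1) → Fin (m + 1)) (t : Fin n) => f (i.succ.succAbove t) := by
      funext f t
      have hf : ∀ s, s ≠ i.succ → (i.succ.insertNth 0
          (fun t : Fin n => f (i.succ.succAbove t)) : Fin (n + 1) → Fin (m + 1)) s = f s := by
        intro s hs
        obtain ⟨s, rfl⟩ := Fin.exists_succAbove_eq hs
        simp
      refine Fin.cases ?_ (fun t => ?_) t
      · simp only [zeroOut, Function.comp, consFun_zero]
        rw [hf 0 (Fin.succ_ne_zero i).symm]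
      · simp only [zeroOut, Function.comp, consFun_succ]
        split_ifs with h
        · rfl
        · rw [hf t.succ]
          rintro h'
          rw [Fin.succ_inj] at h'
          exact h (h' ▸ hi)
    rw [LinearMap.smul_apply, this, Finsupp.lmapDomain_comp, LinearMap.comp_apply, hx, map_zero,
      smul_zero]
  · simp

/-- `cut` is a chain map that kills `fatTail` and fixes `z`, so it turns a filling modulo `fatTail`
into an exact one. -/
theorem exists_bd_eq (n m : ℕ) (z : Chain F (n + 1) m)
    (hz : ∀ m' (h : m = m' + 1), bd (n + 1) m' (h ▸ z) = 0)
    (h0 : pairing n m (tailMap F n m z) = 0) (h1 : pairing (n + 1) m z = 0)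
    (hd : ∀ i : Fin n, Finsupp.lmapDomain F F
      (fun (f : Fin (n + 1) → Fin (m + 1)) (t : Fin n) => f (i.succ.succAbove t)) z = 0) :
    ∃ w, bd (n + 1) m w = z := by
  obtain ⟨w, hw⟩ := exists_bd_sub_mem_fatTail n m z hz h0 h1
  refine ⟨cut n _ w, ?_⟩
  have := cut_eq_zero hw
  rw [map_sub, cut_eq_self z hd, sub_eq_zero] at this
  rw [bd_cut, this]

end CircleChains

/-! ### The simplicial circle and the normalization of the Hochschild complex -/

namespace CircleChains

open Hochschild

theorem card_filter_of_iff {N c : ℕ} (hc : c ≤ N) (p : Fin N → Prop) [DecidablePred p]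
    (h : ∀ a, p a ↔ (a : ℕ) < c) : (Finset.univ.filter p).card = c := by
  have : Finset.univ.filter p = Finset.univ.filter fun a : Fin N => (a : ℕ) < c := by
    ext a; simp [h]
  rw [this, Fin.card_filter_val_lt, min_eq_right hc]

/-- The number of elements with value below `j`. -/
def countBelow {l m : ℕ} (a : Fin l → Fin m) (j : ℕ) : ℕ :=
  (Finset.univ.filter fun i => (a i : ℕ) < j).card

theorem countBelow_le {l m : ℕ} (a : Fin l → Fin m) (j : ℕ) : countBelow a j ≤ l :=
  (Finset.card_le_univ _).trans_eq (Fintype.card_fin l)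

/-- For monotone `a` the indices with value below `j` form an initial segment, so its length decides
membership. -/
theorem lt_iff_lt_countBelow {l m : ℕ} {a : Fin l → Fin m} (ha : Monotone a) (j : ℕ) (k : Fin l) :
    (a k : ℕ) < j ↔ (k : ℕ) < countBelow a j := by
  constructor
  · intro h
    have : Finset.Iic k ⊆ Finset.univ.filter fun i => (a i : ℕ) < j := fun i hi =>
      Finset.mem_filter.2 ⟨Finset.mem_univ _,
        lt_of_le_of_lt (Fin.le_def.1 (ha (Finset.mem_Iic.1 hi))) h⟩
    have := Finset.card_le_card this
    rw [Fin.card_Iic] at this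
    exact this
  · intro h
    by_contra h'
    have : (Finset.univ.filter fun i => (a i : ℕ) < j) ⊆ Finset.Iio k := fun i hi => by
      rw [Finset.mem_Iio]
      by_contra hik
      have h1 := Fin.le_def.1 (ha (not_lt.1 hik))
      have h2 := (Finset.mem_filter.1 hi).2
      omega
    have := Finset.card_le_card this
    rw [Fin.card_Iio] at this
    unfold countBelow at h
    omega

theorem countBelow_comp {l m n : ℕ} (a : Fin l → Fin m) {b : Fin m → Fin n} (hb : Monotone b)
    (j : ℕ) : countBelow (fun i => b (a i)) j = countBelow a (countBelow b j) := by
  unfold countBelow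
  congr 1
  ext i
  simp only [Finset.mem_filter_univ]
  exact lt_iff_lt_countBelow hb j (a i)

/-- Think of a simplex of the circle as a monotone map to `{0, 1}`, recorded by its jump. The jumps
`0` and `m + 1` belong to the two constant maps, which are identified, and their images are again
constant. -/
theorem countBelow_mod {l m : ℕ} (a : Fin (l + 1) → Fin (m + 1)) (c : ℕ) (hc : c ≤ m + 1) :
    countBelow a (c % (m + 1)) % (l + 1) = countBelow a c % (l + 1) := by
  rcases hc.lt_or_eq with h | rfl
  · rw [Nat.mod_eq_of_lt h]
  · have h1 : countBelow a (m + 1) = l + 1 := card_filter_of_iff le_rfl _ fun i => by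
      have := (a i).isLt
      have := i.isLt
      omega
    have h2 : countBelow a 0 = 0 := card_filter_of_iff (Nat.zero_le _) _ fun i => by simp
    rw [Nat.mod_self, h1, h2, Nat.mod_self, Nat.zero_mod]

/-- The simplicial circle, with `n + 1` simplices of dimension `n`. -/
def circle : SimplicialObject FinSetN where
  obj Δ := FinSetN.mk (Δ.unop.len + 1)
  map {Δ Δ'} α := fun j : Fin (Δ.unop.len + 1) =>
    (⟨countBelow α.unop.toOrderHom j % (Δ'.unop.len + 1), Nat.mod_lt _ (Nat.succ_pos _)⟩ :
      Fin (Δ'.unop.len + 1))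
  map_id Δ := by
    funext j
    have hj : (j : ℕ) < Δ.unop.len + 1 := j.isLt
    apply Fin.ext
    change countBelow _ (j : ℕ) % (Δ.unop.len + 1) = j
    have : countBelow (fun i : Fin (Δ.unop.len + 1) => i) j = j :=
      card_filter_of_iff hj.le _ fun a => Iff.rfl
    exact (congrArg (· % (Δ.unop.len + 1)) this).trans (Nat.mod_eq_of_lt hj)
  map_comp {Δ Δ' Δ''} α β := by
    funext j
    apply Fin.ext
    change countBelow (fun i => α.unop.toOrderHom (β.unop.toOrderHom i)) j % _ =
      countBelow β.unop.toOrderHom (countBelow α.unop.toOrderHom j % (Δ'.unop.len + 1)) % _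
    rw [countBelow_comp _ α.unop.toOrderHom.monotone, countBelow_mod _ _ (countBelow_le _ _)]

variable (F : Type u) [Field F]

/-- The simplicial circle as a simplicial object of `Com`. -/
noncomputable def circleCom : SimplicialObject (ComPROP F) :=
  circle ⋙ Free.embedding F FinSetN

open Simplicial Opposite

theorem circleCom_map {m n : ℕ} (α : ⦋n⦌ ⟶ ⦋m⦌) (g : Fin (m + 1) → Fin (n + 1))
    (c : Fin (m + 1) → ℕ) (hc : ∀ j, c j ≤ n + 1)
    (h : ∀ (j : Fin (m + 1)) (a : Fin (n + 1)),
      ((α.toOrderHom a : Fin (m + 1)) : ℕ) < j ↔ (a : ℕ) < c j)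
    (hg : ∀ j, c j % (n + 1) = g j) :
    (circleCom F).map α.op = ComPROP.ofFun F g := by
  have : circle.map α.op = g := funext fun j => Fin.ext <|
    (congrArg (· % (n + 1)) (card_filter_of_iff (N := n + 1) (hc j) _ (h j))).trans (hg j)
  exact congrArg (fun f => (Free.embedding F FinSetN).map (X := FinSetN.mk (m + 1))
    (Y := FinSetN.mk (n + 1)) f) this

theorem circleCom_δ (n : ℕ) (i : Fin (n + 2)) :
    (circleCom F).δ i = ComPROP.ofFun F (face n i) := by
  refine circleCom_map F (m := n + 1) (n := n) (SimplexCategory.δ i) _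
    (fun j => if (j : ℕ) ≤ i then (j : ℕ) else j - 1) (fun j => ?_) (fun j a => ?_) (fun j => rfl)
  · have hj := j.isLt
    have hi := i.isLt
    split_ifs <;> omega
  · change ((i.succAbove a : Fin (n + 2)) : ℕ) < j ↔ _
    rw [Fin.succAbove]
    simp only [Fin.lt_def, Fin.val_castSucc, apply_ite Fin.val, Fin.val_succ]
    split_ifs <;> omega

theorem circleCom_σ (n : ℕ) (i : Fin (n + 1)) :
    (circleCom F).σ i = ComPROP.ofFun F (dgn n i) := by
  refine circleCom_map F (m := n) (n := n + 1) (SimplexCategory.σ i) _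
    (fun j => if (j : ℕ) ≤ i then (j : ℕ) else j + 1) (fun j => ?_) (fun j a => ?_) (fun j => ?_)
  · have hj := j.isLt
    split_ifs <;> omega
  · change ((i.predAbove a : Fin (n + 1)) : ℕ) < j ↔ _
    have h : ((i.predAbove a : Fin (n + 1)) : ℕ) = if (i : ℕ) < a then (a : ℕ) - 1 else a := by
      rw [Fin.predAbove]
      split_ifs with h1 h2 h2
      · rfl
      · exact (h2 h1).elim
      · exact (h1 h2).elim
      · rfl
    rw [h]
    split_ifs <;> omega
  · rw [dgn_val]
    have hj := j.isLt
    exact Nat.mod_eq_of_lt (by split_ifs <;> omega)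

open AlgebraicTopology AlgebraicTopology.DoldKan

/-- The sign arises because `bdry` numbers the faces from `1` and the alternating face map complex
from `0`. -/
theorem circleCom_d (n : ℕ) :
    (AlternatingFaceMapComplex.obj (circleCom F)).d (n + 1) n = - bdry F n := by
  rw [AlternatingFaceMapComplex.obj_d_eq]
  rw [bdry, ← Finset.sum_neg_distrib]
  refine Finset.sum_congr rfl fun i _ => ?_
  rw [circleCom_δ, pow_succ, mul_neg_one, neg_smul, neg_neg]
  rfl

/-- The projection onto the normalized chains. -/
noncomputable def nproj (n : ℕ) : FormalOp.Com F n n :=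
  (PInfty (X := circleCom F)).f n

/-- The homotopy between the projection onto the normalized chains and the identity. -/
noncomputable def nprojHtpy (n : ℕ) : FormalOp.Com F n (n + 1) :=
  (homotopyPInftyToId (circleCom F)).hom n (n + 1)

theorem nproj_comp_bdry (n : ℕ) : nproj F (n + 1) ≫ bdry F n = bdry F n ≫ nproj F n := by
  have h := (PInfty (X := circleCom F)).comm (n + 1) n
  rw [circleCom_d] at h
  have h' : nproj F (n + 1) ≫ (-bdry F n) = (-bdry F n) ≫ nproj F n := h
  rwa [Preadditive.comp_neg, Preadditive.neg_comp, neg_inj] at h'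

theorem nproj_idem (n : ℕ) : nproj F n ≫ nproj F n = nproj F n :=
  PInfty_f_idem (X := circleCom F) n

theorem dgn_comp_nproj (n : ℕ) (i : Fin (n + 1)) :
    ComPROP.ofFun F (dgn n i) ≫ nproj F (n + 1) = 0 := by
  have := σ_comp_PInfty (circleCom F) i
  rwa [circleCom_σ] at this

theorem nproj_zero : nproj F 0 = 𝟙 _ := PInfty_f_0 (X := circleCom F)

theorem nproj_succ_eq (n : ℕ) : nproj F (n + 1) =
    𝟙 _ - (bdry F n ≫ nprojHtpy F n + nprojHtpy F (n + 1) ≫ bdry F (n + 1)) := by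
  have h := (homotopyPInftyToId (circleCom F)).comm (n + 1)
  rw [dNext_eq (i := n + 1) (i' := n) _ rfl, prevD_eq (j := n + 1) (j' := n + 2) _ rfl,
    circleCom_d, circleCom_d] at h
  have h' : nproj F (n + 1) = (-bdry F n) ≫ nprojHtpy F n +
    nprojHtpy F (n + 1) ≫ (-bdry F (n + 1)) + 𝟙 _ := h
  rw [h', Preadditive.comp_neg, Preadditive.neg_comp]
  abel

theorem nproj_zero_eq : nproj F 0 = 𝟙 _ - nprojHtpy F 0 ≫ bdry F 0 := by
  have h := (homotopyPInftyToId (circleCom F)).comm 0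
  rw [Homotopy.dNext_zero_chainComplex, zero_add, prevD_eq (j := 0) (j' := 1) _ rfl,
    circleCom_d] at h
  have h' : nproj F 0 = nprojHtpy F 0 ≫ (-bdry F 0) + 𝟙 _ := h
  rw [h', Preadditive.comp_neg]
  abel

/-- The span of the pointed maps in `Com(n + 1, m + 1)` with a given property. -/
noncomputable def pointedSpan (n m : ℕ) (p : (Fin (n + 1) → Fin (m + 1)) → Prop) :
    Submodule F (FormalOp.Com F n m) :=
  Submodule.span F {x | ∃ g, g 0 = 0 ∧ p g ∧ x = ComPROP.ofFun F g}

variable {F}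

theorem comp_mem_pointedSpan {l m n : ℕ} {p : (Fin (l + 1) → Fin (m + 1)) → Prop}
    {q : (Fin (l + 1) → Fin (n + 1)) → Prop} {x : FormalOp.Com F l m} (hx : x ∈ pointedSpan F l m p)
    (g : Fin (m + 1) → Fin (n + 1)) (hg : g 0 = 0) (h : ∀ f, p f → q fun t => g (f t)) :
    (x ≫ ComPROP.ofFun F g : FormalOp.Com F l n) ∈ pointedSpan F l n q := by
  induction hx using Submodule.span_induction with
  | mem x hx =>
    obtain ⟨f, h0, hf, rfl⟩ := hx
    rw [ComPROP.ofFun_comp]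
    exact Submodule.subset_span ⟨_, by rw [h0, hg], h f hf, rfl⟩
  | zero => rw [Limits.zero_comp]; exact Submodule.zero_mem _
  | add x y _ _ hx hy => rw [Preadditive.add_comp]; exact Submodule.add_mem _ hx hy
  | smul c x _ hx => rw [Linear.smul_comp]; exact Submodule.smul_mem _ _ hx

theorem id_eq_ofFun (n : ℕ) : 𝟙 (ComPROP.obj F n) = ComPROP.ofFun F id :=
  ((Free.embedding F FinSetN).map_id (FinSetN.mk n)).symm

variable (F)

/-- The components of the projections `P q` of the Dold-Kan correspondence. -/
noncomputable def partP (q n : ℕ) : FormalOp.Com F n n := (P (X := circleCom F) q).f n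

/-- The components of the projections `Q q` of the Dold-Kan correspondence. -/
noncomputable def partQ (q n : ℕ) : FormalOp.Com F n n := (Q (X := circleCom F) q).f n

theorem partP_add_partQ (q n : ℕ) : partP F q n + partQ F q n = 𝟙 _ :=
  P_add_Q_f (X := circleCom F) q n

theorem partQ_succ (q n : ℕ) : partQ F q (n + 1) =
    ∑ i : Fin (n + 1) with i.val < q, partP F i (n + 1) ≫
      ComPROP.ofFun F (face n i.rev.succ) ≫ ComPROP.ofFun F (dgn n i.rev) := by
  refine (decomposition_Q (X := circleCom F) n q).trans (Finset.sum_congr rfl fun i _ => ?_)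
  rw [circleCom_δ, circleCom_σ]
  rfl

/-- Each summand of `Q` ends with a face followed by a degeneracy, so it passes through a smaller
set and cannot be injective. The factor in front is pointed by induction, since `P = 1 - Q`. -/
theorem partQ_mem_pointedSpan (n q : ℕ) :
    partQ F q (n + 1) ∈ pointedSpan F (n + 1) (n + 1) fun g => ¬ Function.Injective g := by
  induction q using Nat.strong_induction_on with
  | _ q ih =>
    rw [partQ_succ]
    refine Submodule.sum_mem _ fun i hi => ?_
    have hP : partP F i (n + 1) ∈ pointedSpan F (n + 1) (n + 1) fun _ => True := by
      rw [eq_sub_of_add_eq (partP_add_partQ F i (n + 1)), id_eq_ofFun]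
      refine Submodule.sub_mem _ (Submodule.subset_span ⟨id, rfl, trivial, rfl⟩) ?_
      refine Submodule.span_mono ?_ (ih i (Finset.mem_filter.1 hi).2)
      rintro x ⟨g, h0, -, rfl⟩
      exact ⟨g, h0, trivial, rfl⟩
    have h1 := comp_mem_pointedSpan hP (face n i.rev.succ) (face_zero_right _ _)
      (q := fun _ => True) fun _ _ => trivial
    have h2 := comp_mem_pointedSpan h1 (dgn n i.rev) (dgn_zero_right _ _)
      (q := fun g => ¬ Function.Injective g) fun f _ hf => by
        have := Fintype.card_le_of_injective f
          (Function.Injective.of_comp (f := dgn n i.rev) (g := f) hf)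
        simp at this
    rw [Category.assoc] at h2
    exact h2

/-- Noninjective pointed maps will be invisible to `lamZero` and `lamOne`, so normalization does not
affect the detection of generators. -/
theorem nproj_sub_mem_pointedSpan (n : ℕ) :
    𝟙 _ - nproj F n ∈ pointedSpan F n n fun g => ¬ Function.Injective g := by
  obtain _ | n := n
  · rw [nproj_zero, sub_self]
    exact Submodule.zero_mem _
  · have h : nproj F (n + 1) = partP F (n + 1) (n + 1) := rfl
    rw [h, sub_eq_of_eq_add' (partP_add_partQ F (n + 1) (n + 1)).symm]
    exact partQ_mem_pointedSpan F n (n + 1)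

end CircleChains

/-! ### The vertical homology of the complex of formal operations -/

namespace CircleChains

open Hochschild FormalOp

variable {F : Type u} [Field F]

/-- Elements of `Com(n + 1, m + 1)` as chains. -/
noncomputable def toChain (n m : ℕ) : Com F n m ≃ₗ[F] Chain F (n + 1) m :=
  LinearEquiv.refl F (Chain F (n + 1) m)

theorem toChain_ofFun {n m : ℕ} (g : Fin (n + 1) → Fin (m + 1)) :
    toChain n m (ComPROP.ofFun F g) = Finsupp.single g 1 := rfl

theorem com_ext {n m : ℕ} {M : Type*} [AddCommGroup M] [Module F M] {φ ψ : Com F n m →ₗ[F] M}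
    (h : ∀ g, φ (ComPROP.ofFun F g) = ψ (ComPROP.ofFun F g)) (x : Com F n m) : φ x = ψ x := by
  have : φ ∘ₗ (toChain n m).symm.toLinearMap = ψ ∘ₗ (toChain n m).symm.toLinearMap := by
    refine Finsupp.lhom_ext' fun g => LinearMap.ext_ring ?_
    exact h g
  have h2 := LinearMap.congr_fun this (toChain n m x)
  simpa using h2

theorem toChain_comp_ofFun {n m k : ℕ} (g : Fin (m + 1) → Fin (k + 1)) (x : Com F n m) :
    toChain n k (x ≫ ComPROP.ofFun F g) =
      Finsupp.lmapDomain F F (fun f t => g (f t)) (toChain n m x) :=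
  com_ext (φ := (toChain n k).toLinearMap ∘ₗ Linear.rightComp F _ (ComPROP.ofFun F g))
    (ψ := Finsupp.lmapDomain F F (fun f t => g (f t)) ∘ₗ (toChain n m).toLinearMap)
    (fun f => by
      simp only [LinearMap.comp_apply, Linear.rightComp_apply, LinearEquiv.coe_coe]
      rw [ComPROP.ofFun_comp, toChain_ofFun, toChain_ofFun]
      simp) x

theorem toChain_ofFun_comp {n m k : ℕ} (g : Fin (n + 1) → Fin (m + 1)) (x : Com F m k) :
    toChain n k (ComPROP.ofFun F g ≫ x) =
      Finsupp.lmapDomain F F (fun f t => f (g t)) (toChain m k x) :=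
  com_ext (φ := (toChain n k).toLinearMap ∘ₗ Linear.leftComp F _ (ComPROP.ofFun F g))
    (ψ := Finsupp.lmapDomain F F (fun f t => f (g t)) ∘ₗ (toChain m k).toLinearMap)
    (fun f => by
      simp only [LinearMap.comp_apply, Linear.leftComp_apply, LinearEquiv.coe_coe]
      rw [ComPROP.ofFun_comp, toChain_ofFun, toChain_ofFun]
      simp) x

theorem toChain_comp_bdry {n m : ℕ} (x : Com F n (m + 1)) :
    toChain n m (x ≫ bdry F m) = - bd (n + 1) m (toChain n (m + 1) x) := by
  rw [bdry, Preadditive.comp_sum, map_sum, bd, LinearMap.sum_apply, ← Finset.sum_neg_distrib]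
  refine Finset.sum_congr rfl fun i _ => ?_
  rw [Preadditive.comp_zsmul, map_zsmul, toChain_comp_ofFun, pow_succ, mul_neg_one, neg_smul,
    LinearMap.smul_apply, neg_inj]
  rcases neg_one_pow_eq_or ℤ (i : ℕ) with h | h
  · have h' : (-1 : F) ^ (i : ℕ) = 1 := by exact_mod_cast congrArg (Int.cast : ℤ → F) h
    rw [h, h', one_smul, one_smul]
  · have h' : (-1 : F) ^ (i : ℕ) = -1 := by exact_mod_cast congrArg (Int.cast : ℤ → F) h
    rw [h, h', neg_one_smul, neg_one_smul]

/-- The functional which detects the homology of `Com(n + 1, -)` in dimension `n`. -/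
noncomputable def lamZero (n m : ℕ) : Com F n m →ₗ[F] F :=
  pairing n m ∘ₗ tailMap F n m ∘ₗ (toChain n m).toLinearMap

/-- The functional which detects the homology of `Com(n + 1, -)` in dimension `n + 1`. -/
noncomputable def lamOne (n m : ℕ) : Com F n m →ₗ[F] F :=
  pairing (n + 1) m ∘ₗ (toChain n m).toLinearMap

theorem lamZero_of_ne {n m : ℕ} (h : m ≠ n) (x : Com F n m) : lamZero n m x = 0 :=
  pairing_of_ne h _

theorem lamOne_of_ne {n m : ℕ} (h : m ≠ n + 1) (x : Com F n m) : lamOne n m x = 0 :=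
  pairing_of_ne h _

theorem lamZero_ofFun {n m : ℕ} (g : Fin (n + 1) → Fin (m + 1)) :
    lamZero n m (ComPROP.ofFun F g) =
      if m = n ∧ ∀ t : Fin n, (g t.succ : ℕ) = t + 1 then 1 else 0 := by
  rw [lamZero, LinearMap.comp_apply, LinearMap.comp_apply, LinearEquiv.coe_coe, toChain_ofFun,
    tailMap_single, pairing_single]

theorem lamOne_ofFun {n m : ℕ} (g : Fin (n + 1) → Fin (m + 1)) :
    lamOne n m (ComPROP.ofFun F g) =
      if m = n + 1 ∧ ∀ t : Fin (n + 1), (g t : ℕ) = t + 1 then 1 else 0 := by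
  rw [lamOne, LinearMap.comp_apply, LinearEquiv.coe_coe, toChain_ofFun, pairing_single]

theorem lamZero_comp_bdry {n m : ℕ} (x : Com F n (m + 1)) :
    lamZero n m (x ≫ bdry F m) = 0 := by
  rw [lamZero, LinearMap.comp_apply, LinearMap.comp_apply, LinearEquiv.coe_coe,
    toChain_comp_bdry, map_neg, ← bd_tailMap, map_neg, pairing_bd, neg_zero]

theorem lamOne_comp_bdry {n m : ℕ} (x : Com F n (m + 1)) :
    lamOne n m (x ≫ bdry F m) = 0 := by
  rw [lamOne, LinearMap.comp_apply, LinearEquiv.coe_coe,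
    toChain_comp_bdry, map_neg, pairing_bd, neg_zero]

/-- Hence precomposition with a degeneracy deletes a coordinate other than the first, and normalized
elements satisfy the deletion hypothesis of `exists_bd_eq`. -/
theorem dgn_eq_succAbove (m : ℕ) (i t : Fin (m + 1)) : dgn m i t = i.succ.succAbove t := by
  rw [dgn, Fin.succAbove]
  simp only [Fin.lt_def, Fin.le_def, Fin.val_castSucc, Fin.val_succ, Nat.lt_succ_iff]

/-- A normalized vertical cycle on which the detecting functionals vanish is the boundary of a
normalized element. -/
theorem exists_comp_bdry_eq {n m : ℕ} (z : Com F n m) (hn : nproj F n ≫ z = z)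
    (hz : z ≫ dCom F m (m - 1) = 0) (h0 : lamZero n m z = 0) (h1 : lamOne n m z = 0) :
    ∃ w : Com F n (m + 1), nproj F n ≫ w = w ∧ w ≫ bdry F m = z := by
  obtain ⟨w, hw⟩ := exists_bd_eq n m (toChain n m z) (by
      rintro m' rfl
      rw [Nat.add_sub_cancel, dCom_succ] at hz
      have := toChain_comp_bdry z
      rw [hz, map_zero] at this
      exact neg_eq_zero.1 this.symm) h0 h1 (fun i => by
      obtain _ | n := n
      · exact i.elim0
      · have h := dgn_comp_nproj F n i
        have h' : ComPROP.ofFun F (dgn n i) ≫ z = 0 := by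
          rw [← hn, ← Category.assoc, h, Limits.zero_comp]
        have h2 := toChain_ofFun_comp (dgn n i) z
        rw [h', map_zero] at h2
        simp only [dgn_eq_succAbove] at h2
        exact h2.symm)
  -- Normalization acts on the left and the boundary on the right, so the normalized filling still
  -- has boundary `nproj F n ≫ z = z`.
  refine ⟨nproj F n ≫ (-(toChain n (m + 1)).symm w), ?_, ?_⟩
  · rw [← Category.assoc, nproj_idem]
  · rw [Category.assoc, Preadditive.neg_comp]
    have : -((toChain n (m + 1)).symm w ≫ bdry F m) = z := by
      apply (toChain n m).injective
      rw [map_neg, toChain_comp_bdry, LinearEquiv.apply_symm_apply, neg_neg, hw]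
    rw [this, hn]

/-- `lamZero` ignores the first entry, but a pointed map on which it is nonzero must be the
identity. Pointedness of `y` keeps the composite among pointed maps. -/
theorem lamZero_comp_eq_zero {n m : ℕ} {x : Com F n m} {k : ℕ}
    (hx : x ∈ pointedSpan F n m fun g => ¬ Function.Injective g) {y : Com F m k}
    (hy : y ∈ pointedSpan F m k fun _ => True) : lamZero n k (x ≫ y) = 0 := by
  induction hy using Submodule.span_induction with
  | mem y hy =>
    obtain ⟨g, hg, -, rfl⟩ := hy
    have h := comp_mem_pointedSpan hx g hg (q := fun g => ¬ Function.Injective g)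
      fun f hf h => hf (Function.Injective.of_comp (f := g) (g := f) h)
    generalize x ≫ ComPROP.ofFun F g = v at h ⊢
    induction h using Submodule.span_induction with
    | mem y hy =>
      obtain ⟨f, h0, hf, rfl⟩ := hy
      rw [lamZero_ofFun, if_neg]
      rintro ⟨-, h⟩
      refine hf fun a b hab => ?_
      have hv : ∀ a, (f a : ℕ) = a := fun a =>
        Fin.cases (by rw [h0]; rfl) (fun a => by rw [h]; rfl) a
      exact Fin.ext (by rw [← hv a, ← hv b, hab])
    | zero => rw [map_zero]
    | add x y _ _ hx hy => rw [map_add, hx, hy, add_zero]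
    | smul c x _ hx => rw [map_smul, hx, smul_zero]
  | zero => rw [Limits.comp_zero, map_zero]
  | add x y _ _ hx hy => rw [Preadditive.comp_add, map_add, hx, hy, add_zero]
  | smul c x _ hx => rw [Linear.comp_smul, map_smul, hx, smul_zero]

/-- `lamOne` sees only the injective tuple `(1, …, n + 1)`, first entry included, so nothing need be
assumed about `y`. -/
theorem lamOne_comp_eq_zero {n m : ℕ} {x : Com F n m} {k : ℕ}
    (hx : x ∈ pointedSpan F n m fun g => ¬ Function.Injective g) (y : Com F m k) :
    lamOne n k (x ≫ y) = 0 := by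
  induction hx using Submodule.span_induction with
  | mem x hx =>
    obtain ⟨f, -, hf, rfl⟩ := hx
    refine com_ext (φ := lamOne n k ∘ₗ Linear.leftComp F _ (ComPROP.ofFun F f)) (ψ := 0)
      (fun g => ?_) y
    rw [LinearMap.comp_apply, Linear.leftComp_apply, ComPROP.ofFun_comp, lamOne_ofFun, if_neg]
    · rfl
    · rintro ⟨-, h⟩
      refine hf fun a b hab => Fin.ext ?_
      have h1 := h a
      rw [hab, h b] at h1
      omega
  | zero => rw [Limits.zero_comp, map_zero]
  | add x y _ _ hx hy => rw [Preadditive.add_comp, map_add, hx, hy, add_zero]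
  | smul c x _ hx => rw [Linear.smul_comp, map_smul, hx, smul_zero]

theorem lamZero_nproj_comp {n k : ℕ} {y : Com F n k} (hy : y ∈ pointedSpan F n k fun _ => True) :
    lamZero n k (nproj F n ≫ y) = lamZero n k y := by
  have := lamZero_comp_eq_zero (nproj_sub_mem_pointedSpan F n) hy
  rwa [Preadditive.sub_comp, Category.id_comp, map_sub, sub_eq_zero, eq_comm] at this

theorem lamOne_nproj_comp {n k : ℕ} (y : Com F n k) :
    lamOne n k (nproj F n ≫ y) = lamOne n k y := by
  have := lamOne_comp_eq_zero (nproj_sub_mem_pointedSpan F n) y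
  rwa [Preadditive.sub_comp, Category.id_comp, map_sub, sub_eq_zero, eq_comm] at this

end CircleChains

/-! ### Signed sums over colorings -/

namespace CircleChains

open Hochschild FormalOp

/-- The permutation which maps `i` to `s` and is order isomorphic to `σ` on the other
elements. -/
def insertPerm {n : ℕ} (σ : Equiv.Perm (Fin n)) (i s : Fin (n + 1)) : Equiv.Perm (Fin (n + 1)) :=
  s.cycleRange.symm * Equiv.Perm.decomposeFin.symm (0, σ) * i.cycleRange

theorem insertPerm_self {n : ℕ} (σ : Equiv.Perm (Fin n)) (i s : Fin (n + 1)) :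
    insertPerm σ i s i = s := by
  simp [insertPerm]

theorem insertPerm_succAbove {n : ℕ} (σ : Equiv.Perm (Fin n)) (i s : Fin (n + 1)) (t : Fin n) :
    insertPerm σ i s (i.succAbove t) = s.succAbove (σ t) := by
  simp [insertPerm, Fin.cycleRange_succAbove]

theorem sign_insertPerm {n : ℕ} (σ : Equiv.Perm (Fin n)) (i s : Fin (n + 1)) :
    (Equiv.Perm.sign (insertPerm σ i s) : ℤ) =
      (-1) ^ (i + s : ℕ) * Equiv.Perm.sign σ := by
  simp [insertPerm, Fin.sign_cycleRange, pow_add]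
  ring

theorem sort_eq_of_forall {n k : ℕ} {c : Fin n → Fin k} {τ : Equiv.Perm (Fin n)}
    (h : ∀ t t', t < t' → c (τ t) ≤ c (τ t') ∧ (c (τ t) = c (τ t') → τ t < τ t')) :
    Tuple.sort c = τ :=
  (Tuple.eq_sort_iff.2 ⟨fun t t' htt' => by
    rcases htt'.eq_or_lt with rfl | h'
    · exact le_rfl
    · exact (h t t' h').1, fun t t' htt' => (h t t' htt').2⟩).symm

theorem sort_spec {n k : ℕ} (c : Fin n → Fin k) {t t' : Fin n} (h : t < t') :
    c (Tuple.sort c t) ≤ c (Tuple.sort c t') ∧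
      (c (Tuple.sort c t) = c (Tuple.sort c t') → Tuple.sort c t < Tuple.sort c t') :=
  have := (Tuple.eq_sort_iff (f := c) (σ := Tuple.sort c)).1 rfl
  ⟨this.1 h.le, this.2 t t' h⟩

/-- Adding the element `s` to a sorted colouring leaves the order of the others alone; it only has
to be checked that `s` belongs at rank `i`. -/
theorem sort_eq_insertPerm {n k : ℕ} (c : Fin (n + 1) → Fin k) (i s : Fin (n + 1))
    {d : Fin n → Fin k} (hd : d = fun t => c (s.succAbove t))
    (h1 : ∀ u : Fin n, u.castSucc < i → d (Tuple.sort d u) ≤ c s ∧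
      (d (Tuple.sort d u) = c s → s.succAbove (Tuple.sort d u) < s))
    (h2 : ∀ u : Fin n, i ≤ u.castSucc → c s ≤ d (Tuple.sort d u) ∧
      (c s = d (Tuple.sort d u) → s < s.succAbove (Tuple.sort d u))) :
    Tuple.sort c = insertPerm (Tuple.sort d) i s := by
  have hd' : ∀ t, c (s.succAbove t) = d t := fun t => by rw [hd]
  refine sort_eq_of_forall fun t t' htt' => ?_
  rcases Fin.eq_self_or_eq_succAbove i t with ht | ⟨u, rfl⟩ <;>
    rcases Fin.eq_self_or_eq_succAbove i t' with ht' | ⟨v, rfl⟩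
  · exact absurd htt' (by rw [ht, ht']; exact lt_irrefl _)
  · rw [ht] at htt' ⊢
    rw [insertPerm_self, insertPerm_succAbove, hd']
    exact h2 v (Fin.lt_succAbove_iff_le_castSucc _ _ |>.1 htt')
  · rw [ht'] at htt' ⊢
    rw [insertPerm_self, insertPerm_succAbove, hd']
    exact h1 u (Fin.succAbove_lt_iff_castSucc_lt _ _ |>.1 htt')
  · rw [insertPerm_succAbove, insertPerm_succAbove, hd', hd']
    have := sort_spec d ((Fin.strictMono_succAbove i).lt_iff_lt.1 htt')
    exact ⟨this.1, fun h => Fin.strictMono_succAbove s (this.2 h)⟩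

theorem predAbove_insertPerm {n : ℕ} (σ : Equiv.Perm (Fin n)) (i : Fin n) (t : Fin (n + 1)) :
    (σ i).predAbove (insertPerm σ i.castSucc (σ i).castSucc t) = σ (i.predAbove t) := by
  obtain rfl | ⟨u, rfl⟩ := Fin.eq_self_or_eq_succAbove i.castSucc t
  · rw [insertPerm_self, Fin.predAbove_castSucc_self, Fin.predAbove_castSucc_self]
  · rw [insertPerm_succAbove, Fin.predAbove_succAbove, Fin.predAbove_succAbove]

/-- Doubling the element of rank `i` creates two neighbours of equal colour, and a stable sort keeps
them adjacent at that rank. -/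
theorem sort_comp_predAbove {n k : ℕ} (d : Fin n → Fin k) (i : Fin n) :
    Tuple.sort (fun t => d ((Tuple.sort d i).predAbove t)) =
      insertPerm (Tuple.sort d) i.castSucc (Tuple.sort d i).castSucc := by
  refine sort_eq_insertPerm _ _ _ ?_ (fun u hu => ?_) (fun u hu => ?_)
  · funext t
    rw [Fin.predAbove_succAbove]
  · have := sort_spec d (Fin.castSucc_lt_castSucc_iff.1 hu)
    simp only [Fin.predAbove_castSucc_self]
    exact ⟨this.1, fun h => Fin.succAbove_lt_iff_castSucc_lt _ _ |>.2 (this.2 h)⟩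
  · simp only [Fin.predAbove_castSucc_self]
    rcases (Fin.castSucc_le_castSucc_iff.1 hu).eq_or_lt with rfl | hu
    · exact ⟨le_rfl, fun _ => Fin.lt_succAbove_iff_le_castSucc _ _ |>.2 le_rfl⟩
    · have := sort_spec d hu
      exact ⟨this.1, fun h => Fin.lt_succAbove_iff_le_castSucc _ _ |>.2 (this.2 h).le⟩

theorem sort_cons_zero {n k : ℕ} (d : Fin n → Fin (k + 1)) :
    Tuple.sort (Fin.cons 0 d : Fin (n + 1) → Fin (k + 1)) = insertPerm (Tuple.sort d) 0 0 := by
  refine sort_eq_insertPerm _ _ _ ?_ (fun u hu => absurd hu (Fin.not_lt_zero _)) (fun u _ => ?_)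
  · funext t
    simp
  · simp only [Fin.cons_zero]
    exact ⟨Fin.zero_le _, fun _ => by simp⟩

theorem sort_snoc_last {n k : ℕ} (d : Fin n → Fin (k + 1)) :
    Tuple.sort (Fin.snoc d (Fin.last k) : Fin (n + 1) → Fin (k + 1)) =
      insertPerm (Tuple.sort d) (Fin.last n) (Fin.last n) := by
  refine sort_eq_insertPerm _ _ _ ?_ (fun u _ => ?_) (fun u hu => ?_)
  · funext t
    simp
  · simp only [Fin.snoc_last]
    exact ⟨Fin.le_last _, fun _ => by simp [Fin.castSucc_lt_last]⟩
  · exact absurd hu (not_le.2 (Fin.castSucc_lt_last u))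

theorem finRotate_symm_zero (n : ℕ) : (finRotate (n + 1)).symm 0 = Fin.last n := by
  rw [Equiv.symm_apply_eq, finRotate_last]

theorem finRotate_symm_succ {n : ℕ} (t : Fin n) :
    (finRotate (n + 1)).symm t.succ = t.castSucc := by
  rw [Equiv.symm_apply_eq, finRotate_apply]
  simp

/-- Coming first among the elements of colour `j + 1` is the same place in the sorted order as
coming last among those of colour `j`. So only the names of the elements are rotated. -/
theorem sort_snoc_castSucc {n k : ℕ} (d : Fin n → Fin (k + 1)) (j : Fin k) :
    Tuple.sort (Fin.snoc d j.castSucc : Fin (n + 1) → Fin (k + 1)) =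
      (finRotate (n + 1)).symm * Tuple.sort (Fin.cons j.succ d : Fin (n + 1) → Fin (k + 1)) := by
  refine sort_eq_of_forall fun t t' htt' => ?_
  have := sort_spec (Fin.cons j.succ d : Fin (n + 1) → Fin (k + 1)) htt'
  rw [Equiv.Perm.mul_apply, Equiv.Perm.mul_apply]
  generalize Tuple.sort (Fin.cons j.succ d : Fin (n + 1) → Fin (k + 1)) t = x at this ⊢
  generalize Tuple.sort (Fin.cons j.succ d : Fin (n + 1) → Fin (k + 1)) t' = y at this ⊢
  cases x using Fin.cases with
  | zero =>
    cases y using Fin.cases with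
    | zero => exact absurd (this.2 rfl) (lt_irrefl _)
    | succ y =>
      rw [finRotate_symm_zero, finRotate_symm_succ, Fin.snoc_last, Fin.snoc_castSucc]
      simp only [Fin.cons_zero, Fin.cons_succ] at this
      have h := lt_of_lt_of_le (Fin.castSucc_lt_succ (i := j)) this.1
      exact ⟨h.le, fun h' => absurd h' h.ne⟩
  | succ x =>
    cases y using Fin.cases with
    | zero =>
      rw [finRotate_symm_zero, finRotate_symm_succ, Fin.snoc_last, Fin.snoc_castSucc]
      simp only [Fin.cons_zero, Fin.cons_succ, Fin.not_lt_zero, imp_false] at this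
      exact ⟨Fin.le_castSucc_iff.2 (lt_of_le_of_ne this.1 this.2),
        fun _ => Fin.castSucc_lt_last x⟩
    | succ y =>
      rw [finRotate_symm_succ, finRotate_symm_succ, Fin.snoc_castSucc, Fin.snoc_castSucc]
      simp only [Fin.cons_succ, Fin.succ_lt_succ_iff] at this
      exact ⟨this.1, fun h => Fin.castSucc_lt_castSucc_iff.2 (this.2 h)⟩

/-- Neighbours of different colours are ordered by colour alone, so exchanging them merely renames
them. -/
theorem sort_comp_swap {n k : ℕ} (c : Fin (n + 1) → Fin k) (s : Fin n)
    (h : c s.castSucc ≠ c s.succ) :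
    Tuple.sort (fun t => c (Equiv.swap s.castSucc s.succ t)) =
      Equiv.swap s.castSucc s.succ * Tuple.sort c := by
  refine sort_eq_of_forall fun t t' htt' => ?_
  have := sort_spec c htt'
  simp only [Equiv.Perm.mul_apply, Equiv.swap_apply_self]
  refine ⟨this.1, fun hc => ?_⟩
  have hlt := this.2 hc
  generalize Tuple.sort c t = x at *
  generalize Tuple.sort c t' = y at *
  have hs : ∀ z, (Equiv.swap s.castSucc s.succ z : ℕ) =
      if (z : ℕ) = s then (s : ℕ) + 1 else if (z : ℕ) = s + 1 then (s : ℕ) else z := fun z => by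
    rw [Equiv.swap_apply_def]
    simp only [Fin.ext_iff, Fin.val_castSucc, Fin.val_succ]
    split_ifs <;> simp_all
  rw [Fin.lt_def, hs, hs]
  rw [Fin.lt_def] at hlt
  have hne : ¬ ((x : ℕ) = s ∧ (y : ℕ) = s + 1) := fun ⟨h1, h2⟩ => h <| by
    obtain rfl : x = s.castSucc := Fin.ext h1
    obtain rfl : y = s.succ := Fin.ext h2
    exact hc
  split_ifs <;> omega

theorem predAbove_swap {n : ℕ} (s : Fin n) (t : Fin (n + 1)) :
    s.predAbove (Equiv.swap s.castSucc s.succ t) = s.predAbove t := by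
  rw [Equiv.swap_apply_def]
  split_ifs with h1 h2
  · rw [h1]; simp
  · rw [h2]; simp
  · rfl

/-- The pointed map given by a permutation. -/
def pointedPerm {n : ℕ} (σ : Equiv.Perm (Fin n)) : Fin (n + 1) → Fin (n + 1) :=
  Fin.cons 0 fun i => (σ i).succ

theorem pointedPerm_zero {n : ℕ} (σ : Equiv.Perm (Fin n)) : pointedPerm σ 0 = 0 := rfl

theorem pointedPerm_succ {n : ℕ} (σ : Equiv.Perm (Fin n)) (t : Fin n) :
    pointedPerm σ t.succ = (σ t).succ := rfl

theorem face_succ_castSucc (n : ℕ) (s : Fin n) (t : Fin (n + 1)) :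
    face n s.castSucc.succ t.succ = (s.predAbove t).succ := by
  apply Fin.ext
  have h : ((s.predAbove t : Fin n) : ℕ) = if (s : ℕ) < t then (t : ℕ) - 1 else t := by
    rw [Fin.predAbove]
    split_ifs with h1 h2 h2
    · rfl
    · exact (h2 h1).elim
    · exact (h1 h2).elim
    · rfl
  rw [face_val, Fin.val_succ, Fin.val_succ, Fin.val_succ, h, Fin.val_castSucc]
  have := s.isLt
  have := t.isLt
  split_ifs <;> omega

theorem face_zero_succ (n : ℕ) (t : Fin (n + 1)) : face n 0 t.succ = t := by
  apply Fin.ext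
  rw [face_val, Fin.val_succ, Fin.val_zero]
  have := t.isLt
  split_ifs <;> omega

theorem face_last_castSucc (n : ℕ) (t : Fin (n + 1)) : face n (Fin.last (n + 1)) t.castSucc = t := by
  apply Fin.ext
  rw [face_val, Fin.val_castSucc, Fin.val_last]
  have := t.isLt
  split_ifs <;> omega

theorem face_last_last (n : ℕ) : face n (Fin.last (n + 1)) (Fin.last (n + 1)) = 0 := by
  apply Fin.ext
  rw [face_val, Fin.val_last]
  simp

end CircleChains

/-! ### Adams operations commute with the Hochschild boundary -/

namespace CircleChains

open Hochschild FormalOp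

variable (F : Type u) [Field F]

/-- The signed sum over all colorings of `n` elements with `k` colors of the permutations which
sort them. -/
noncomputable def adams (k n : ℕ) : Com F n n :=
  ∑ c : Fin n → Fin k, (Equiv.Perm.sign (Tuple.sort c) : ℤ) • ofPerm F (Tuple.sort c)

/-- A summand of `adams F k (n + 1) ≫ bdry F n`. -/
noncomputable def adamsBdry {k n : ℕ} (p : Fin (n + 2)) (c : Fin (n + 1) → Fin k) :
    Com F (n + 1) n :=
  ((-1) ^ (p + 1 : ℕ) * Equiv.Perm.sign (Tuple.sort c) : ℤ) •
    ComPROP.ofFun F fun t => face n p (pointedPerm (Tuple.sort c) t)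

/-- A summand of `bdry F n ≫ adams F k n`. -/
noncomputable def bdryAdams {k n : ℕ} (p : Fin (n + 2)) (d : Fin n → Fin k) :
    Com F (n + 1) n :=
  ((-1) ^ (p + 1 : ℕ) * Equiv.Perm.sign (Tuple.sort d) : ℤ) •
    ComPROP.ofFun F fun t => pointedPerm (Tuple.sort d) (face n p t)

theorem adams_comp_bdry_eq (k n : ℕ) :
    adams F k (n + 1) ≫ bdry F n = ∑ p, ∑ c : Fin (n + 1) → Fin k, adamsBdry F p c := by
  rw [bdry, Preadditive.comp_sum]
  refine Finset.sum_congr rfl fun p _ => ?_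
  rw [adams, Preadditive.sum_comp]
  refine Finset.sum_congr rfl fun c _ => ?_
  rw [Preadditive.comp_zsmul, Preadditive.zsmul_comp, smul_smul]
  exact congrArg _ (ComPROP.ofFun_comp F _ _)

theorem bdry_comp_adams_eq (k n : ℕ) :
    bdry F n ≫ adams F k n = ∑ p, ∑ d : Fin n → Fin k, bdryAdams F p d := by
  rw [bdry, Preadditive.sum_comp]
  refine Finset.sum_congr rfl fun p _ => ?_
  rw [adams, Preadditive.comp_sum]
  refine Finset.sum_congr rfl fun c _ => ?_
  rw [Preadditive.comp_zsmul, Preadditive.zsmul_comp, smul_smul, mul_comm]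
  exact congrArg _ (ComPROP.ofFun_comp F _ _)

variable {F}

theorem adamsBdry_cons_zero {k n : ℕ} (d : Fin n → Fin (k + 1)) :
    adamsBdry F 0 (Fin.cons 0 d : Fin (n + 1) → Fin (k + 1)) = bdryAdams F 0 d := by
  rw [adamsBdry, bdryAdams, sort_cons_zero, sign_insertPerm]
  congr 2
  · simp
  · funext t
    cases t using Fin.cases with
    | zero => rw [face_zero_right]; rfl
    | succ t =>
      rw [pointedPerm_succ, face_zero_succ, face_zero_succ]
      cases t using Fin.cases with
      | zero => exact insertPerm_self _ _ _
      | succ t => exact insertPerm_succAbove _ 0 0 t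

theorem adamsBdry_snoc_last {k n : ℕ} (d : Fin n → Fin (k + 1)) :
    adamsBdry F (Fin.last (n + 1)) (Fin.snoc d (Fin.last k) : Fin (n + 1) → Fin (k + 1)) =
      bdryAdams F (Fin.last (n + 1)) d := by
  rw [adamsBdry, bdryAdams, sort_snoc_last, sign_insertPerm]
  congr 2
  · simp [← two_mul]
  · funext t
    cases t using Fin.cases with
    | zero => rw [face_zero_right]; rfl
    | succ t =>
      rw [pointedPerm_succ]
      cases t using Fin.lastCases with
      | last => rw [insertPerm_self, Fin.succ_last, face_last_last]; rfl
      | cast t =>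
        rw [← Fin.succAbove_last_apply, insertPerm_succAbove, Fin.succAbove_last,
          Fin.succ_castSucc, Fin.succ_castSucc, face_last_castSucc, face_last_castSucc]
        rfl

/-- Rotating the elements matches the two outer faces. The rotation has sign `(-1)^n` and the faces
have signs `-1` and `(-1)^n`, so the terms cancel. -/
theorem adamsBdry_rotate {k n : ℕ} (d : Fin n → Fin (k + 1)) (j : Fin k) :
    adamsBdry F 0 (Fin.cons j.succ d : Fin (n + 1) → Fin (k + 1)) +
      adamsBdry F (Fin.last (n + 1)) (Fin.snoc d j.castSucc : Fin (n + 1) → Fin (k + 1)) = 0 := by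
  rw [adamsBdry, adamsBdry, sort_snoc_castSucc]
  generalize Tuple.sort (Fin.cons j.succ d : Fin (n + 1) → Fin (k + 1)) = τ
  have hf : (fun t => face n (Fin.last (n + 1))
      (pointedPerm ((finRotate (n + 1)).symm * τ) t)) = fun t => face n 0 (pointedPerm τ t) := by
    funext t
    cases t using Fin.cases with
    | zero => rw [pointedPerm_zero, pointedPerm_zero, face_zero_right, face_zero_right]
    | succ t =>
      rw [pointedPerm_succ, pointedPerm_succ, face_zero_succ, Equiv.Perm.mul_apply]
      cases τ t using Fin.cases with
      | zero => rw [finRotate_symm_zero, Fin.succ_last, face_last_last]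
      | succ t => rw [finRotate_symm_succ, Fin.succ_castSucc, face_last_castSucc]
  rw [hf, ← add_smul]
  convert zero_smul ℤ _
  have h : ((Equiv.Perm.sign (finRotate (n + 1)).symm : ℤˣ) : ℤ) = (-1) ^ n := by
    rw [Equiv.Perm.sign_symm, sign_finRotate]
    simp
  have h2 : ((-1 : ℤ) ^ n) * (-1) ^ n = 1 := by rw [← mul_pow]; simp
  rw [map_mul, Units.val_mul, h, Fin.val_last, Fin.val_zero, pow_add, pow_add, pow_one]
  linear_combination ((Equiv.Perm.sign τ : ℤˣ) : ℤ) * h2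

/-- The terms left over by the rotation have the removed element of least colour in first place or
of greatest colour in last place. Such an element stays at its end under sorting, so it can be
removed beforehand. -/
theorem sum_adamsBdry_outer (k n : ℕ) :
    ∑ c : Fin (n + 1) → Fin (k + 1), adamsBdry F 0 c +
      ∑ c : Fin (n + 1) → Fin (k + 1), adamsBdry F (Fin.last (n + 1)) c =
    ∑ d : Fin n → Fin (k + 1), bdryAdams F 0 d +
      ∑ d : Fin n → Fin (k + 1), bdryAdams F (Fin.last (n + 1)) d := by
  rw [← (Fin.consEquiv fun _ => Fin (k + 1)).sum_comp,
    ← (Fin.snocEquiv fun _ => Fin (k + 1)).sum_comp, Fintype.sum_prod_type, Fintype.sum_prod_type,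
    Fin.sum_univ_succ, Fin.sum_univ_castSucc]
  change ∑ d, adamsBdry F 0 (Fin.cons 0 d : Fin (n + 1) → Fin (k + 1)) +
    ∑ j : Fin k, ∑ d, adamsBdry F 0 (Fin.cons j.succ d : Fin (n + 1) → Fin (k + 1)) +
    (∑ j : Fin k, ∑ d, adamsBdry F (Fin.last (n + 1))
      (Fin.snoc d j.castSucc : Fin (n + 1) → Fin (k + 1)) +
      ∑ d, adamsBdry F (Fin.last (n + 1))
        (Fin.snoc d (Fin.last k) : Fin (n + 1) → Fin (k + 1))) = _
  have h : ∑ j : Fin k, ∑ d, adamsBdry F 0 (Fin.cons j.succ d : Fin (n + 1) → Fin (k + 1)) +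
    ∑ j : Fin k, ∑ d, adamsBdry F (Fin.last (n + 1))
      (Fin.snoc d j.castSucc : Fin (n + 1) → Fin (k + 1)) = 0 := by
    rw [← Finset.sum_add_distrib]
    refine Finset.sum_eq_zero fun j _ => ?_
    rw [← Finset.sum_add_distrib]
    exact Finset.sum_eq_zero fun d _ => adamsBdry_rotate d j
  simp only [adamsBdry_cons_zero, adamsBdry_snoc_last]
  rw [eq_neg_of_add_eq_zero_left h]
  abel

/-- The face merges `s` and `s + 1`, so exchanging them does not change the map but changes the
sign. -/
theorem adamsBdry_swap {k n : ℕ} (s : Fin n) (c : Fin (n + 1) → Fin k)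
    (h : c s.castSucc ≠ c s.succ) :
    adamsBdry F s.castSucc.succ c +
      adamsBdry F s.castSucc.succ (fun t => c (Equiv.swap s.castSucc s.succ t)) = 0 := by
  rw [adamsBdry, adamsBdry, sort_comp_swap c s h]
  have hf : (fun t => face n s.castSucc.succ
      (pointedPerm (Equiv.swap s.castSucc s.succ * Tuple.sort c) t)) =
        fun t => face n s.castSucc.succ (pointedPerm (Tuple.sort c) t) := by
    funext t
    cases t using Fin.cases with
    | zero => rfl
    | succ t =>
      rw [pointedPerm_succ, pointedPerm_succ, face_succ_castSucc, face_succ_castSucc,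
        Equiv.Perm.mul_apply, predAbove_swap]
  rw [hf, map_mul, Equiv.Perm.sign_swap (Fin.castSucc_lt_succ).ne, Units.val_mul]
  simp

/-- Equally coloured neighbours stay adjacent after sorting, so they may be merged before sorting
instead, at their rank `i`. -/
theorem adamsBdry_comp_predAbove {k n : ℕ} (i : Fin n) (d : Fin n → Fin k) :
    adamsBdry F (Tuple.sort d i).castSucc.succ (fun t => d ((Tuple.sort d i).predAbove t)) =
      bdryAdams F i.castSucc.succ d := by
  rw [adamsBdry, bdryAdams, sort_comp_predAbove, sign_insertPerm]
  refine congrArg₂ (fun (a : ℤ) x => a • ComPROP.ofFun F x) ?_ ?_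
  · simp only [Fin.val_succ, Fin.val_castSucc]
    have h2 : ((-1 : ℤ) ^ ((Tuple.sort d i : Fin n) : ℕ)) * (-1) ^ ((Tuple.sort d i : Fin n) : ℕ) = 1 := by
      rw [← mul_pow]; simp
    simp only [pow_add, pow_one]
    linear_combination (-1) ^ (i : ℕ) * ((Equiv.Perm.sign (Tuple.sort d) : ℤˣ) : ℤ) * h2
  · funext t
    cases t using Fin.cases with
    | zero => rw [face_zero_right, pointedPerm_zero, pointedPerm_zero, face_zero_right]
    | succ t =>
      rw [pointedPerm_succ, face_succ_castSucc, face_succ_castSucc, predAbove_insertPerm,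
        pointedPerm_succ]

theorem sum_adamsBdry_inner (k n : ℕ) :
    ∑ s : Fin n, ∑ c : Fin (n + 1) → Fin k, adamsBdry F s.castSucc.succ c =
    ∑ i : Fin n, ∑ d : Fin n → Fin k, bdryAdams F i.castSucc.succ d := by
  have h : ∀ s : Fin n, ∑ c : Fin (n + 1) → Fin k, adamsBdry F s.castSucc.succ c =
      ∑ d : Fin n → Fin k, adamsBdry F s.castSucc.succ fun t => d (s.predAbove t) := fun s => by
    rw [← Finset.sum_filter_add_sum_filter_not _ fun c => c s.castSucc = c s.succ]
    have h0 : ∑ c : Fin (n + 1) → Fin k with ¬ c s.castSucc = c s.succ,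
        adamsBdry F s.castSucc.succ c = 0 := by
      refine Finset.sum_involution (fun c _ t => c (Equiv.swap s.castSucc s.succ t))
        (fun c hc => adamsBdry_swap s c (Finset.mem_filter.1 hc).2) (fun c hc _ h => ?_)
        (fun c hc => ?_) (fun c hc => ?_)
      · have := congrFun h s.castSucc
        simp only [Equiv.swap_apply_left] at this
        exact (Finset.mem_filter.1 hc).2 this.symm
      · simpa [eq_comm] using (Finset.mem_filter.1 hc).2
      · simp
    rw [h0, add_zero]
    refine Finset.sum_bij' (fun c _ t => c (s.castSucc.succAbove t))
      (fun d _ t => d (s.predAbove t)) (fun c _ => Finset.mem_univ _) (fun d _ => ?_)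
      (fun c hc => ?_) (fun d _ => ?_) (fun c hc => ?_)
    · simp
    all_goals try
      funext t
      simp only [Fin.predAbove_succAbove]
    all_goals
      have : (fun t => c (s.castSucc.succAbove (s.predAbove t))) = c := by
        funext t
        obtain h | ⟨u, rfl⟩ := Fin.eq_self_or_eq_succAbove s.castSucc t
        · rw [h, Fin.predAbove_castSucc_self, Fin.succAbove_castSucc_self]
          exact (Finset.mem_filter.1 hc).2.symm
        · rw [Fin.predAbove_succAbove]
    · exact congrFun this _
    · rw [this]
  rw [Finset.sum_congr rfl fun s _ => h s, Finset.sum_comm, Finset.sum_comm (s := Finset.univ (α := Fin n))]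
  refine Finset.sum_congr rfl fun d _ => ?_
  -- Replaces the position of the doubled element by its rank in the sorted order.
  rw [← Equiv.sum_comp (Tuple.sort d)]
  exact Finset.sum_congr rfl fun i _ => adamsBdry_comp_predAbove i d

variable (F)

/-- Commutativity: the two products of two inputs agree and enter with opposite signs. -/
theorem bdry_zero : bdry F 0 = 0 := by
  rw [bdry, Fin.sum_univ_two]
  have : face 0 0 = face 0 1 := by
    funext t
    exact Subsingleton.elim (α := Fin 1) _ _
  rw [this]
  simp

theorem sum_univ_inner_add_outer {M : Type*} [AddCommMonoid M] {n : ℕ} (f : Fin (n + 2) → M) :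
    ∑ p, f p = ∑ s : Fin n, f s.castSucc.succ + (f 0 + f (Fin.last (n + 1))) := by
  rw [Fin.sum_univ_succ, Fin.sum_univ_castSucc, Fin.succ_last, add_left_comm]

theorem adams_comp_bdry (k n : ℕ) : adams F k (n + 1) ≫ bdry F n = bdry F n ≫ adams F k n := by
  obtain _ | k := k
  · obtain _ | n := n
    · rw [bdry_zero, Limits.comp_zero, Limits.zero_comp]
    · simp [adams]
  · rw [adams_comp_bdry_eq, bdry_comp_adams_eq, sum_univ_inner_add_outer,
      sum_univ_inner_add_outer, sum_adamsBdry_inner, sum_adamsBdry_outer]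

end CircleChains

/-! ### Shuffle operations commute with the Hochschild boundary -/

namespace CircleChains

open Hochschild FormalOp

theorem descents_succ {n : ℕ} (σ : Equiv.Perm (Fin (n + 1))) :
    descents σ = Finset.card {i : Fin n | σ i.succ < σ i.castSucc} := by
  refine Finset.card_bij' (fun i hi => ⟨i, by
      obtain ⟨h, -⟩ := (Finset.mem_filter.1 hi).2
      omega⟩) (fun i _ => i.castSucc) (fun i hi => ?_) (fun i hi => ?_) (fun i _ => rfl)
    (fun i _ => rfl)
  · obtain ⟨h, h'⟩ := (Finset.mem_filter.1 hi).2
    exact Finset.mem_filter.2 ⟨Finset.mem_univ _, h'⟩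
  · exact Finset.mem_filter.2 ⟨Finset.mem_univ _, by simp,
      (Finset.mem_filter.1 hi).2⟩

theorem descents_le {n : ℕ} (σ : Equiv.Perm (Fin (n + 1))) : descents σ ≤ n := by
  rw [descents_succ]
  exact (Finset.card_le_univ _).trans_eq (Fintype.card_fin n)

/-- The number of ascents before a given position. -/
def ascentsBefore {n : ℕ} (σ : Equiv.Perm (Fin (n + 1))) (i : Fin (n + 1)) : ℕ :=
  Finset.card {j : Fin n | (j : ℕ) < i ∧ ¬ σ j.succ < σ j.castSucc}

theorem ascentsBefore_succ {n : ℕ} (σ : Equiv.Perm (Fin (n + 1))) (i : Fin n) :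
    ascentsBefore σ i.succ =
      ascentsBefore σ i.castSucc + if σ i.succ < σ i.castSucc then 0 else 1 := by
  unfold ascentsBefore
  split_ifs with h
  · rw [add_zero]
    congr 1
    ext j
    simp only [Finset.mem_filter_univ, Fin.val_succ, Fin.val_castSucc]
    refine ⟨fun ⟨h1, h2⟩ => ⟨?_, h2⟩, fun ⟨h1, h2⟩ => ⟨by omega, h2⟩⟩
    refine lt_of_le_of_ne (by omega) fun h3 => h2 ?_
    obtain rfl : j = i := Fin.ext h3
    exact h
  · rw [← Finset.card_insert_of_notMem (a := i) (by simp)]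
    congr 1
    ext j
    simp only [Finset.mem_filter_univ, Finset.mem_insert, Fin.val_succ, Fin.val_castSucc]
    constructor
    · rintro ⟨h1, h2⟩
      by_cases hj : j = i
      · exact Or.inl hj
      · exact Or.inr ⟨lt_of_le_of_ne (by omega) fun h3 => hj (Fin.ext h3), h2⟩
    · rintro (rfl | ⟨h1, h2⟩)
      · exact ⟨by omega, h⟩
      · exact ⟨by omega, h2⟩

theorem ascentsBefore_le {n : ℕ} (σ : Equiv.Perm (Fin (n + 1))) (i : Fin (n + 1)) :
    ascentsBefore σ i ≤ i := by
  induction i using Fin.induction with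
  | zero => simp [ascentsBefore]
  | succ i ih =>
    rw [ascentsBefore_succ, Fin.val_succ]
    rw [Fin.val_castSucc] at ih
    split_ifs <;> omega

theorem ascentsBefore_last {n : ℕ} (σ : Equiv.Perm (Fin (n + 1))) :
    ascentsBefore σ (Fin.last n) + descents σ = n := by
  rw [descents_succ, ascentsBefore, add_comm]
  have := Finset.card_filter_add_card_filter_not (s := Finset.univ (α := Fin n))
    fun j => σ j.succ < σ j.castSucc
  rw [Finset.card_univ, Fintype.card_fin] at this
  simp only [Fin.val_last, Fin.is_lt, true_and]
  exact this

theorem ascentsBefore_mono {n : ℕ} (σ : Equiv.Perm (Fin (n + 1))) : Monotone (ascentsBefore σ) :=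
  fun i j hij => Finset.card_le_card fun t ht => by
    rw [Finset.mem_filter_univ] at ht ⊢
    exact ⟨lt_of_lt_of_le ht.1 hij, ht.2⟩

/-- Along the sorting permutation colours increase weakly, and strictly at a descent, where equal
colours would contradict stability. Consecutive ranks suffice because the lexicographic order is
transitive. -/
theorem sort_eq_iff {n k : ℕ} (c : Fin (n + 1) → Fin k) (σ : Equiv.Perm (Fin (n + 1))) :
    Tuple.sort c = σ ↔ ∀ i : Fin n, c (σ i.castSucc) ≤ c (σ i.succ) ∧
      (σ i.succ < σ i.castSucc → c (σ i.castSucc) < c (σ i.succ)) := by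
  constructor
  · rintro rfl i
    have := sort_spec c (Fin.castSucc_lt_succ (i := i))
    exact ⟨this.1, fun h => lt_of_le_of_ne this.1 fun h' => (this.2 h').not_gt h⟩
  · intro h
    have hm : StrictMono fun i => toLex (c (σ i), σ i) := by
      refine Fin.strictMono_iff_lt_succ.2 fun i => ?_
      rw [Prod.Lex.toLex_lt_toLex]
      rcases (h i).1.lt_or_eq with h1 | h1
      · exact Or.inl h1
      · refine Or.inr ⟨h1, lt_of_not_ge fun h2 => ?_⟩
        rcases h2.lt_or_eq with h3 | h3
        · exact ((h i).2 h3).ne h1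
        · exact (Fin.castSucc_lt_succ (i := i)).ne (σ.injective h3).symm
    refine sort_eq_of_forall fun t t' htt' => ?_
    have := hm htt'
    rw [Prod.Lex.toLex_lt_toLex] at this
    rcases this with h1 | h1
    · exact ⟨h1.le, fun h2 => absurd h2 h1.ne⟩
    · exact ⟨h1.1.le, fun _ => h1.2⟩

theorem ascentsBefore_le_apply {n : ℕ} (σ : Equiv.Perm (Fin (n + 1))) {v : Fin (n + 1) → ℕ}
    (hv : StrictMono v) (i : Fin (n + 1)) : ascentsBefore σ i ≤ v i := by
  refine (ascentsBefore_le σ i).trans ?_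
  induction i using Fin.induction with
  | zero => exact Nat.zero_le _
  | succ i ih => exact lt_of_le_of_lt ih (hv Fin.castSucc_lt_succ)

theorem monotone_sub_ascentsBefore {n : ℕ} (σ : Equiv.Perm (Fin (n + 1))) {v : Fin (n + 1) → ℕ}
    (hv : StrictMono v) : Monotone fun i => v i - ascentsBefore σ i := by
  refine Fin.monotone_iff_le_succ.2 fun i => ?_
  have h1 : v i.castSucc < v i.succ := hv Fin.castSucc_lt_succ
  have h2 := ascentsBefore_le_apply σ hv i.castSucc
  change v i.castSucc - ascentsBefore σ i.castSucc ≤ v i.succ - ascentsBefore σ i.succ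
  rw [ascentsBefore_succ]
  split_ifs <;> omega

/-- Adding one for every preceding ascent makes exactly the weak steps strict. Colourings with a
given sorting permutation can thereby be counted as subsets. -/
theorem strictMono_add_ascentsBefore {n k : ℕ} {c : Fin (n + 1) → Fin k}
    {σ : Equiv.Perm (Fin (n + 1))} (h : Tuple.sort c = σ) :
    StrictMono fun i => (c (σ i) : ℕ) + ascentsBefore σ i := by
  refine Fin.strictMono_iff_lt_succ.2 fun i => ?_
  have h' := (sort_eq_iff c σ).1 h i
  change (c (σ i.castSucc) : ℕ) + ascentsBefore σ i.castSucc <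
    (c (σ i.succ) : ℕ) + ascentsBefore σ i.succ
  rw [ascentsBefore_succ]
  split_ifs with h1
  · exact Nat.add_lt_add_right (Fin.lt_def.1 (h'.2 h1)) _
  · have := Fin.le_def.1 h'.1
    omega

/-- Colorings which are sorted by a given permutation correspond to strictly monotone maps. -/
def sortFiberEquiv {n : ℕ} (k : ℕ) (σ : Equiv.Perm (Fin (n + 1))) :
    {c : Fin (n + 1) → Fin k // Tuple.sort c = σ} ≃
      (Fin (n + 1) ↪o Fin (k + n - descents σ)) where
  toFun c := OrderEmbedding.ofStrictMono (fun i => ⟨c.1 (σ i) + ascentsBefore σ i, by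
      have h1 := ascentsBefore_last σ
      have h2 : ascentsBefore σ i ≤ _ := ascentsBefore_mono σ (Fin.le_last i)
      have := (c.1 (σ i)).isLt
      omega⟩) fun _ _ h => strictMono_add_ascentsBefore c.2 h
  invFun v := ⟨fun x => ⟨v (σ.symm x) - ascentsBefore σ (σ.symm x), by
      have h1 := ascentsBefore_last σ
      have hv : StrictMono fun i => (v i : ℕ) := fun _ _ h => v.strictMono h
      have h2 : (v (σ.symm x) : ℕ) - ascentsBefore σ (σ.symm x) ≤ v (Fin.last n) - _ :=
        monotone_sub_ascentsBefore σ hv (Fin.le_last (σ.symm x))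
      have h3 := (v (Fin.last n)).isLt
      have h4 := ascentsBefore_le_apply σ hv (Fin.last n)
      omega⟩, by
        have hv : StrictMono fun i => (v i : ℕ) := fun _ _ h => v.strictMono h
        refine (sort_eq_iff _ _).2 fun i => ?_
        simp only [Equiv.symm_apply_apply, Fin.lt_def (n := k), Fin.le_def (n := k)]
        refine ⟨monotone_sub_ascentsBefore σ hv (Fin.castSucc_lt_succ (i := i)).le, fun h => ?_⟩
        have h1 : (v i.castSucc : ℕ) < v i.succ := hv Fin.castSucc_lt_succ
        have h2 : _ ≤ (v i.castSucc : ℕ) := ascentsBefore_le_apply σ hv i.castSucc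
        rw [ascentsBefore_succ, if_pos h]
        omega⟩
  left_inv c := by
    ext x
    change (c.1 (σ (σ.symm x)) : ℕ) + ascentsBefore σ (σ.symm x) - _ = c.1 x
    rw [Nat.add_sub_cancel, Equiv.apply_symm_apply]
  right_inv v := by
    ext i
    have hv : StrictMono fun i => (v i : ℕ) := fun _ _ h => v.strictMono h
    have h2 : _ ≤ (v i : ℕ) := ascentsBefore_le_apply σ hv i
    simp only [OrderEmbedding.coe_ofStrictMono, Equiv.symm_apply_apply]
    exact Nat.sub_add_cancel h2

theorem card_sort_eq {n : ℕ} (k : ℕ) (σ : Equiv.Perm (Fin (n + 1))) :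
    Finset.card {c : Fin (n + 1) → Fin k | Tuple.sort c = σ} =
      (k + (n - descents σ)).choose (n + 1) := by
  rw [← Fintype.card_subtype, ← Nat.card_eq_fintype_card,
    Nat.card_congr ((sortFiberEquiv k σ).trans Set.powersetCard.ofFinEmbEquiv),
    Set.powersetCard.card, Nat.card_eq_fintype_card, Fintype.card_fin,
    Nat.add_sub_assoc (descents_le σ)]

variable (F : Type u) [Field F]

theorem adams_succ_eq (k n : ℕ) : adams F k (n + 1) = ∑ σ : Equiv.Perm (Fin (n + 1)),
    ((k + (n - descents σ)).choose (n + 1) * Equiv.Perm.sign σ : ℤ) • ofPerm F σ := by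
  rw [adams, ← Finset.sum_fiberwise' Finset.univ Tuple.sort
    fun σ => (Equiv.Perm.sign σ : ℤ) • ofPerm F σ]
  refine Finset.sum_congr rfl fun σ _ => ?_
  rw [Finset.sum_const, card_sort_eq, mul_smul, natCast_zsmul]

theorem sh_of_lt {k n : ℕ} (h : n < k) : sh F k n = 0 := by
  rw [sh, if_neg (by omega), if_neg (by omega)]

theorem sh_zero_zero : sh F 0 0 = 𝟙 _ := by
  rw [sh, if_pos ⟨rfl, rfl⟩]

/-- The binomial coefficient in its complementary form vanishes by itself for permutations with too
many descents and for `k = 0`, so the case distinctions in `sh` disappear. -/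
theorem sh_succ_eq {k n : ℕ} (h : k ≤ n + 1) : sh F k (n + 1) =
    ∑ σ : Equiv.Perm (Fin (n + 1)),
      ((n - descents σ).choose (n + 1 - k) * Equiv.Perm.sign σ : ℤ) • ofPerm F σ := by
  rw [sh, if_neg (by omega)]
  by_cases hk : 1 ≤ k
  · rw [if_pos ⟨hk, h⟩]
    simp only [loday, if_neg (Nat.succ_ne_zero n), Finset.sum_filter, Finset.smul_sum]
    rw [Finset.sum_comm]
    refine Finset.sum_congr rfl fun σ _ => ?_
    simp only [smul_ite, smul_zero]
    rw [Finset.sum_ite_eq, mul_smul]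
    have hd := descents_le σ
    split_ifs with h'
    · rw [Finset.mem_Icc] at h'
      congr 2
      rw [Nat.choose_symm_of_eq_add (b := n + 1 - k) (by omega), Nat.add_sub_add_right]
    · rw [Finset.mem_Icc] at h'
      rw [Nat.choose_eq_zero_of_lt (by omega), Nat.cast_zero, zero_smul]
  · rw [if_neg (by tauto), eq_comm]
    refine Finset.sum_eq_zero fun σ _ => ?_
    rw [Nat.choose_eq_zero_of_lt (by omega), Nat.cast_zero, zero_mul, zero_smul]

theorem ofPerm_one (n : ℕ) : ofPerm F (1 : Equiv.Perm (Fin n)) = 𝟙 _ := by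
  rw [id_eq_ofFun]
  refine congrArg _ (funext fun t => ?_)
  cases t using Fin.cases <;> rfl

/-- Comparing coefficients of a permutation, this is Vandermonde's identity for `binom(k + (n - d),
n + 1)`, where `d` is the number of descents. -/
theorem adams_eq_sum_sh (k n : ℕ) :
    adams F k n = ∑ j ∈ Finset.range (k + 1), (k.choose j : ℤ) • sh F j n := by
  have h : ∑ j ∈ Finset.range (k + 1), (k.choose j : ℤ) • sh F j n =
      ∑ j ∈ Finset.range (n + 1), (k.choose j : ℤ) • sh F j n := by
    rcases le_total k n with hkn | hkn
    · refine Finset.sum_subset (Finset.range_subset_range.2 (by omega)) fun j _ hj => ?_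
      rw [Finset.mem_range] at hj
      rw [Nat.choose_eq_zero_of_lt (by omega), Nat.cast_zero, zero_smul]
    · refine (Finset.sum_subset (Finset.range_subset_range.2 (by omega)) fun j _ hj => ?_).symm
      rw [Finset.mem_range] at hj
      rw [sh_of_lt F (by omega), smul_zero]
  rw [h]
  obtain _ | n := n
  · have h1 : Tuple.sort (default : Fin 0 → Fin k) = 1 := Subsingleton.elim _ _
    rw [adams, Fintype.sum_unique, h1, ofPerm_one]
    simp [sh_zero_zero]
  · have h' : ∀ j ∈ Finset.range (n + 1 + 1), (k.choose j : ℤ) • sh F j (n + 1) =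
        ∑ σ : Equiv.Perm (Fin (n + 1)), (k.choose j : ℤ) •
          ((n - descents σ).choose (n + 1 - j) * Equiv.Perm.sign σ : ℤ) • ofPerm F σ :=
      fun j hj => by
        rw [sh_succ_eq F (Nat.lt_succ_iff.1 (Finset.mem_range.1 hj)), Finset.smul_sum]
    rw [adams_succ_eq, Finset.sum_congr rfl h', Finset.sum_comm]
    refine Finset.sum_congr rfl fun σ _ => ?_
    simp only [smul_smul]
    rw [← Finset.sum_smul, Nat.add_choose_eq, Finset.Nat.sum_antidiagonal_eq_sum_range_succ_mk]
    push_cast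
    rw [Finset.sum_mul]
    congr 1
    exact Finset.sum_congr rfl fun j _ => by ring

/-- In the expansion of `adams` the operation `sh^k` has coefficient `1` and the others have smaller
index. Induction therefore needs no division and works in every characteristic. -/
theorem sh_comp_bdry (k n : ℕ) : sh F k (n + 1) ≫ bdry F n = bdry F n ≫ sh F k n := by
  induction k using Nat.strong_induction_on with
  | _ k ih =>
    have h := adams_comp_bdry F k n
    simp only [adams_eq_sum_sh, Finset.sum_range_succ _ k, Preadditive.add_comp,
      Preadditive.comp_add, Preadditive.sum_comp, Preadditive.comp_sum, Preadditive.zsmul_comp,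
      Preadditive.comp_zsmul, Nat.choose_self, Nat.cast_one, one_smul] at h
    rw [Finset.sum_congr rfl fun j hj => by rw [ih j (Finset.mem_range.1 hj)]] at h
    exact add_left_cancel h

variable {F}

theorem ofPerm_mem_pointedSpan {n : ℕ} (σ : Equiv.Perm (Fin n)) :
    ofPerm F σ ∈ pointedSpan F n n fun _ => True :=
  Submodule.subset_span ⟨_, rfl, trivial, rfl⟩

theorem sh_mem_pointedSpan (k n : ℕ) : sh F k n ∈ pointedSpan F n n fun _ => True := by
  rcases lt_or_ge n k with h | h
  · rw [sh_of_lt F h]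
    exact Submodule.zero_mem _
  · obtain _ | n := n
    · obtain rfl : k = 0 := by omega
      rw [sh_zero_zero, ← ofPerm_one]
      exact ofPerm_mem_pointedSpan _
    · rw [sh_succ_eq F h]
      exact Submodule.sum_mem _ fun σ _ => zsmul_mem (ofPerm_mem_pointedSpan σ) _

theorem lamZero_ofPerm {n : ℕ} (σ : Equiv.Perm (Fin n)) :
    lamZero n n (ofPerm F σ) = if σ = 1 then 1 else 0 := by
  rw [ofPerm, lamZero_ofFun]
  refine if_congr ⟨fun h => Equiv.ext fun t => Fin.ext ?_, fun h => ⟨rfl, fun t => ?_⟩⟩ rfl rfl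
  · have := h.2 t
    simpa using this
  · rw [h]
    rfl

/-- Only the identity permutation is seen, and its coefficient in the last shuffle operation is
`binom(n, 0) = 1`. -/
theorem lamZero_sh_self (n : ℕ) : lamZero n n (sh F n n) = 1 := by
  obtain _ | n := n
  · rw [sh_zero_zero, ← ofPerm_one, lamZero_ofPerm, if_pos rfl]
  · rw [sh_succ_eq F le_rfl, map_sum, Finset.sum_eq_single 1]
    · rw [map_zsmul, lamZero_ofPerm, if_pos rfl]
      simp
    · intro σ _ h
      rw [map_zsmul, lamZero_ofPerm, if_neg h, smul_zero]
    · simp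

end CircleChains

/-! ### Connes' operator anticommutes with the Hochschild boundary -/

namespace CircleChains

open Hochschild FormalOp

theorem rot_val (n i : ℕ) (t : Fin (n + 1)) : (rot n i t : ℕ) = (t + i) % (n + 1) + 1 := rfl

theorem rot_add_self (n i : ℕ) : rot n (i + (n + 1)) = rot n i := by
  funext t
  apply Fin.ext
  rw [rot_val, rot_val, ← add_assoc, Nat.add_mod_right]

variable (F : Type u) [Field F]

/-- A summand of Connes' operator. -/
noncomputable def connesTerm (n i : ℕ) : Com F n (n + 1) :=
  (-1 : ℤ) ^ (i * (n + 2)) • ComPROP.ofFun F (rot n i)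

theorem connesTerm_add_self (n i : ℕ) : connesTerm F n (i + (n + 1)) = connesTerm F n i := by
  have h : Even ((n + 1) * (n + 2)) := Nat.even_mul_succ_self (n + 1)
  rw [connesTerm, connesTerm, rot_add_self, add_mul, pow_add, h.neg_one_pow, mul_one]

/-- The terms have period `n + 1` in `i`, signs included because `(n + 1)(n + 2)` is even. So the
sum may start at `0`. -/
theorem connes_eq (n : ℕ) : connes F n = ∑ i : Fin (n + 1), connesTerm F n i := by
  change ∑ i ∈ Finset.Icc 1 (n + 1), connesTerm F n i = _
  rw [Fin.sum_univ_eq_sum_range (connesTerm F n), ← Finset.Ico_add_one_right_eq_Icc,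
    Finset.sum_Ico_eq_sum_range]
  simp only [add_comm 1]
  have h := (Finset.sum_range_succ' (connesTerm F n) (n + 1)).symm.trans
    (Finset.sum_range_succ _ _)
  have h0 := connesTerm_add_self F n 0
  rw [zero_add] at h0
  rw [h0] at h
  exact add_right_cancel h

/-- An inner face after a rotation by `i` merges what were the cyclic neighbours `s - i` and `s - i
+ 1`. Here no wrapping occurs; otherwise the position is taken modulo `n + 2` and the rotation loses
one step, as in `face_rot_of_lt`. -/
theorem face_rot_of_le {n i s : ℕ} (h : i ≤ s) (hs : s ≤ n) (t : Fin (n + 2)) :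
    face (n + 1) ⟨s + 1, by omega⟩ (rot (n + 1) i t) =
      rot n i (face n ⟨s - i, by omega⟩ t) := by
  apply Fin.ext
  have ht := t.isLt
  have e1 : ((t : ℕ) + i) % (n + 1 + 1) = if (t : ℕ) + i < n + 2 then t + i else t + i - (n + 2) := by
    split_ifs with h
    · exact Nat.mod_eq_of_lt h
    · rw [Nat.mod_eq_sub_mod (by omega), Nat.mod_eq_of_lt (by omega)]
  have e2 : ∀ a : ℕ, a ≤ n → (a + i) % (n + 1) = if a + i < n + 1 then a + i else a + i - (n + 1) :=
    fun a ha => by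
      split_ifs with h
      · exact Nat.mod_eq_of_lt h
      · rw [Nat.mod_eq_sub_mod (by omega), Nat.mod_eq_of_lt (by omega)]
  rw [face_val, rot_val, rot_val, e1, e2 _ (by have := (face n ⟨s - i, by omega⟩ t).isLt; omega),
    face_val]
  simp only
  split_ifs <;> omega

theorem face_rot_of_lt {n i s p : ℕ} (h : s ≤ i) (hi : i ≤ n) (hp : p + i = s + n + 1)
    (t : Fin (n + 2)) :
    face (n + 1) ⟨s + 1, by omega⟩ (rot (n + 1) (i + 1) t) =
      rot n i (face n ⟨p, by omega⟩ t) := by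
  apply Fin.ext
  have ht := t.isLt
  have e1 : ((t : ℕ) + (i + 1)) % (n + 1 + 1) =
      if (t : ℕ) + i + 1 < n + 2 then t + i + 1 else t + i + 1 - (n + 2) := by
    split_ifs with h
    · exact Nat.mod_eq_of_lt h
    · rw [Nat.mod_eq_sub_mod (by omega), Nat.mod_eq_of_lt (by omega)]
      omega
  have e2 : ∀ a : ℕ, a ≤ n → (a + i) % (n + 1) = if a + i < n + 1 then a + i else a + i - (n + 1) :=
    fun a ha => by
      split_ifs with h
      · exact Nat.mod_eq_of_lt h
      · rw [Nat.mod_eq_sub_mod (by omega), Nat.mod_eq_of_lt (by omega)]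
  rw [face_val, rot_val, rot_val, e1,
    e2 _ (by have := (face n ⟨p, by omega⟩ t).isLt; omega), face_val]
  simp only
  split_ifs <;> omega

/-- The slot `0` receives no input under `rot`, so merging it with its cyclic neighbour on either
side leaves a rotation; the two results differ by one step. -/
theorem face_last_rot (n i : ℕ) (t : Fin (n + 1)) :
    face n (Fin.last (n + 1)) (rot n i t) = face n 0 (rot n (i + 1) t) := by
  apply Fin.ext
  have h : ((t : ℕ) + (i + 1)) % (n + 1) =
      if (t + i) % (n + 1) = n then 0 else (t + i) % (n + 1) + 1 := by
    rw [← add_assoc]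
    have h0 : ((t : ℕ) + i) % (n + 1) < n + 1 := Nat.mod_lt _ n.succ_pos
    rw [Nat.add_mod]
    obtain _ | n := n
    · simp [Nat.mod_one]
    · rw [Nat.mod_eq_of_lt (show 1 < n + 1 + 1 by omega)]
      split_ifs with h1
      · rw [h1, Nat.mod_self]
      · exact Nat.mod_eq_of_lt (by omega)
  rw [face_val, face_val, rot_val, rot_val, h]
  have h0 : ((t : ℕ) + i) % (n + 1) < n + 1 := Nat.mod_lt _ n.succ_pos
  simp only [Fin.val_last, Fin.val_zero]
  split_ifs <;> omega

/-- The bijection between the terms of `connes F (n + 1) ≫ bdry F (n + 1)` for the inner faces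
and the terms of `bdry F n ≫ connes F n`. -/
def connesEquiv (n : ℕ) : Fin (n + 2) × Fin (n + 1) ≃ Fin (n + 1) × Fin (n + 2) where
  toFun x := if h : (x.1 : ℕ) ≤ x.2 then (⟨x.1, by omega⟩, ⟨x.2 - x.1, by omega⟩)
    else (⟨x.1 - 1, by omega⟩, ⟨x.2 + n + 2 - x.1, by omega⟩)
  invFun y := if h : (y.1 : ℕ) + y.2 ≤ n then (⟨y.1, by omega⟩, ⟨y.1 + y.2, by omega⟩)
    else (⟨y.1 + 1, by omega⟩, ⟨y.1 + y.2 - (n + 1), by omega⟩)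
  left_inv x := by
    obtain ⟨⟨i, hi⟩, ⟨s, hs⟩⟩ := x
    by_cases h : i ≤ s
    · simp only [h, dif_pos]
      rw [dif_pos (by omega)]
      simp only [Prod.mk.injEq, Fin.mk.injEq, true_and]
      omega
    · simp only [h, dif_neg, not_false_eq_true]
      rw [dif_neg (by omega)]
      simp only [Prod.mk.injEq, Fin.mk.injEq]
      omega
  right_inv y := by
    obtain ⟨⟨i, hi⟩, ⟨p, hp⟩⟩ := y
    by_cases h : i + p ≤ n
    · simp only [h, dif_pos]
      rw [dif_pos (by omega)]
      simp only [Prod.mk.injEq, Fin.mk.injEq, true_and]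
      omega
    · simp only [h, dif_neg, not_false_eq_true]
      rw [dif_neg (by omega)]
      simp only [Prod.mk.injEq, Fin.mk.injEq]
      omega

/-- A summand of `connesTerm F n i ≫ bdry F n`. -/
noncomputable def connesBdry (n i : ℕ) (p : Fin (n + 2)) : Com F n n :=
  ((-1) ^ (p + 1 : ℕ) * (-1) ^ (i * (n + 2)) : ℤ) • ComPROP.ofFun F fun t => face n p (rot n i t)

/-- A summand of `bdry F n ≫ connesTerm F n i`. -/
noncomputable def bdryConnes (n i : ℕ) (p : Fin (n + 2)) : Com F (n + 1) (n + 1) :=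
  ((-1) ^ (p + 1 : ℕ) * (-1) ^ (i * (n + 2)) : ℤ) • ComPROP.ofFun F fun t => rot n i (face n p t)

theorem connesTerm_comp_bdry (n i : ℕ) :
    connesTerm F n i ≫ bdry F n = ∑ p, connesBdry F n i p := by
  rw [bdry, Preadditive.comp_sum]
  refine Finset.sum_congr rfl fun p _ => ?_
  rw [connesTerm, Preadditive.comp_zsmul, Preadditive.zsmul_comp, smul_smul]
  exact congrArg _ (ComPROP.ofFun_comp F _ _)

theorem bdry_comp_connesTerm (n i : ℕ) :
    bdry F n ≫ connesTerm F n i = ∑ p, bdryConnes F n i p := by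
  rw [bdry, Preadditive.sum_comp]
  refine Finset.sum_congr rfl fun p _ => ?_
  rw [connesTerm, Preadditive.comp_zsmul, Preadditive.zsmul_comp, smul_smul, mul_comm]
  exact congrArg _ (ComPROP.ofFun_comp F _ _)

theorem connesBdry_last (n i : ℕ) :
    connesBdry F n i (Fin.last (n + 1)) = - connesBdry F n (i + 1) 0 := by
  rw [connesBdry, connesBdry, ← neg_smul]
  congr 1
  · rw [Fin.val_last, Fin.val_zero]
    ring
  · simp only [face_last_rot]

theorem connesBdry_add_self (n i : ℕ) (p : Fin (n + 2)) :
    connesBdry F n (i + (n + 1)) p = connesBdry F n i p := by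
  have h : Even ((n + 1) * (n + 2)) := Nat.even_mul_succ_self (n + 1)
  rw [connesBdry, connesBdry, rot_add_self, add_mul, pow_add _ (i * _), h.neg_one_pow, mul_one]

/-- The outer faces telescope, and by periodicity the first and last terms agree. -/
theorem sum_connesBdry_outer (n : ℕ) :
    ∑ i : Fin (n + 1), (connesBdry F n i 0 + connesBdry F n i (Fin.last (n + 1))) = 0 := by
  simp only [connesBdry_last, ← sub_eq_add_neg]
  rw [Fin.sum_univ_eq_sum_range (fun i => connesBdry F n i 0 - connesBdry F n (i + 1) 0),
    Finset.sum_range_sub', sub_eq_zero]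
  have := connesBdry_add_self F n 0 0
  rw [zero_add] at this
  exact this.symm

theorem connesBdry_inner (n : ℕ) (x : Fin (n + 2) × Fin (n + 1)) :
    connesBdry F (n + 1) x.1 x.2.castSucc.succ =
      - bdryConnes F n (connesEquiv n x).1 (connesEquiv n x).2 := by
  obtain ⟨⟨i, hi⟩, ⟨s, hs⟩⟩ := x
  rw [connesBdry, bdryConnes, ← neg_smul]
  by_cases h : i ≤ s
  · have he : connesEquiv n (⟨i, hi⟩, ⟨s, hs⟩) = (⟨i, by omega⟩, ⟨s - i, by omega⟩) := dif_pos h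
    rw [he]
    refine congrArg₂ (fun (a : ℤ) x => a • ComPROP.ofFun F x) ?_ ?_
    · obtain ⟨r, rfl⟩ := Nat.exists_eq_add_of_le h
      have h1 : ((-1 : ℤ) ^ i) * (-1) ^ i = 1 := by rw [← mul_pow]; simp
      simp only [Fin.val_succ, Fin.val_castSucc, Nat.add_sub_cancel_left]
      rw [show i * (n + 1 + 2) = i * (n + 2) + i by ring]
      generalize i * (n + 2) = e
      linear_combination ((-1) ^ r * (-1) ^ e) * h1
    · exact funext fun t => face_rot_of_le h (by omega) t
  · have he : connesEquiv n (⟨i, hi⟩, ⟨s, hs⟩) = (⟨i - 1, by omega⟩, ⟨s + n + 2 - i, by omega⟩) :=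
      dif_neg h
    rw [he]
    obtain ⟨i, rfl⟩ := Nat.exists_eq_add_of_le' (show 1 ≤ i by omega)
    refine congrArg₂ (fun (a : ℤ) x => a • ComPROP.ofFun F x) ?_ ?_
    · obtain ⟨r, rfl⟩ := Nat.exists_eq_add_of_le (show i ≤ n by omega)
      have h1 : ((-1 : ℤ) ^ i) * (-1) ^ i = 1 := by rw [← mul_pow]; simp
      simp only [Fin.val_succ, Fin.val_castSucc, Nat.add_sub_cancel]
      rw [show (i + 1) * (i + r + 1 + 2) = i * (i + r + 2) + i + i + r + 3 by ring,
        show s + (i + r) + 2 - (i + 1) + 1 = s + r + 2 by omega]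
      generalize i * (i + r + 2) = e
      linear_combination (-((-1) ^ s * (-1) ^ r * (-1) ^ e)) * h1
    · exact funext fun t => face_rot_of_lt (s := s) (i := i) (p := s + n + 2 - (i + 1))
        (by omega) (by omega) (by omega) t

theorem connes_comp_bdry (n : ℕ) :
    connes F (n + 1) ≫ bdry F (n + 1) + bdry F n ≫ connes F n = 0 := by
  simp only [connes_eq, Preadditive.sum_comp, Preadditive.comp_sum, connesTerm_comp_bdry,
    bdry_comp_connesTerm]
  simp only [sum_univ_inner_add_outer (connesBdry F (n + 1) _)]
  rw [Finset.sum_add_distrib, sum_connesBdry_outer, add_zero, ← Fintype.sum_prod_type',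
    ← Fintype.sum_prod_type', ← (connesEquiv n).sum_comp, ← Finset.sum_add_distrib]
  exact Finset.sum_eq_zero fun x _ => by rw [connesBdry_inner, neg_add_cancel]

end CircleChains

/-! ### The cycles `B^k` and their detection -/

namespace CircleChains

open Hochschild FormalOp

variable {F : Type u} [Field F]

theorem bsh_comp_bdry_zero (k : ℕ) : bsh F k 0 ≫ bdry F 0 = 0 := by
  rw [bdry_zero, Limits.comp_zero]

theorem bsh_comp_bdry (k n : ℕ) :
    bsh F k (n + 1) ≫ bdry F (n + 1) = - (bdry F n ≫ bsh F k n) := by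
  have h := eq_neg_of_add_eq_zero_left (connes_comp_bdry F n)
  have h2 : bsh F k (n + 1) ≫ bdry F (n + 1) =
    sh F k (n + 1) ≫ connes F (n + 1) ≫ bdry F (n + 1) := Category.assoc _ _ _
  rw [h2, h, Preadditive.comp_neg, ← Category.assoc, sh_comp_bdry, Category.assoc]
  rfl

/-- For pointed `g` the first entry after the rotation is `i + 1`, while `lamOne` demands `1`. Only
`i = 0` survives, where `rot` is the shift `t ↦ t + 1`. -/
theorem lamOne_ofFun_comp_rot {n : ℕ} {g : Fin (n + 1) → Fin (n + 1)} (hg : g 0 = 0)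
    (i : Fin (n + 1)) :
    lamOne n (n + 1) (ComPROP.ofFun F fun t => rot n i (g t)) =
      if i = 0 then lamZero n n (ComPROP.ofFun F g) else 0 := by
  rw [lamOne_ofFun, lamZero_ofFun, ← ite_and]
  refine if_congr ?_ rfl rfl
  simp only [rot_val, true_and, add_left_inj]
  constructor
  · intro h
    have h0 := h 0
    rw [hg, Fin.val_zero, zero_add, Nat.mod_eq_of_lt i.isLt] at h0
    refine ⟨Fin.ext h0, fun t => ?_⟩
    have := h t.succ
    rwa [h0, add_zero, Nat.mod_eq_of_lt (g _).isLt, Fin.val_succ] at this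
  · rintro ⟨rfl, h⟩ t
    rw [Fin.val_zero, add_zero, Nat.mod_eq_of_lt (g _).isLt]
    cases t using Fin.cases with
    | zero => rw [hg]
    | succ t => rw [h, Fin.val_succ]

theorem lamOne_comp_connes {n : ℕ} {x : Com F n n} (hx : x ∈ pointedSpan F n n fun _ => True) :
    lamOne n (n + 1) (x ≫ connes F n) = lamZero n n x := by
  induction hx using Submodule.span_induction with
  | mem x hx =>
    obtain ⟨g, hg, -, rfl⟩ := hx
    have h : ∀ i : Fin (n + 1), lamOne n (n + 1) (ComPROP.ofFun F g ≫ connesTerm F n i) =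
        if i = 0 then lamZero n n (ComPROP.ofFun F g) else 0 := fun i => by
      rw [connesTerm, Preadditive.comp_zsmul, map_zsmul, ComPROP.ofFun_comp,
        lamOne_ofFun_comp_rot hg]
      split_ifs with hi
      · rw [hi, Fin.val_zero, zero_mul, pow_zero, one_smul]
      · rw [smul_zero]
    rw [connes_eq, Preadditive.comp_sum, map_sum, Finset.sum_congr rfl fun i _ => h i,
      Finset.sum_ite_eq' , if_pos (Finset.mem_univ _)]
  | zero => rw [Limits.zero_comp, map_zero, map_zero]
  | add x y _ _ hx hy => rw [Preadditive.add_comp, map_add, map_add, hx, hy]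
  | smul c x _ hx => rw [Linear.smul_comp, map_smul, map_smul, hx]

theorem lamOne_bsh_self (n : ℕ) : lamOne n (n + 1) (bsh F n n) = 1 := by
  rw [bsh, lamOne_comp_connes (sh_mem_pointedSpan n n), lamZero_sh_self]

theorem bsh_of_lt {k n : ℕ} (h : n < k) : bsh F k n = 0 := by
  rw [bsh, sh_of_lt F h, Limits.zero_comp]

end CircleChains

/-! ### Cycles and boundaries in terms of components -/

namespace FormalOp

open Hochschild CircleChains

variable {F : Type u} [Field F]

/-- The components of a cycle of degree `l`. -/
def IsCyc (l : ℤ) (f : ∀ n m : ℕ, Com F n m) : Prop :=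
  ∀ n m : ℕ, (n : ℤ) + l = m + 1 → dHom l f n m = 0

/-- The components of a boundary of degree `l`. -/
def IsBdry (l : ℤ) (f : ∀ n m : ℕ, Com F n m) : Prop :=
  ∃ h : ∀ n m : ℕ, Com F n m, ∀ n m : ℕ, (n : ℤ) + l = m → dHom (l + 1) h n m = f n m

/-- The components of a normalized operation of degree `l`. -/
def IsNormal (l : ℤ) (f : ∀ n m : ℕ, Com F n m) : Prop :=
  ∀ n m : ℕ, (n : ℤ) + l = m → nproj F n ≫ f n m = f n m

/-- The components of the normalization of an operation. -/
noncomputable def normalize (f : ∀ n m : ℕ, Com F n m) (n m : ℕ) : Com F n m :=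
  nproj F n ≫ f n m

theorem isNormal_normalize (l : ℤ) (f : ∀ n m : ℕ, Com F n m) : IsNormal l (normalize f) :=
  fun n m _ => by rw [normalize, ← Category.assoc, nproj_idem]

theorem dHom_sub (l : ℤ) (f g : ∀ n m : ℕ, Com F n m) (n m : ℕ) :
    dHom l (f - g) n m = dHom l f n m - dHom l g n m := by
  simp only [dHom, Pi.sub_apply, Preadditive.sub_comp, Preadditive.comp_sub, smul_sub]
  abel

theorem IsBdry.sub {l : ℤ} {f g : ∀ n m : ℕ, Com F n m} (hf : IsBdry l f) (hg : IsBdry l g) :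
    IsBdry l (f - g) := by
  obtain ⟨h, hh⟩ := hf
  obtain ⟨k, hk⟩ := hg
  exact ⟨h - k, fun n m hm => by rw [dHom_sub, hh n m hm, hk n m hm]; rfl⟩

theorem IsBdry.congr {l : ℤ} {f g : ∀ n m : ℕ, Com F n m} (hf : IsBdry l f)
    (hfg : ∀ n m : ℕ, (n : ℤ) + l = m → f n m = g n m) : IsBdry l g := by
  obtain ⟨h, hh⟩ := hf
  exact ⟨h, fun n m hm => (hh n m hm).trans (hfg n m hm)⟩

theorem dCom_comp_nproj (n : ℕ) :
    dCom F n (n - 1) ≫ nproj F (n - 1) = nproj F n ≫ dCom F n (n - 1) := by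
  obtain _ | n := n
  · rw [dCom_of_ne (by omega), Limits.zero_comp, Limits.comp_zero]
  · rw [Nat.add_sub_cancel, dCom_succ, nproj_comp_bdry]

theorem dHom_normalize (l : ℤ) (f : ∀ n m : ℕ, Com F n m) (n m : ℕ) :
    dHom l (normalize f) n m = nproj F n ≫ dHom l f n m := by
  rw [dHom, dHom, normalize, normalize, Preadditive.comp_sub, Preadditive.comp_zsmul,
    Category.assoc, ← Category.assoc (dCom F n (n - 1)), dCom_comp_nproj, Category.assoc]

/-- Precomposing a cycle with the homotopy from the Dold-Kan projection to the identity gives the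
filling. The cycle condition moves the vertical boundary past `f` at the cost of the sign `(-1)^l`.
-/
theorem IsCyc.sub_normalize {l : ℤ} {f : ∀ n m : ℕ, Com F n m} (hf : IsCyc l f) :
    IsBdry l (f - normalize f) := by
  refine ⟨fun n m => (l.negOnePow : ℤ) • (nprojHtpy F n ≫ f (n + 1) m), fun n m hm => ?_⟩
  have hs : ((l.negOnePow : ℤ) * l.negOnePow) = 1 := by
    rw [← Units.val_mul, Int.units_mul_self, Units.val_one]
  have h1 := hf (n + 1) m (by push_cast; omega)
  rw [dHom, Nat.add_sub_cancel, dCom_succ, dCom_succ, sub_eq_zero] at h1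
  rw [dHom, dCom_succ, Preadditive.zsmul_comp, Category.assoc, h1, Preadditive.comp_zsmul,
    smul_smul, hs, one_smul, Int.negOnePow_succ, Units.val_neg, neg_smul, sub_neg_eq_add,
    Preadditive.comp_zsmul, smul_smul, hs, one_smul]
  change _ = f n m - nproj F n ≫ f n m
  obtain _ | n := n
  · rw [dCom_of_ne (by omega), Limits.zero_comp, add_zero, nproj_zero_eq, Preadditive.sub_comp,
      Category.id_comp, Category.assoc, sub_sub_cancel]
  · rw [Nat.add_sub_cancel, dCom_succ, nproj_succ_eq, Preadditive.sub_comp,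
      Category.id_comp, sub_sub_cancel, Preadditive.add_comp, Category.assoc, Category.assoc]
    exact add_comm _ _

/-- A sequence of cycles of degree `l` whose `k`-th member begins in `Com(k + 1, -)` with a
generator of the normalized vertical homology. -/
structure Generates (l : ℤ) (g : ℕ → ∀ n m : ℕ, Com F n m) : Prop where
  isCyc : ∀ k, IsCyc l (g k)
  eq_zero : ∀ k n m : ℕ, n < k → (n : ℤ) + l = m → g k n m = 0
  exists_eq : ∀ (k m : ℕ) (z : Com F k m), (k : ℤ) + l = m → nproj F k ≫ z = z →
    z ≫ dCom F m (m - 1) = 0 → ∃ (c : F) (w : Com F k (m + 1)), nproj F k ≫ w = w ∧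
      w ≫ bdry F m = z - c • (nproj F k ≫ g k k m)

/-- As `P n` depends only on the entries up to `n`, choosing later entries never spoils it. The
stages therefore stabilize in each entry, and the diagonal sequence satisfies all conditions. -/
theorem exists_forall_of_exists_update {α : ℕ → Type*} [∀ n, Inhabited (α n)]
    (P : ℕ → (∀ n, α n) → Prop)
    (hP : ∀ n x y, (∀ k ≤ n, x k = y k) → P n x → P n y)
    (step : ∀ n x, (∀ k < n, P k x) → ∃ y, P n (Function.update x n y)) :
    ∃ x, ∀ n, P n x := by
  classical
  choose! s hs using step
  let x : ℕ → ∀ n, α n := fun N => Nat.rec (fun _ => default)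
    (fun N x => Function.update x N (s N x)) N
  have hx : ∀ N, x (N + 1) = Function.update (x N) N (s N (x N)) := fun N => rfl
  have hlt : ∀ N k n, n < N → x (N + k) n = x N n := fun N k n hn => by
    induction k with
    | zero => rfl
    | succ k ih =>
      rw [← add_assoc, hx, Function.update_of_ne (by omega), ih]
  have hagree : ∀ N n, n < N → x N n = x (n + 1) n := fun N n hn => by
    obtain ⟨k, rfl⟩ := Nat.exists_eq_add_of_le (show n + 1 ≤ N by omega)
    exact hlt _ _ _ (Nat.lt_succ_self n)
  have hall : ∀ N, ∀ k < N, P k (x N) := fun N => by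
    induction N with
    | zero => intro k hk; omega
    | succ N ih =>
      intro k hk
      rcases Nat.lt_succ_iff_lt_or_eq.1 hk with h | rfl
      · refine hP k (x N) _ (fun j hj => ?_) (ih k h)
        rw [hx, Function.update_of_ne (by omega)]
      · rw [hx]
        exact hs k (x k) ih
  refine ⟨fun n => x (n + 1) n, fun n => hP n (x (n + 1)) _ (fun k hk => ?_)
    (hall (n + 1) n (Nat.lt_succ_self n))⟩
  exact hagree (n + 1) k (by omega)

end FormalOp

/-! ### Solving the boundary equation column by column -/

namespace FormalOp

open Hochschild CircleChains

variable {F : Type u} [Field F]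

/-- The partial sums of the series of operations `∑ c_k g_k`, which are locally finite. -/
noncomputable def combination (g : ℕ → ∀ n m : ℕ, Com F n m) (c : ℕ → F) (n m : ℕ) : Com F n m :=
  ∑ k ∈ Finset.range (n + 1), c k • g k n m

theorem normalize_combination (g : ℕ → ∀ n m : ℕ, Com F n m) (c : ℕ → F) (n m : ℕ) :
    normalize (combination g c) n m =
      ∑ k ∈ Finset.range (n + 1), c k • (nproj F n ≫ g k n m) := by
  simp only [normalize, combination, Preadditive.comp_sum, Linear.comp_smul]

theorem dCom_comp_dCom (n : ℕ) : dCom F n (n - 1) ≫ dCom F (n - 1) (n - 1 - 1) = 0 := by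
  obtain _ | _ | n := n
  · rw [dCom_of_ne (by omega), Limits.zero_comp]
  · rw [dCom_of_ne (n := 0 + 1 - 1) (by omega), Limits.comp_zero]
  · change dCom F (n + 1 + 1) (n + 1) ≫ dCom F (n + 1) n = 0
    rw [dCom_succ, dCom_succ, bdry_bdry]

theorem dHom_dHom (l : ℤ) (f : ∀ n m : ℕ, Com F n m) (n m : ℕ) :
    dHom l (dHom (l + 1) f) n m = 0 := by
  have h1 : (f n (m + 1 + 1) ≫ bdry F (m + 1)) ≫ bdry F m = 0 := by
    rw [Category.assoc, bdry_bdry, Limits.comp_zero]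
  have h2 : dCom F n (n - 1) ≫ dCom F (n - 1) (n - 1 - 1) ≫ f (n - 1 - 1) m = 0 := by
    rw [← Category.assoc, dCom_comp_dCom, Limits.zero_comp]
  simp only [dHom, dCom_succ, Int.negOnePow_succ, Units.val_neg, neg_smul, sub_neg_eq_add,
    Preadditive.add_comp, Preadditive.comp_add, h1, zero_add]
  rw [Preadditive.zsmul_comp, Preadditive.comp_zsmul, h2, smul_zero, add_zero, Category.assoc,
    sub_self]

theorem dHom_smul (l : ℤ) (c : F) (f : ∀ n m : ℕ, Com F n m) (n m : ℕ) :
    dHom l (c • f) n m = c • dHom l f n m := by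
  simp only [dHom, Pi.smul_apply, Linear.smul_comp, Linear.comp_smul, smul_sub]
  rw [smul_comm c]

theorem dHom_sum {ι : Type*} (s : Finset ι) (l : ℤ) (f : ι → ∀ n m : ℕ, Com F n m) (n m : ℕ) :
    dHom l (∑ i ∈ s, f i) n m = ∑ i ∈ s, dHom l (f i) n m := by
  simp only [dHom, Finset.sum_apply, Preadditive.sum_comp, Preadditive.comp_sum,
    Finset.smul_sum, Finset.sum_sub_distrib]

theorem dHom_congr {l : ℤ} {f g : ∀ n m : ℕ, Com F n m} {n m : ℕ}
    (h1 : f n (m + 1) = g n (m + 1)) (h2 : dCom F n (n - 1) ≫ f (n - 1) m =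
      dCom F n (n - 1) ≫ g (n - 1) m) : dHom l f n m = dHom l g n m := by
  rw [dHom, dHom, h1, h2]

namespace Generates

variable {l : ℤ} {g : ℕ → ∀ n m : ℕ, Com F n m}

theorem combination_eq (hg : Generates l g) (c : ℕ → F) {n m N : ℕ} (hm : (n : ℤ) + l = m)
    (hN : n ≤ N) : combination g c n m = ∑ k ∈ Finset.range (N + 1), c k • g k n m := by
  refine Finset.sum_subset (Finset.range_subset_range.2 (by omega)) fun k _ hk => ?_
  rw [Finset.mem_range] at hk
  rw [hg.eq_zero k n m (by omega) hm, smul_zero]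

/-- The differential at a given position reads only two adjacent columns, where the infinite sum
agrees with one finite sum. -/
theorem isCyc_combination (hg : Generates l g) (c : ℕ → F) : IsCyc l (combination g c) := by
  intro n m hm
  have h : dHom l (combination g c) n m =
      dHom l (∑ k ∈ Finset.range (n + 1), c k • g k) n m := by
    refine dHom_congr ?_ ?_
    · rw [hg.combination_eq c (by push_cast; omega) le_rfl]
      simp only [Finset.sum_apply, Pi.smul_apply]
    · obtain _ | n := n
      · rw [dCom_of_ne (by omega), Limits.zero_comp, Limits.zero_comp]
      · rw [Nat.add_sub_cancel, hg.combination_eq c (N := n + 1) (by push_cast at hm; omega)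
          (Nat.le_succ n)]
        simp only [Finset.sum_apply, Pi.smul_apply]
  rw [h, dHom_sum]
  exact Finset.sum_eq_zero fun k _ => by rw [dHom_smul, hg.isCyc k n m hm, smul_zero]

/-- One step of the recursion. The error left by the earlier columns is a normalized vertical cycle
in column `n`, so the generator property supplies the coefficient `c_n` and the new entry of the
filling. The predicate `p` allows `f` to be a cycle only on an initial range of columns. -/
theorem exists_update (hg : Generates l g) (p : ℕ → Prop) (hp : ∀ n, p (n + 1) → p n)
    (f : ∀ n m : ℕ, Com F n m) (hn : IsNormal l f)
    (hf : ∀ n m : ℕ, p n → (n : ℤ) + l = m + 1 → dHom l f n m = 0)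
    (x : ∀ n, F × ∀ m, Com F n m) (n m : ℕ) (hm : (n : ℤ) + l = m) (hpn : p n)
    (hx : ∀ k < n, (∀ m : ℕ, (k : ℤ) + (l + 1) = m → nproj F k ≫ (x k).2 m = (x k).2 m) ∧
      ∀ m : ℕ, p k → (k : ℤ) + l = m → dHom (l + 1) (fun n m => (x n).2 m) k m =
        f k m - normalize (combination g fun n => (x n).1) k m) :
    ∃ y, (∀ m : ℕ, (n : ℤ) + (l + 1) = m →
        nproj F n ≫ (Function.update x n y n).2 m = (Function.update x n y n).2 m) ∧
      ∀ m : ℕ, p n → (n : ℤ) + l = m →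
        dHom (l + 1) (fun k m => (Function.update x n y k).2 m) n m =
          f n m - normalize (combination g fun k => (Function.update x n y k).1) n m := by
  -- The entries in column `n` are reset to zero, so that the error `E` involves only the earlier
  -- choices.
  let h' : ∀ n m : ℕ, Com F n m := fun k m => (Function.update x n 0 k).2 m
  let c' : ℕ → F := fun k => (Function.update x n 0 k).1
  let E := f - normalize (combination g c') - dHom (l + 1) h'
  have hh' : ∀ k m, k < n → h' k m = (x k).2 m := fun k m hk => by
    simp only [h', Function.update_of_ne hk.ne]
  have hc' : ∀ k, k < n → c' k = (x k).1 := fun k hk => by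
    simp only [c', Function.update_of_ne hk.ne]
  have hn0 : ∀ m, h' n m = 0 := fun m => by
    simp only [h', Function.update_self]
    rfl
  -- `E` is a cycle at this position and vanishes in column `n - 1` by the induction hypothesis, so
  -- its vertical boundary in column `n` vanishes.
  have hE : ∀ m' : ℕ, (n : ℤ) + l = m' + 1 → E n (m' + 1) ≫ bdry F m' = 0 := fun m' hm' => by
    have h1 : dHom l E n m' = 0 := by
      rw [dHom_sub, dHom_sub, hf n m' hpn hm', dHom_normalize, hg.isCyc_combination c' n m' hm',
        dHom_dHom, Limits.comp_zero, sub_zero, sub_zero]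
    have h2 : dCom F n (n - 1) ≫ E (n - 1) m' = 0 := by
      obtain _ | n := n
      · rw [dCom_of_ne (by omega), Limits.zero_comp]
      · rw [Nat.add_sub_cancel]
        have h3 := (hx n (Nat.lt_succ_self n)).2 m' (hp n hpn) (by push_cast at hm'; omega)
        have h4 : dHom (l + 1) h' n m' = dHom (l + 1) (fun n m => (x n).2 m) n m' :=
          dHom_congr (hh' _ _ (Nat.lt_succ_self n)) (by rw [hh' _ _ (by omega)])
        have h5 : combination g c' n m' = combination g (fun n => (x n).1) n m' :=
          Finset.sum_congr rfl fun k hk => by rw [hc' k (Finset.mem_range.1 hk)]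
        have h6 : E n m' = 0 := by
          change f n m' - normalize (combination g c') n m' - dHom (l + 1) h' n m' = 0
          rw [h4, h3, normalize, normalize, h5, sub_self]
        rw [h6, Limits.comp_zero]
    rwa [dHom, h2, smul_zero, sub_zero, dCom_succ] at h1
  have hdH : dHom (l + 1) h' n m = - (((l + 1).negOnePow : ℤ) • (dCom F n (n - 1) ≫ h' (n - 1) m)) := by
    rw [dHom, hn0, Limits.zero_comp, zero_sub]
  have hEn : nproj F n ≫ E n m = E n m := by
    change nproj F n ≫ (f n m - normalize (combination g c') n m - dHom (l + 1) h' n m) =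
      f n m - normalize (combination g c') n m - dHom (l + 1) h' n m
    rw [Preadditive.comp_sub, Preadditive.comp_sub, hn n m hm, isNormal_normalize l _ n m hm, hdH,
      Preadditive.comp_neg, Preadditive.comp_zsmul, ← Category.assoc, ← dCom_comp_nproj,
      Category.assoc]
    obtain _ | n := n
    · rw [dCom_of_ne (by omega), Limits.zero_comp, Limits.zero_comp]
    · rw [Nat.add_sub_cancel, hh' n m (Nat.lt_succ_self n),
        (hx n (Nat.lt_succ_self n)).1 m (by push_cast at hm; omega)]
  obtain ⟨c, w, hw, hwb⟩ := hg.exists_eq n m (E n m) hm hEn (by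
    obtain _ | m := m
    · rw [dCom_of_ne (by omega), Limits.comp_zero]
    · rw [Nat.add_sub_cancel, dCom_succ]
      exact hE m (by push_cast at hm; omega))
  refine ⟨(c, Function.update 0 (m + 1) w), fun m' hm' => ?_, fun m' _ hm' => ?_⟩
  · obtain rfl : m' = m + 1 := by omega
    rw [Function.update_self]
    simp only [Function.update_self]
    exact hw
  · obtain rfl : m' = m := by omega
    have h1 : dHom (l + 1) (fun k m => (Function.update x n (c, Function.update 0 (m' + 1) w) k).2 m)
        n m' = w ≫ bdry F m' + dHom (l + 1) h' n m' := by
      have hu : (Function.update (0 : ∀ m, Com F n m) (m' + 1) w) (m' + 1) = w :=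
        Function.update_self ..
      rw [hdH, dHom, Function.update_self, dCom_succ, sub_eq_add_neg]
      change (Function.update (0 : ∀ m, Com F n m) (m' + 1) w) (m' + 1) ≫ _ + _ = _
      rw [hu]
      obtain _ | n := n
      · rw [dCom_of_ne (by omega), Limits.zero_comp, Limits.zero_comp]
      · rw [Nat.add_sub_cancel, hh' n m' (Nat.lt_succ_self n),
          Function.update_of_ne (Nat.lt_succ_self n).ne]
    have h2 : normalize (combination g fun k =>
        (Function.update x n (c, Function.update 0 (m' + 1) w) k).1) n m' =
        normalize (combination g c') n m' + c • (nproj F n ≫ g n n m') := by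
      rw [normalize_combination, normalize_combination, Finset.sum_range_succ,
        Finset.sum_range_succ, Function.update_self]
      have h3 : c' n = 0 := by
        simp only [c', Function.update_self]
        rfl
      rw [h3, zero_smul, add_zero]
      congr 1
      refine Finset.sum_congr rfl fun k hk => ?_
      rw [hc' k (Finset.mem_range.1 hk), Function.update_of_ne (Finset.mem_range.1 hk).ne]
    rw [h1, h2, hwb]
    change f n m' - normalize (combination g c') n m' - dHom (l + 1) h' n m' - _ + _ = _
    abel

/-- A normalized cycle is, as far as it is a cycle, a combination of the generators up to a
boundary. -/
theorem exists_dHom_eq (hg : Generates l g) (p : ℕ → Prop) (hp : ∀ n, p (n + 1) → p n)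
    (f : ∀ n m : ℕ, Com F n m) (hn : IsNormal l f)
    (hf : ∀ n m : ℕ, p n → (n : ℤ) + l = m + 1 → dHom l f n m = 0) :
    ∃ (c : ℕ → F) (h : ∀ n m : ℕ, Com F n m), IsNormal (l + 1) h ∧
      ∀ n m : ℕ, p n → (n : ℤ) + l = m →
        dHom (l + 1) h n m = f n m - normalize (combination g c) n m := by
  have : ∀ n : ℕ, Inhabited (F × ∀ m, Com F n m) := fun n => ⟨0⟩
  suffices ∃ x : ∀ n : ℕ, F × ∀ m, Com F n m, ∀ n : ℕ,
      ((∀ m : ℕ, (n : ℤ) + (l + 1) = m → nproj F n ≫ (x n).2 m = (x n).2 m) ∧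
      ∀ m : ℕ, p n → (n : ℤ) + l = m → dHom (l + 1) (fun n m => (x n).2 m) n m =
        f n m - normalize (combination g fun n => (x n).1) n m) by
    obtain ⟨x, hx⟩ := this
    exact ⟨fun n => (x n).1, fun n m => (x n).2 m, fun n => (hx n).1, fun n => (hx n).2⟩
  refine exists_forall_of_exists_update _ ?_ ?_
  · rintro n x y hxy ⟨h1, h2⟩
    rw [← hxy n le_rfl]
    refine ⟨h1, fun m hpn hm => ?_⟩
    have e1 : dHom (l + 1) (fun n m => (y n).2 m) n m =
        dHom (l + 1) (fun n m => (x n).2 m) n m :=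
      dHom_congr (by simp only [hxy n le_rfl]) (by simp only [hxy (n - 1) (Nat.sub_le n 1)])
    have e2 : combination g (fun n => (y n).1) n m = combination g (fun n => (x n).1) n m :=
      Finset.sum_congr rfl fun k hk => by
        simp only [hxy k (Nat.lt_succ_iff.1 (Finset.mem_range.1 hk))]
    rw [e1, h2 m hpn hm, normalize, normalize, e2]
  · intro n x hx
    by_cases hm : ∃ m : ℕ, (n : ℤ) + l = m ∧ p n
    · obtain ⟨m, hm, hpn⟩ := hm
      exact hg.exists_update p hp f hn hf x n m hm hpn hx
    -- There is no equation to satisfy in this column.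
    · refine ⟨0, fun m _ => ?_, fun m hpn hm' => absurd ⟨m, hm', hpn⟩ hm⟩
      rw [Function.update_self]
      exact Limits.comp_zero

/-- Every cycle is homologous to a combination of the generators. -/
theorem exists_isBdry_sub (hg : Generates l g) {f : ∀ n m : ℕ, Com F n m} (hf : IsCyc l f) :
    ∃ c : ℕ → F, IsBdry l (f - combination g c) := by
  obtain ⟨c, h, -, hh⟩ := hg.exists_dHom_eq (fun _ => True) (fun _ _ => trivial) (normalize f)
    (isNormal_normalize l f) (fun n m _ hm => by
      rw [dHom_normalize, hf n m hm, Limits.comp_zero])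
  refine ⟨c, ?_⟩
  have h1 : IsBdry l (normalize f - normalize (combination g c)) :=
    ⟨h, fun n m hm => hh n m trivial hm⟩
  have h2 := (hg.isCyc_combination c).sub_normalize
  -- `(h1 - h1) - h1` stands for minus `h1`: the term `h1` is added using differences of boundaries
  -- only.
  have h3 := (hf.sub_normalize.sub h2).sub ((h1.sub h1).sub h1)
  convert h3 using 1
  abel

/-- The generators are linearly independent in homology if they are detected by functionals which
vanish on boundaries. -/
theorem eq_zero_of_isBdry {g' : ℕ → ∀ n m : ℕ, Com F n m}
    (hg' : Generates (l + 1) g') (lam : ∀ n m : ℕ, Com F n m →ₗ[F] F)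
    (hlam : ∀ (n m : ℕ) (x : Com F n (m + 1)), lam n m (x ≫ bdry F m) = 0)
    (hone : ∀ k m : ℕ, (k : ℤ) + l = m → lam k m (nproj F k ≫ g k k m) = 1)
    (hl : 0 ≤ l) {c : ℕ → F} (hc : IsBdry l (combination g c)) : c = 0 := by
  obtain ⟨h, hh⟩ := hc
  have hh' : ∀ n m : ℕ, (n : ℤ) + l = m →
      dHom (l + 1) (normalize h) n m = normalize (combination g c) n m := fun n m hm => by
    rw [dHom_normalize, hh n m hm]
    rfl
  funext k
  induction k using Nat.strong_induction_on with
  | _ k ih =>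
    obtain ⟨m, hm⟩ : ∃ m : ℕ, (k : ℤ) + l = m := ⟨(k + l).toNat, by omega⟩
    have h1 : normalize (combination g c) k m = c k • (nproj F k ≫ g k k m) := by
      rw [normalize_combination, Finset.sum_range_succ, Finset.sum_eq_zero, zero_add]
      intro j hj
      rw [ih j (Finset.mem_range.1 hj), Pi.zero_apply, zero_smul]
    -- The horizontal contribution of column `k - 1` is a vertical boundary, so the functional does
    -- not see it.
    have h2 : lam k m (dCom F k (k - 1) ≫ normalize h (k - 1) m) = 0 := by
      obtain _ | k := k
      · rw [dCom_of_ne (by omega), Limits.zero_comp, map_zero]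
      · rw [Nat.add_sub_cancel, dCom_succ]
        -- The earlier coefficients vanish, so the filling is itself a cycle in these columns, and
        -- up to a boundary a combination of the generators of degree `l + 1`.
        obtain ⟨c', w, -, hw⟩ := hg'.exists_dHom_eq (fun n => n < k + 1) (fun n hn => by omega)
          (normalize h) (isNormal_normalize _ h) (fun n m hn hm => by
            rw [hh' n m (by omega), normalize_combination]
            refine Finset.sum_eq_zero fun j hj => ?_
            rw [ih j (by have := Finset.mem_range.1 hj; omega), Pi.zero_apply, zero_smul])
        have h3 := hw k m (Nat.lt_succ_self k) (by push_cast at hm; omega)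
        have h4 := (hg'.isCyc_combination c') (k + 1) m (by push_cast at hm ⊢; omega)
        rw [dHom, sub_eq_zero, dCom_succ, Nat.add_sub_cancel, dCom_succ] at h4
        rw [dHom, dCom_succ] at h3
        -- These generators are cycles in all columns, so their horizontal image is the vertical
        -- boundary of their next column.
        have h5 : bdry F k ≫ combination g' c' k m = (((l + 1).negOnePow : ℤ) •
            combination g' c' (k + 1) (m + 1)) ≫ bdry F m := by
          rw [Preadditive.zsmul_comp, h4, smul_smul, ← Units.val_mul, Int.units_mul_self,
            Units.val_one, one_smul]
        have h6 : bdry F k ≫ normalize (combination g' c') k m = (nproj F (k + 1) ≫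
            (((l + 1).negOnePow : ℤ) • combination g' c' (k + 1) (m + 1))) ≫ bdry F m := by
          rw [normalize, ← Category.assoc, ← nproj_comp_bdry, Category.assoc, Category.assoc, h5]
        have h7 : bdry F k ≫ dCom F k (k - 1) = 0 := by
          have := dCom_comp_dCom (F := F) (k + 1)
          rwa [Nat.add_sub_cancel, dCom_succ] at this
        rw [← sub_add_cancel (normalize h k m) (normalize (combination g' c') k m), ← h3,
          Preadditive.comp_add, h6, map_add, hlam, add_zero, Preadditive.comp_sub, map_sub,
          ← Category.assoc, hlam, Preadditive.comp_zsmul, ← Category.assoc (bdry F k), h7,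
          Limits.zero_comp, smul_zero, map_zero, sub_zero]
    have h8 := congrArg (lam k m) (hh' k m hm)
    rw [h1, dHom, dCom_succ, map_sub, hlam, map_zsmul, h2, smul_zero, sub_zero, map_smul,
      hone k m hm, smul_eq_mul, mul_one] at h8
    exact h8.symm

end Generates

end FormalOp

/-! ### The generators in each degree and the conclusion -/

namespace FormalOp

open Hochschild CircleChains

variable {F : Type u} [Field F]

theorem comp_shOp (k n : ℕ) : comp (shOp F k).1 n n = sh F k n :=
  comp_familyOf 0 (fun n => sh F k n) n

theorem comp_bOp (k n : ℕ) : comp (bOp F k).1 n (n + 1) = bsh F k n :=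
  comp_familyOf 1 (fun n => bsh F k n) n

theorem comp_shSum (c : ℕ → F) (n m : ℕ) (hm : (n : ℤ) + 0 = m) :
    comp (shSum c).1 n m = combination (fun k => comp (shOp F k).1) c n m := by
  obtain rfl : n = m := by omega
  refine (comp_familyOf 0 (fun n => ∑ k ∈ Finset.range (n + 1), c k • sh F k n) n).trans ?_
  exact Finset.sum_congr rfl fun k _ => by simp only [comp_shOp]

theorem comp_bSum (c : ℕ → F) (n m : ℕ) (hm : (n : ℤ) + 1 = m) :
    comp (bSum c).1 n m = combination (fun k => comp (bOp F k).1) c n m := by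
  obtain rfl : m = n + 1 := by omega
  refine (comp_familyOf 1 (fun n => ∑ k ∈ Finset.range (n + 1), c k • bsh F k n) n).trans ?_
  exact Finset.sum_congr rfl fun k _ => by simp only [comp_bOp]

theorem exists_comp_bdry_eq_sub {n m : ℕ} {z y : Com F n m} (hz : nproj F n ≫ z = z)
    (hzd : z ≫ dCom F m (m - 1) = 0) (hyd : y ≫ dCom F m (m - 1) = 0) (c : F)
    (h0 : lamZero n m z = c * lamZero n m (nproj F n ≫ y))
    (h1 : lamOne n m z = c * lamOne n m (nproj F n ≫ y)) :
    ∃ w : Com F n (m + 1), nproj F n ≫ w = w ∧ w ≫ bdry F m = z - c • (nproj F n ≫ y) := by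
  refine exists_comp_bdry_eq _ ?_ ?_ ?_ ?_
  · rw [Preadditive.comp_sub, Linear.comp_smul, hz, ← Category.assoc, nproj_idem]
  · rw [Preadditive.sub_comp, Linear.smul_comp, hzd, Category.assoc, hyd, Limits.comp_zero,
      smul_zero, sub_zero]
  · rw [map_sub, map_smul, h0, smul_eq_mul, sub_self]
  · rw [map_sub, map_smul, h1, smul_eq_mul, sub_self]

theorem lamZero_nproj_comp_sh (k : ℕ) : lamZero k k (nproj F k ≫ sh F k k) = 1 := by
  rw [lamZero_nproj_comp (sh_mem_pointedSpan k k), lamZero_sh_self]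

theorem lamOne_nproj_comp_bsh (k : ℕ) : lamOne k (k + 1) (nproj F k ≫ bsh F k k) = 1 := by
  rw [lamOne_nproj_comp, lamOne_bsh_self]

/-- In degree `0` column `k` is in dimension `k`, where `lamOne` vanishes and `lamZero` alone
decides. The element `sh_k^k` is a vertical cycle because `sh^k` vanishes in column `k - 1`. -/
theorem generates_shOp : Generates 0 fun k => comp (shOp F k).1 where
  isCyc k n m hm := by
    obtain rfl : n = m + 1 := by omega
    rw [dHom, Nat.add_sub_cancel, comp_shOp, comp_shOp, dCom_succ, sh_comp_bdry,
      Int.negOnePow_zero, Units.val_one, one_smul, sub_self]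
  eq_zero k n m h hm := by
    obtain rfl : n = m := by omega
    rw [comp_shOp, sh_of_lt F h]
  exists_eq k m z hm hn hz := by
    obtain rfl : k = m := by omega
    rw [comp_shOp]
    refine ⟨lamZero k k z, exists_comp_bdry_eq_sub hn hz ?_ _ ?_ ?_⟩
    · obtain _ | k := k
      · rw [dCom_of_ne (by omega), Limits.comp_zero]
      · rw [Nat.add_sub_cancel, dCom_succ, sh_comp_bdry, sh_of_lt F (Nat.lt_succ_self k),
          Limits.comp_zero]
    · rw [lamZero_nproj_comp_sh, mul_one]
    · rw [lamOne_of_ne (Nat.succ_ne_self k).symm, lamOne_of_ne (Nat.succ_ne_self k).symm, mul_zero]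

/-- In degree `1` column `k` is in dimension `k + 1`, where the roles of the two functionals are
exchanged. -/
theorem generates_bOp : Generates 1 fun k => comp (bOp F k).1 where
  isCyc k n m hm := by
    obtain rfl : n = m := by omega
    rw [dHom, comp_bOp, dCom_succ]
    obtain _ | n := n
    · rw [bsh_comp_bdry_zero, dCom_of_ne (by omega), Limits.zero_comp, smul_zero, sub_zero]
    · rw [Nat.add_sub_cancel, comp_bOp, dCom_succ, bsh_comp_bdry]
      simp
  eq_zero k n m h hm := by
    obtain rfl : m = n + 1 := by omega
    rw [comp_bOp, bsh_of_lt h]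
  exists_eq k m z hm hn hz := by
    obtain rfl : m = k + 1 := by omega
    rw [comp_bOp]
    refine ⟨lamOne k (k + 1) z, exists_comp_bdry_eq_sub hn hz ?_ _ ?_ ?_⟩
    · rw [Nat.add_sub_cancel, dCom_succ]
      obtain _ | k := k
      · exact bsh_comp_bdry_zero 0
      · rw [bsh_comp_bdry, bsh_of_lt (Nat.lt_succ_self k), Limits.comp_zero, neg_zero]
    · rw [lamZero_of_ne (Nat.succ_ne_self k), lamZero_of_ne (Nat.succ_ne_self k), mul_zero]
    · rw [lamOne_nproj_comp_bsh, mul_one]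

/-- In all other degrees both functionals vanish for reasons of dimension, so every normalized
vertical cycle bounds. -/
theorem generates_zero {l : ℤ} (h0 : l ≠ 0) (h1 : l ≠ 1) :
    Generates l fun _ => (0 : ∀ n m : ℕ, Com F n m) where
  isCyc _ n m _ := by
    simp only [dHom, Pi.zero_apply]
    rw [Limits.zero_comp, Limits.comp_zero, smul_zero, sub_zero]
  eq_zero _ _ _ _ _ := rfl
  exists_eq k m z hm hn hz := by
    refine ⟨0, exists_comp_bdry_eq_sub hn hz Limits.zero_comp _ ?_ ?_⟩
    · rw [lamZero_of_ne (by omega), zero_mul]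
    · rw [lamOne_of_ne (by omega), zero_mul]

/-- The class of every cycle is the class of exactly one combination of the generators. -/
theorem existsUnique_hasClass {l l' l'' : ℤ} (hl : l + 1 = l') (hl' : l'' + 1 = l)
    {g : ℕ → ∀ n m : ℕ, Com F n m} (hg : Generates l g) (φ : (ℕ → F) → op F l)
    (hφ : ∀ (c : ℕ → F) (n m : ℕ), (n : ℤ) + l = m → comp (φ c).1 n m = combination g c n m)
    (huniq : ∀ c, IsBdry l (combination g c) → c = 0) :
    (∀ c, ∃ x, HasClass (φ c) x) ∧ ∀ x, ∃! c, HasClass (φ c) x := by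
  have hcyc : ∀ c, ∃ x, HasClass (φ c) x := fun c => by
    refine exists_hasClass hl' ((dOp_eq_zero_iff hl' _).2 fun n m hm => ?_)
    rw [← hg.isCyc_combination c n m (by omega)]
    refine dHom_congr (hφ c n (m + 1) (by push_cast; omega)) ?_
    obtain _ | n := n
    · rw [dCom_of_ne (by omega), Limits.zero_comp, Limits.zero_comp]
    · rw [Nat.add_sub_cancel, hφ c n m (by push_cast at hm; omega)]
  have hbd : ∀ (ψ χ : op F l) x y, HasClass ψ x → HasClass χ y →
      (x = y ↔ IsBdry l (comp ψ.1 - comp χ.1)) := fun ψ χ x y hx hy => by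
    subst hl
    rw [HasClass.iff_boundary rfl hx hy, exists_dOp_eq_iff rfl]
    refine exists_congr fun h => forall_congr' fun n => forall_congr' fun m =>
      imp_congr_right fun _ => ?_
    have e : comp (ψ - χ).1 n m = (comp ψ.1 - comp χ.1) n m := comp_sub ψ.1 χ.1 n m
    rw [e]
  refine ⟨hcyc, fun x => ?_⟩
  obtain ⟨ψ, hψ, hx⟩ := exists_representative hl' x
  obtain ⟨c, hc⟩ := hg.exists_isBdry_sub (f := comp ψ.1) fun n m hm =>
    (dOp_eq_zero_iff hl' ψ).1 hψ n m (by omega)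
  obtain ⟨y, hy⟩ := hcyc c
  have hxy : x = y := (hbd ψ (φ c) x y hx hy).2 (hc.congr fun n m hm => by
    rw [Pi.sub_apply, Pi.sub_apply, Pi.sub_apply, Pi.sub_apply, hφ c n m hm])
  refine ⟨c, by rw [hxy]; exact hy, fun c' hc' => ?_⟩
  have h1 := (hbd (φ c') (φ c) y y (by rw [← hxy]; exact hc') hy).1 rfl
  refine sub_eq_zero.1 (huniq _ (h1.congr fun n m hm => ?_))
  rw [Pi.sub_apply, Pi.sub_apply, hφ c n m hm, hφ c' n m hm, combination, combination,
    combination, ← Finset.sum_sub_distrib]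
  exact Finset.sum_congr rfl fun k _ => (sub_smul _ _ _).symm

theorem isZero_homology_of_generates_zero {l : ℤ}
    (hg : Generates l fun _ => (0 : ∀ n m : ℕ, Com F n m)) :
    Limits.IsZero ((complex F).homology l) := by
  refine isZero_homology (l' := l + 1) (l'' := l - 1) rfl (by omega) fun φ hφ => ?_
  obtain ⟨c, hc⟩ := hg.exists_isBdry_sub (f := comp φ.1) fun n m hm =>
    (dOp_eq_zero_iff (by omega) φ).1 hφ n m (by omega)
  refine (exists_dOp_eq_iff rfl φ).2 (hc.congr fun n m _ => ?_)
  rw [Pi.sub_apply, Pi.sub_apply, combination, Finset.sum_eq_zero, sub_zero]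
  exact fun k _ => smul_zero _

theorem exists_hasClass_shOp (k : ℕ) : ∃ x, HasClass (shOp F k) x := by
  refine exists_hasClass (l' := -1) (by omega) ((dOp_eq_zero_iff _ _).2 fun n m hm => ?_)
  exact generates_shOp.isCyc k n m (by omega)

theorem exists_hasClass_bOp (k : ℕ) : ∃ x, HasClass (bOp F k) x := by
  refine exists_hasClass (l' := 0) (by omega) ((dOp_eq_zero_iff _ _).2 fun n m hm => ?_)
  exact generates_bOp.isCyc k n m (by omega)

end FormalOp

theorem theorem2 (F : Type u) [Field F] :
    (∀ l : ℤ, l ≠ 0 → l ≠ 1 → Limits.IsZero ((FormalOp.complex F).homology l)) ∧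
    ((∀ k : ℕ, ∃ x, FormalOp.HasClass (FormalOp.shOp F k) x) ∧
      (∀ c : ℕ → F, ∃ x, FormalOp.HasClass (FormalOp.shSum c) x) ∧
      ∀ x : (FormalOp.complex F).homology 0, ∃! c : ℕ → F,
        FormalOp.HasClass (FormalOp.shSum c) x) ∧
    ((∀ k : ℕ, ∃ x, FormalOp.HasClass (FormalOp.bOp F k) x) ∧
      (∀ c : ℕ → F, ∃ x, FormalOp.HasClass (FormalOp.bSum c) x) ∧
      ∀ x : (FormalOp.complex F).homology 1, ∃! c : ℕ → F,
        FormalOp.HasClass (FormalOp.bSum c) x) := by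
  refine ⟨fun l h0 h1 => FormalOp.isZero_homology_of_generates_zero
    (FormalOp.generates_zero h0 h1), ⟨FormalOp.exists_hasClass_shOp, ?_⟩,
    ⟨FormalOp.exists_hasClass_bOp, ?_⟩⟩
  · refine FormalOp.existsUnique_hasClass (l' := 1) (l'' := -1) (by omega) (by omega)
      FormalOp.generates_shOp FormalOp.shSum FormalOp.comp_shSum fun c hc => ?_
    -- A filling in degree `1` is controlled by the generators `B^k`, and in the case below a
    -- filling in degree `2` has no generators at all.
    refine FormalOp.Generates.eq_zero_of_isBdry (l := 0) FormalOp.generates_bOp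
      CircleChains.lamZero (fun n m => CircleChains.lamZero_comp_bdry) (fun k m hm => ?_)
      le_rfl hc
    obtain rfl : k = m := by omega
    rw [FormalOp.comp_shOp, FormalOp.lamZero_nproj_comp_sh]
  · refine FormalOp.existsUnique_hasClass (l' := 2) (l'' := 0) (by omega) (by omega)
      FormalOp.generates_bOp FormalOp.bSum FormalOp.comp_bSum fun c hc => ?_
    refine FormalOp.Generates.eq_zero_of_isBdry (l := 1)
      (FormalOp.generates_zero (by omega) (by omega))
      CircleChains.lamOne (fun n m => CircleChains.lamOne_comp_bdry) (fun k m hm => ?_)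
      zero_le_one hc
    obtain rfl : m = k + 1 := by omega
    rw [FormalOp.comp_bOp, FormalOp.lamOne_nproj_comp_bsh]
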